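/- **Theorem 3.2.** Let $r\ge 3$ be an integer, $A=\sqrt{-1}\,e^{-2\pi i/4r}$ and $\delta=-A^2-A^{-2}=2\cos(\pi/r)$. *The modular functor $\mathbf{CSr}$ on punctured disks.* Let $\mathcal S_N$ be the Kauffman bracket skein space of a disk with $N$ boundary points: the complex vector space with basis the crossingless perfect matchings of the $N$ points, with the Hermitian form $\langle s,t\rangle_h=\delta^{\ell(s,t)}$ on basis elements (linear in $s$, conjugate linear in $t$), where $\ell(s,t)$ is the number of loops formed by gluing the disk with $s$ to the mirror image of the disk with $t$. Let $U_j$ act on $\mathcal S_N$ by gluing on the diagram $\cup\cap$ at the points $j,j+1$, each closed loop being replaced by $\delta$. For $0\le m\le r-2$ let $V(D_n^m)$, the state space of the disk with $n$ interior punctures labelled $1$ and boundary labelled $m$, be the image in $\mathcal S_{n+m}$ of the $m$-th Jones–Wenzl idempotent placed on the last $m$ points, modulo the radical of $\langle\,,\rangle_h$. Fix a handedness of half twists, i.e. $a\in\{A,A^{-1}\}$; the half twist $\sigma_j$ acts by gluing on a crossing, i.e. by $a\,\mathrm{id}+a^{-1}U_j$. Denote the resulting action by $\rho_r$: for $m\ne1$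 the mapping class group of $D_n^m$ is the braid group $B_n=\langle\sigma_1,\dots,\sigma_{n-1}\rangle$; for $m=1$ it is the mapping class group $\mathcal M(0,n+1)$ of the $(n+1)$-punctured sphere, generated by $\sigma_1,\dots,\sigma_n$ subject to the braid relations and $\sigma_1\cdots\sigma_n\sigma_n\cdots\sigma_1=1=(\sigma_1\cdots\sigma_n)^{n+1}$, acting projectively (up to phase). *The Jones sectors.* Let $q=a^4$ (so $q=e^{2\pi i/r}$ for $a=A^{-1}$ and $q=A^4=e^{-2\pi i/r}$ for $a=A$) and $[k]=\sin(k\pi/r)/\sin(\pi/r)$. For a Young diagram $\lambda=[\lambda_1,\lambda_2]$ with $n$ boxes and $\lambda_1-\lambda_2\le r-2$, let $T_\lambda^{(2,r)}$ be the set of standard tableaux of shape $\lambda$ such that for each $k\le n$ the boxes with entries $\le k$ form a diagram $[\nu_1,\nu_2]$ with $\nu_1-\nu_2\le r-2$. The sector $\rho_{\lambda,\beta,n}$ (where $\beta=[2]^2$) is the unitary representation of $B_n$ on the Hilbert space with orthonormal basis $\{v_t:t\in T_\lambda^{(2,r)}\}$ given by $\sigma_i\mapsto q-(1+q)e_i$,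 where $e_iv_t=\alpha v_t+\sqrt{\alpha(1-\alpha)}\,v_{g_i(t)}$, $\alpha=\frac{[d+1]}{[2][d]}$, $d=c_1-c_2-(r_1-r_2)$, the entries $i$ and $i+1$ of $t$ are in row and column $(r_1,c_1)$ and $(r_2,c_2)$, and $g_i(t)$ is $t$ with $i$ and $i+1$ exchanged (the second term is omitted if $g_i(t)\notin T_\lambda^{(2,r)}$). Then all these representations are well defined, $\rho_r$ preserves $\langle\,,\rangle_h$, and: (1) If $0\le m\le\min(r-2,n)$, $m\neq1$ and $m+n$ is even, then $\rho_r:B_n\to \mathbf U(V(D_n^m))$ is unitarily equivalent, up to phase, to $\rho_{\lambda,\beta,n}$ for $\lambda=[\frac{m+n}{2},\frac{n-m}{2}]$: there are a linear isomorphism $S$ carrying $\langle\,,\rangle_h$ to the standard inner product (so $\langle\,,\rangle_h$ is positive definite on $V(D_n^m)$) and a homomorphism $\chi:B_n\to U(1)$ with $S\rho_r(b)S^{-1}=\chi(b)\rho_{\lambda,\beta,n}(b)$ for all $b\in B_n$. (2) If $n$ is odd and $m=1$, then the composition of the projective representation $\rho_r$ of $\mathcal M(0,n+1)$ with the natural map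 $\iota:B_n\to\mathcal M(0,n+1)$, $\sigma_i\mapsto\sigma_i$, is unitarily equivalent, up to phase, to $\rho_{\lambda,\beta,n}$ for $\lambda=[\frac{n+1}{2},\frac{n-1}{2}]$: there is a linear isomorphism $S$ carrying $\langle\,,\rangle_h$ to the standard inner product such that, for every $b\in B_n$ and every unitary $u$ representing $\rho_r(\iota(b))$, $SuS^{-1}=z\,\rho_{\lambda,\beta,n}(b)$ for some $z\in U(1)$. -/

import Mathlib

open scoped ComplexConjugate

noncomputable section

namespace CSJones

/-! ### Braid groups and mapping class groups of punctured spheres -/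

/-- Relations of Artin's braid group, as words in generators `σ_0, …, σ_{k-1}`. -/
def braidRels (k : ℕ) : Set (FreeGroup (Fin k)) :=
  {w | ∃ i j : Fin k, (i : ℕ) + 1 < j ∧
      w = FreeGroup.of i * FreeGroup.of j * (FreeGroup.of i)⁻¹ * (FreeGroup.of j)⁻¹} ∪
  {w | ∃ i j : Fin k, (i : ℕ) + 1 = j ∧
      w = (FreeGroup.of i * FreeGroup.of j * FreeGroup.of i) *
        (FreeGroup.of j * FreeGroup.of i * FreeGroup.of j)⁻¹}

/-- The braid group `B_n` on `n` strands, generators `σ_0, …, σ_{n-2}`. -/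
abbrev BraidGroup (n : ℕ) : Type := PresentedGroup (braidRels (n - 1))

/-- The word `σ_0 σ_1 ⋯ σ_{k-1}`. -/
def coxeterWord (k : ℕ) : FreeGroup (Fin k) :=
  (List.ofFn fun i : Fin k => FreeGroup.of i).prod

/-- The word `σ_{k-1} ⋯ σ_1 σ_0`. -/
def coxeterWordRev (k : ℕ) : FreeGroup (Fin k) :=
  (List.ofFn fun i : Fin k => FreeGroup.of i).reverse.prod

/-- Relations of the mapping class group of the sphere with `k + 1` punctures:
the braid relations, `σ_0 ⋯ σ_{k-1} σ_{k-1} ⋯ σ_0 = 1` and `(σ_0 ⋯ σ_{k-1}) ^ (k + 1) = 1`. -/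
def sphereRels (k : ℕ) : Set (FreeGroup (Fin k)) :=
  braidRels k ∪ {coxeterWord k * coxeterWordRev k, coxeterWord k ^ (k + 1)}

/-- The mapping class group `M(0, N)` of the sphere with `N` (unordered) punctures. -/
abbrev SphereMCG (N : ℕ) : Type := PresentedGroup (sphereRels (N - 1))

/-- The images of the standard generators of `B_n` in `M(0, n + 1)`. -/
def inclGen (n : ℕ) (i : Fin (n - 1)) : SphereMCG (n + 1) :=
  PresentedGroup.of ⟨i, by omega⟩

theorem inclGen_rels (n : ℕ) : ∀ w ∈ braidRels (n - 1), FreeGroup.lift (inclGen n) w = 1 := by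
  have key : ∀ w ∈ braidRels n, PresentedGroup.mk (sphereRels (n + 1 - 1)) w = 1 := by
    intro w hw
    exact PresentedGroup.one_of_mem (Or.inl hw)
  rintro w (⟨i, j, hij, rfl⟩ | ⟨i, j, hij, rfl⟩)
  · have := key _ (Or.inl ⟨⟨i, by omega⟩, ⟨j, by omega⟩, hij, rfl⟩)
    simpa [inclGen, PresentedGroup.of] using this
  · have := key _ (Or.inr ⟨⟨i, by omega⟩, ⟨j, by omega⟩, hij, rfl⟩)
    simpa [inclGen, PresentedGroup.of] using this

/-- The natural map `ι : B_n → M(0, n + 1)`, `σ_i ↦ σ_i`, where the boundary of the disk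
becomes the last puncture. -/
def braidToSphere (n : ℕ) : BraidGroup n →* SphereMCG (n + 1) :=
  PresentedGroup.toGroup (inclGen_rels n)

/-! ### The Kauffman bracket skein space of a disk with boundary points -/

/-- `A = √-1 · exp (-2πi / 4r)`. -/
def kauffmanA (r : ℕ) : ℂ :=
  Complex.I * Complex.exp (-(2 * Real.pi * Complex.I) / (4 * r))

/-- The value `-A² - A⁻²` of a closed loop. -/
def loopValue (r : ℕ) : ℂ := -(kauffmanA r) ^ 2 - ((kauffmanA r)⁻¹) ^ 2

theorem conj_kauffmanA (r : ℕ) : conj (kauffmanA r) = (kauffmanA r)⁻¹ := by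
  have h : ((2 * Real.pi * Complex.I) / (4 * r) : ℂ)
      = ((2 * Real.pi / (4 * r) : ℝ) : ℂ) * Complex.I := by push_cast; ring
  rw [kauffmanA, neg_div, h, map_mul, ← Complex.exp_conj, mul_inv, Complex.inv_I,
    ← Complex.exp_neg, map_neg, map_mul, Complex.conj_ofReal, Complex.conj_I]
  ring_nf

theorem conj_loopValue (r : ℕ) : conj (loopValue r) = loopValue r := by
  simp only [loopValue, map_sub, map_neg, map_pow, map_inv₀, conj_kauffmanA, inv_inv]
  ring

/-- A crossingless perfect matching of `N` points on the boundary of a disk, that is, a simple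
tangle diagram without closed loops, up to isotopy. `partner x` is the other end of the arc
at `x`. -/
@[ext]
structure PlanarMatching (N : ℕ) where
  partner : Equiv.Perm (Fin N)
  invol : ∀ x, partner (partner x) = x
  noFix : ∀ x, partner x ≠ x
  planar : ∀ x y, ¬ (x < y ∧ y < partner x ∧ partner x < partner y)

instance (N : ℕ) : Finite (PlanarMatching N) :=
  Finite.of_injective PlanarMatching.partner fun _ _ h => PlanarMatching.ext h

instance (N : ℕ) : Fintype (PlanarMatching N) := Fintype.ofFinite _

theorem glue_apply {N : ℕ} (p : Equiv.Perm (Fin N)) (invol : ∀ z, p (p z) = z)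
    (noFix : ∀ z, p z ≠ z) (x y : Fin N) (hxy : x ≠ y) (z : Fin N) :
    (Equiv.swap (p x) y * p * Equiv.swap (p x) y) z =
      if z = x then y else if z = y then x else if z = p x then p y else
        if z = p y then p x else p z := by
  have h1 := invol x
  have h2 := invol y
  have h3 := noFix x
  have h4 := noFix y
  have h5 : ∀ u v, p u = p v → u = v := fun u v h => p.injective h
  simp only [Equiv.Perm.mul_apply, Equiv.swap_apply_def]
  grind

theorem planar_glue {N : ℕ} (p : Equiv.Perm (Fin N)) (invol : ∀ z, p (p z) = z)
    (noFix : ∀ z, p z ≠ z) (planar : ∀ x y, ¬ (x < y ∧ y < p x ∧ p x < p y))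
    (x y : Fin N) (hxy : (x : ℕ) + 1 = y) (z w : Fin N) :
    ¬ (z < w ∧ w < (Equiv.swap (p x) y * p * Equiv.swap (p x) y) z ∧
      (Equiv.swap (p x) y * p * Equiv.swap (p x) y) z <
        (Equiv.swap (p x) y * p * Equiv.swap (p x) y) w) := by
  have hne : x ≠ y := by intro h; rw [h] at hxy; omega
  rw [glue_apply p invol noFix x y hne, glue_apply p invol noFix x y hne]
  have P : ∀ u v : Fin N, ¬ ((u : ℕ) < v ∧ (v : ℕ) < p u ∧ (p u : ℕ) < p v) ∧
      ¬ ((p u : ℕ) < v ∧ (v : ℕ) < u ∧ (u : ℕ) < p v) ∧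
      ¬ ((u : ℕ) < p v ∧ (p v : ℕ) < p u ∧ (p u : ℕ) < v) ∧
      ¬ ((p u : ℕ) < p v ∧ (p v : ℕ) < u ∧ (u : ℕ) < v) := by
    intro u v
    refine ⟨planar u v, ?_, ?_, ?_⟩
    · simpa [invol] using planar (p u) v
    · simpa [invol] using planar u (p v)
    · simpa [invol] using planar (p u) (p v)
  have ne : ∀ v, v ≠ x → v ≠ y → v ≠ p x → v ≠ p y →
      (v : ℕ) ≠ x ∧ (v : ℕ) ≠ y ∧ (p v : ℕ) ≠ x ∧ (p v : ℕ) ≠ y ∧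
      (v : ℕ) ≠ p x ∧ (v : ℕ) ≠ p y ∧ (p v : ℕ) ≠ p x ∧ (p v : ℕ) ≠ p y := by
    intro v h1 h2 h3 h4
    refine ⟨?_, ?_, ?_, ?_, ?_, ?_, ?_, ?_⟩ <;> intro h <;> have h' := Fin.ext h <;> grind
  have hxp : (p x : ℕ) ≠ x := fun h => noFix x (Fin.ext h)
  have hyp : (p y : ℕ) ≠ y := fun h => noFix y (Fin.ext h)
  rintro ⟨h1, h2, h3⟩
  simp only [Fin.lt_def] at h1 h2 h3
  by_cases zx : z = x
  · rw [if_pos zx] at h2; subst zx; omega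
  by_cases zy : z = y
  · rw [if_neg zx, if_pos zy] at h2; subst zy; omega
  rw [if_neg zx, if_neg zy] at h2 h3
  by_cases wx : w = x
  · rw [if_pos wx] at h3; subst wx; omega
  by_cases wy : w = y
  · rw [if_neg wx, if_pos wy] at h3; subst wy; omega
  rw [if_neg wx, if_neg wy] at h3
  have Q1 := And.intro (P x w) (P w x)
  have Q2 := And.intro (P y w) (P w y)
  have Q3 := And.intro (P z x) (P x z)
  have Q4 := And.intro (P z y) (P y z)
  by_cases za : z = p x
  · rw [if_pos za] at h2 h3
    by_cases wb : w = p y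
    · subst wb; omega
    · have wa : w ≠ p x := by intro h; rw [h, ← za] at h1; omega
      rw [if_neg wa, if_neg wb] at h3
      have := ne w wx wy wa wb
      rw [za] at h1
      clear Q3 Q4 P
      omega
  by_cases zb : z = p y
  · rw [if_neg za, if_pos zb] at h2 h3
    by_cases wa : w = p x
    · subst wa; omega
    · have wb : w ≠ p y := by intro h; rw [h, ← zb] at h1; omega
      rw [if_neg wa, if_neg wb] at h3
      have := ne w wx wy wa wb
      rw [zb] at h1
      clear Q3 Q4 P
      omega
  rw [if_neg za, if_neg zb] at h2 h3
  have nz := ne z zx zy za zb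
  by_cases wa : w = p x
  · rw [if_pos wa] at h3
    rw [wa] at h1 h2
    clear Q1 Q2 P
    omega
  by_cases wb : w = p y
  · rw [if_neg wa, if_pos wb] at h3
    rw [wb] at h1 h2
    clear Q1 Q2 P
    omega
  rw [if_neg wa, if_neg wb] at h3
  exact planar z w ⟨h1, h2, h3⟩

/-- Glue the diagram `∪∩` to a matching at two neighbouring points `x`, `y`: in the result `x`
is joined to `y`, and the former partners of `x` and `y` are joined to each other. -/
def glueArc {N : ℕ} (f : PlanarMatching N) (x y : Fin N) (h : (x : ℕ) + 1 = y) :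
    PlanarMatching N where
  partner := Equiv.swap (f.partner x) y * f.partner * Equiv.swap (f.partner x) y
  invol z := by simp [f.invol]
  noFix z hz := by
    apply f.noFix (Equiv.swap (f.partner x) y z)
    apply (Equiv.swap (f.partner x) y).injective
    simpa using hz
  planar := planar_glue f.partner f.invol f.noFix f.planar x y h

instance (N : ℕ) : DecidableEq (PlanarMatching N) := Classical.decEq _

/-- The skein space of a disk with `N` boundary points: crossings and closed loops being
removed by the Kauffman bracket relations, the crossingless matchings form a basis, and an
element is given by its coefficients. -/
abbrev Skein (N : ℕ) : Type := PlanarMatching N → ℂ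

/-- Stacking the Temperley-Lieb diagram `U_j` (`∪∩` at the points `j`, `j + 1`) on a skein;
a loop is created exactly if `j` and `j + 1` were already joined. -/
def cupCap (r N j : ℕ) : Skein N →ₗ[ℂ] Skein N :=
  if h : j + 1 < N then
    Fintype.linearCombination ℂ fun f : PlanarMatching N =>
      (if f.partner ⟨j, by omega⟩ = ⟨j + 1, h⟩ then loopValue r else 1) •
        Pi.single (glueArc f ⟨j, by omega⟩ ⟨j + 1, h⟩ rfl) (1 : ℂ)
  else 0

/-- Stacking a crossing between the strands `j` and `j + 1`, resolved by the Kauffman bracket: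
`a • (identity) + a⁻¹ • U_j`. For `a = A` and `a = A⁻¹` these are the two crossings. -/
def crossing (r N : ℕ) (a : ℂ) (j : ℕ) : Skein N →ₗ[ℂ] Skein N :=
  a • LinearMap.id + a⁻¹ • cupCap r N j

/-- `Δ_k`, the bracket of the closure of the `k`-th Jones-Wenzl idempotent. -/
def chebyshevDelta (r : ℕ) : ℕ → ℂ
  | 0 => 1
  | 1 => loopValue r
  | k + 2 => loopValue r * chebyshevDelta r (k + 1) - chebyshevDelta r k

/-- Stacking the `k`-th Jones-Wenzl idempotent on the strands `s, …, s + k - 1`: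
`p_{k+1} = p_k - (Δ_{k-1} / Δ_k) p_k U_k p_k`. -/
def jonesWenzl (r N s : ℕ) : ℕ → (Skein N →ₗ[ℂ] Skein N)
  | 0 => LinearMap.id
  | 1 => LinearMap.id
  | k + 2 => jonesWenzl r N s (k + 1) -
      (chebyshevDelta r k / chebyshevDelta r (k + 1)) •
        (jonesWenzl r N s (k + 1) ∘ₗ cupCap r N (s + k) ∘ₗ jonesWenzl r N s (k + 1))

/-- The number of closed loops obtained by gluing two disks along their boundaries. -/
def loops {N : ℕ} (f g : PlanarMatching N) : ℕ :=
  Nat.card (Quotient (Relation.EqvGen.setoid fun x y : Fin N =>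
    f.partner x = y ∨ g.partner x = y))

theorem loops_comm {N : ℕ} (f g : PlanarMatching N) : loops f g = loops g f := by
  unfold loops
  simp only [or_comm]

/-- The Hermitian form `⟨s, t⟩_h`: Kauffman bracket evaluation of `s` glued to the mirror image
of `t`, extended linearly in `s` and conjugate linearly in `t`. -/
def bracketForm (r : ℕ) {N : ℕ} (x y : Skein N) : ℂ :=
  ∑ f, ∑ g, x f * conj (y g) * loopValue r ^ loops f g

theorem bracketForm_add_left (r : ℕ) {N : ℕ} (x x' y : Skein N) :
    bracketForm r (x + x') y = bracketForm r x y + bracketForm r x' y := by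
  simp [bracketForm, add_mul, Finset.sum_add_distrib]

theorem bracketForm_smul_left (r : ℕ) {N : ℕ} (c : ℂ) (x y : Skein N) :
    bracketForm r (c • x) y = c * bracketForm r x y := by
  simp [bracketForm, Finset.mul_sum, mul_assoc]

theorem bracketForm_conj (r : ℕ) {N : ℕ} (x y : Skein N) :
    conj (bracketForm r x y) = bracketForm r y x := by
  unfold bracketForm
  rw [Finset.sum_comm]
  simp only [map_sum, map_mul, map_pow, conj_loopValue, Complex.conj_conj]
  refine Finset.sum_congr rfl fun g _ => Finset.sum_congr rfl fun f _ => ?_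
  rw [loops_comm, mul_comm (conj (x f))]

/-! ### The state space of the punctured disk and its unitary group -/

/-- Skeins in the disk with `n` points labelled `1` and one point labelled `m`, i.e. an
`m`-strand cable carrying the Jones-Wenzl idempotent. -/
def labelledSkein (r n m : ℕ) : Submodule ℂ (Skein (n + m)) :=
  LinearMap.range (jonesWenzl r (n + m) n m)

/-- The radical of the Hermitian form on `labelledSkein r n m`. -/
def radical (r n m : ℕ) : Submodule ℂ (labelledSkein r n m) where
  carrier := {x | ∀ y : labelledSkein r n m, bracketForm r (x : Skein (n + m)) y = 0}
  zero_mem' y := by simp [bracketForm]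
  add_mem' {x x'} hx hx' y := by
    rw [Submodule.coe_add, bracketForm_add_left, hx y, hx' y, add_zero]
  smul_mem' c x hx y := by
    rw [Submodule.coe_smul, bracketForm_smul_left, hx y, mul_zero]

/-- The state space `V(D_n^m)` of the disk with `n` interior punctures labelled `1` and boundary
labelled `m` in the modular functor `CSr`. -/
abbrev StateSpace (r n m : ℕ) : Type := labelledSkein r n m ⧸ radical r n m

/-- The Hermitian form on the state space, induced by `bracketForm`. -/
def stateForm (r n m : ℕ) (u v : StateSpace r n m) : ℂ :=
  Quotient.liftOn₂' u v
    (fun x y => bracketForm r (x : Skein (n + m)) (y : Skein (n + m))) (by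
      intro x y x' y' hx hy
      rw [Submodule.quotientRel_def] at hx hy
      have h1 := hx y
      have h2 := hy x'
      have e1 : (x : Skein (n + m)) = (x - x' : labelledSkein r n m) + x' := by simp
      have e2 : (y : Skein (n + m)) = (y - y' : labelledSkein r n m) + y' := by simp
      change bracketForm r (x : Skein (n + m)) y = bracketForm r (x' : Skein (n + m)) y'
      rw [e1, bracketForm_add_left, h1, zero_add, ← bracketForm_conj, e2, bracketForm_add_left,
        h2, zero_add, bracketForm_conj])

/-- The linear automorphisms of `V(D_n^m)` preserving the Hermitian form. -/
def stateUnitary (r n m : ℕ) : Subgroup (StateSpace r n m ≃ₗ[ℂ] StateSpace r n m) where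
  carrier := {u | ∀ v w, stateForm r n m (u v) (u w) = stateForm r n m v w}
  one_mem' _ _ := rfl
  mul_mem' {u u'} hu hu' v w := by
    rw [LinearEquiv.mul_apply, LinearEquiv.mul_apply, hu, hu']
  inv_mem' {u} hu v w := by
    have := hu (u⁻¹ v) (u⁻¹ w)
    rw [← LinearEquiv.mul_apply, ← LinearEquiv.mul_apply, mul_inv_cancel] at this
    exact this.symm

/-- The subgroup of phases (multiplications by complex numbers of modulus one). -/
def phases (r n m : ℕ) : Subgroup (stateUnitary r n m) where
  carrier := {u | ∃ z : Circle, ∀ v, u.1 v = (z : ℂ) • v}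
  one_mem' := ⟨1, fun v => by simp⟩
  mul_mem' := by
    rintro u u' ⟨z, hz⟩ ⟨z', hz'⟩
    refine ⟨z * z', fun v => ?_⟩
    rw [Subgroup.coe_mul, LinearEquiv.mul_apply, hz', hz, smul_smul, Circle.coe_mul]
  inv_mem' := by
    rintro u ⟨z, hz⟩
    refine ⟨z⁻¹, fun v => ?_⟩
    apply u.1.injective
    have h1 : u.1 ((u⁻¹).1 v) = v := by
      rw [Subgroup.coe_inv, ← LinearEquiv.mul_apply, mul_inv_cancel, LinearEquiv.coe_one, id]
    have h2 : u.1 (((z⁻¹ : Circle) : ℂ) • v) = v := by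
      rw [map_smul, hz, smul_smul, Circle.coe_inv, inv_mul_cancel₀ z.coe_ne_zero, one_smul]
    exact h1.trans h2.symm

instance (r n m : ℕ) : (phases r n m).Normal where
  conj_mem := by
    rintro u ⟨z, hz⟩ g
    refine ⟨z, fun v => ?_⟩
    rw [Subgroup.coe_mul, Subgroup.coe_mul, LinearEquiv.mul_apply, LinearEquiv.mul_apply, hz,
      map_smul, Subgroup.coe_inv, ← LinearEquiv.mul_apply, mul_inv_cancel, LinearEquiv.coe_one, id]

/-- The projective unitary group of the state space. -/
abbrev ProjStateUnitary (r n m : ℕ) : Type := stateUnitary r n m ⧸ phases r n m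

/-- `u` is the operator induced on the state space by the operator `T` on skeins; this includes
that `T` preserves the labelled skeins. -/
def IsInducedBy (r n m : ℕ) (u : stateUnitary r n m)
    (T : Skein (n + m) →ₗ[ℂ] Skein (n + m)) : Prop :=
  ∀ x : labelledSkein r n m, ∃ y : labelledSkein r n m,
    (y : Skein (n + m)) = T x ∧
      u.1 (Submodule.Quotient.mk x) = (Submodule.Quotient.mk y : StateSpace r n m)

/-- `ρ` is the representation of `B_n` on `V(D_n^m)` given by `CSr` (with blackboard framing):
each half twist `σ_i` acts by gluing on the corresponding crossing. -/
def IsBraidAction (r n m : ℕ) (a : ℂ) (ρ : BraidGroup n →* stateUnitary r n m) : Prop :=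
  ∀ i : Fin (n - 1), IsInducedBy r n m (ρ (PresentedGroup.of i)) (crossing r (n + m) a i)

/-- `ρ` is the projective representation of `M(0, n + 1)` on `V(D_n^1)` given by `CSr`; here the
`n + 1` punctures of the sphere all have label `1`, and each half twist `σ_i` acts by gluing on
the corresponding crossing, up to phase. -/
def IsSphereAction (r n : ℕ) (a : ℂ) (ρ : SphereMCG (n + 1) →* ProjStateUnitary r n 1) : Prop :=
  ∀ i : Fin (n + 1 - 1), ∃ u : stateUnitary r n 1,
    IsInducedBy r n 1 u (crossing r (n + 1) a i) ∧
      ρ (PresentedGroup.of i) = (QuotientGroup.mk u : ProjStateUnitary r n 1)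

/-! ### Sectors of the Jones representation -/

/-- The quantum integer `[k] = (q^{k/2} - q^{-k/2}) / (q^{1/2} - q^{-1/2})`, which is
`sin (kπ/r) / sin (π/r)` for `q^{1/2} = exp (± πi/r)`. -/
def quantumInt (r : ℕ) (k : ℤ) : ℝ := Real.sin (k * Real.pi / r) / Real.sin (Real.pi / r)

theorem quantumInt_eq (r : ℕ) (k : ℤ) (s : ℂ)
    (hs : s = Complex.exp (Real.pi * Complex.I / r) ∨
      s = Complex.exp (-(Real.pi * Complex.I / r))) :
    (quantumInt r k : ℂ) = (s ^ k - s ^ (-k)) / (s - s⁻¹) := by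
  have key : ∀ t : ℂ, Complex.exp (Complex.I * t) - Complex.exp (-(Complex.I * t)) =
      2 * Complex.I * Complex.sin t := by
    intro t
    rw [Complex.sin]
    have := Complex.I_sq
    ring_nf
    simp only [this]
    ring_nf
  have e1 : (Real.pi * Complex.I / r : ℂ) = Complex.I * (Real.pi / r) := by ring
  have e2 : ∀ k : ℤ, (k * (Complex.I * (Real.pi / r)) : ℂ) = Complex.I * (k * Real.pi / r) := by
    intro k; ring
  have hI : (2 * Complex.I : ℂ) ≠ 0 := by simp
  have main : (quantumInt r k : ℂ) =
      (Complex.exp (Real.pi * Complex.I / r) ^ k - Complex.exp (Real.pi * Complex.I / r) ^ (-k)) /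
      (Complex.exp (Real.pi * Complex.I / r) - (Complex.exp (Real.pi * Complex.I / r))⁻¹) := by
    rw [zpow_neg, ← Complex.exp_int_mul, ← Complex.exp_neg, ← Complex.exp_neg, e1, e2, key, key,
      mul_div_mul_left _ _ hI, quantumInt]
    push_cast
    rfl
  rcases hs with rfl | rfl
  · exact main
  · rw [main, Complex.exp_neg, inv_zpow, inv_zpow, zpow_neg, inv_inv, inv_inv, ← neg_div_neg_eq, neg_sub, neg_sub]

/-- `μ` is a `(2, r)` diagram: at most two rows, and `μ_1 - μ_2 ≤ r - 2`. -/
def IsTwoRow (r : ℕ) (μ : YoungDiagram) : Prop :=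
  μ.colLen 0 ≤ 2 ∧ (μ.rowLen 0 : ℤ) - μ.rowLen 1 ≤ (r : ℤ) - 2

/-- Standard tableaux with `n` entries of shape `μ`; `cell a` is the cell containing the entry
`a + 1`, as a pair (row, column). -/
@[ext]
structure StdTableau (μ : YoungDiagram) (n : ℕ) where
  cell : Fin n ≃ {c : ℕ × ℕ // c ∈ μ.cells}
  row_lt : ∀ a b, (cell a).1.1 = (cell b).1.1 → (cell a).1.2 < (cell b).1.2 → a < b
  col_lt : ∀ a b, (cell a).1.2 = (cell b).1.2 → (cell a).1.1 < (cell b).1.1 → a < b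

/-- The cells that remain when all but the entries `1, …, k` are deleted. -/
def StdTableau.remaining {μ : YoungDiagram} {n : ℕ} (t : StdTableau μ n) (k : ℕ) :
    Finset (ℕ × ℕ) :=
  (Finset.univ.filter fun a : Fin n => (a : ℕ) < k).image fun a => (t.cell a).1

/-- `T_μ^{(2,r)}`: standard tableaux all of whose truncations have `(2, r)` diagrams as shapes. -/
def Tab (r : ℕ) (μ : YoungDiagram) (n : ℕ) : Type :=
  {t : StdTableau μ n // ∀ k ≤ n, ∃ ν : YoungDiagram, ν.cells = t.remaining k ∧ IsTwoRow r ν}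

instance (r : ℕ) (μ : YoungDiagram) (n : ℕ) : Finite (Tab r μ n) :=
  Finite.of_injective (fun t : Tab r μ n => t.1.cell)
    fun _ _ h => Subtype.ext (StdTableau.ext h)

instance (r : ℕ) (μ : YoungDiagram) (n : ℕ) : Fintype (Tab r μ n) := Fintype.ofFinite _

instance (r : ℕ) (μ : YoungDiagram) (n : ℕ) : DecidableEq (Tab r μ n) := Classical.decEq _

/-- `d_{t,i} = c_1 - c_2 - (r_1 - r_2)` for the entries in positions `a`, `b`. -/
def Tab.axial {r : ℕ} {μ : YoungDiagram} {n : ℕ} (t : Tab r μ n) (a b : Fin n) : ℤ :=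
  ((t.1.cell a).1.2 - (t.1.cell b).1.2 : ℤ) - ((t.1.cell a).1.1 - (t.1.cell b).1.1)

/-- `α_{t,i} = [d + 1] / ([2] [d])`. -/
def Tab.alpha {r : ℕ} {μ : YoungDiagram} {n : ℕ} (t : Tab r μ n) (a b : Fin n) : ℝ :=
  quantumInt r (t.axial a b + 1) / (quantumInt r 2 * quantumInt r (t.axial a b))

/-- `β_{t,i} = √(α (1 - α))`. -/
def Tab.beta {r : ℕ} {μ : YoungDiagram} {n : ℕ} (t : Tab r μ n) (a b : Fin n) : ℝ :=
  √(t.alpha a b * (1 - t.alpha a b))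

open Classical in
/-- The matrix of `π_μ^{(2,r)}(e_i)`, for consecutive entries `a`, `b`: the column of `t` is
`α v_t + β v_{g(t)}`, where `g(t)` is `t` with the two entries switched, and the second term is
absent if `g(t)` does not belong to `T_μ^{(2,r)}`. -/
def projMatrix (r : ℕ) (μ : YoungDiagram) (n : ℕ) (a b : Fin n) :
    Matrix (Tab r μ n) (Tab r μ n) ℂ :=
  Matrix.of fun s t =>
    (if s = t then (t.alpha a b : ℂ) else 0) +
      (if ∀ c, s.1.cell c = t.1.cell (Equiv.swap a b c) then (t.beta a b : ℂ) else 0)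

/-- `ρ` is the sector of the Jones representation of `B_n` at `q` for the diagram `μ`:
`σ_i ↦ q - (1 + q) e_i`. -/
def IsJonesSector (r : ℕ) (q : ℂ) (μ : YoungDiagram) (n : ℕ)
    (ρ : BraidGroup n →* Matrix.unitaryGroup (Tab r μ n) ℂ) : Prop :=
  ∀ i : Fin (n - 1), (ρ (PresentedGroup.of i) : Matrix (Tab r μ n) (Tab r μ n) ℂ) =
    q • (1 : Matrix (Tab r μ n) (Tab r μ n) ℂ) -
      (1 + q) • projMatrix r μ n ⟨i, by omega⟩ ⟨i + 1, by omega⟩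

/-- The Young diagram `[a, b]` for `b ≤ a`. -/
def twoRowDiagram (a b : ℕ) (h : b ≤ a) : YoungDiagram :=
  YoungDiagram.ofRowLens [a, b] (by
    simpa [List.sortedGE_iff_pairwise] using h)

/-- `S` is unitary from the state space to `ℂ^T` with its standard inner product. -/
def IsUnitaryIso (r n m : ℕ) {T : Type} [Fintype T] (S : StateSpace r n m ≃ₗ[ℂ] (T → ℂ)) : Prop :=
  ∀ v w, stateForm r n m v w = S v ⬝ᵥ star (S w)

end CSJones

end

/-!
The crossing is a combination of the identity and a Temperley-Lieb generator `U_j`, and so is the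
Jones generator, with the projection `e_j` in place of `U_j / δ`. It therefore suffices to match
the `U_j` on `V(D_n^m)` with the `δ e_j` isometrically; the two crossings then differ by the scalar
`a⁻³`. A crossingless matching expands as a vector on lattice paths `h` of height at most `r - 2`:
a path counts when it makes opposite steps at the two ends of each arc, and an arc along which it
moves from height `k` to height `l` contributes the weight `√([l + 1] / [k + 1])`. This carries
`U_j` to the path operators and loop counting to the standard inner product, and it is onto, because
a path is reached from the lowest one by adding peaks. The image of the Jones-Wenzl idempotent
consists of the vectors supported on the paths that descend at the last `m` steps; the remaining `n`
steps are the standard tableaux of shape `λ`.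

For `m = 1`, the words `σ_1 ⋯ σ_n σ_n ⋯ σ_1` and `(σ_1 ⋯ σ_n) ^ (n + 1)` act by operators that
commute with `U_2, …, U_n`. Such an operator is a scalar: the skeins on which `U_3, U_5, …, U_n` act
by `δ` are the multiples of the matching that joins the points in consecutive pairs, so it sends
this matching to a multiple of itself, and `U_2, …, U_n` generate every skein from this matching.
Hence the relations of the sphere hold up to phase.
-/

namespace CSJones

/-! ### Temperley-Lieb generators -/

section TemperleyLieb

open Polynomial.Chebyshev

variable {K R : Type*} [Field K] [Ring R] [Algebra K R] {δ a : K} {U : ℕ → R} {n : ℕ}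

/-- The elements `U 0, …, U (n - 1)` satisfy the relations of the Temperley-Lieb algebra on
`n + 1` strands with loop value `δ`. -/
structure IsTemperleyLieb (δ : K) (U : ℕ → R) (n : ℕ) : Prop where
  mul_self : ∀ j < n, U j * U j = δ • U j
  mul_mul : ∀ i j, i < n → j < n → i + 1 = j ∨ j + 1 = i → U i * U j * U i = U i
  commute : ∀ i j, i + 1 < j → j < n → Commute (U i) (U j)

theorem IsTemperleyLieb.shift (h : IsTemperleyLieb δ U n) (s : ℕ) :
    IsTemperleyLieb δ (fun l => U (s + l)) (n - s) where
  mul_self j hj := h.mul_self _ (by omega)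
  mul_mul i j hi hj hij := h.mul_mul _ _ (by omega) (by omega) (by omega)
  commute i j hij hj := h.commute _ _ (by omega) (by omega)

/-- The Jones-Wenzl idempotents in terms of Temperley-Lieb generators `U`, by Wenzl's recursion;
the Chebyshev polynomial `S k` evaluated at `δ` is the bracket of the closure of the `k`-th one. -/
noncomputable def wenzlIdempotent (δ : K) (U : ℕ → R) : ℕ → R
  | 0 => 1
  | 1 => 1
  | k + 2 => wenzlIdempotent δ U (k + 1) -
      ((S K k).eval δ / (S K (k + 1 : ℕ)).eval δ) •
        (wenzlIdempotent δ U (k + 1) * U k * wenzlIdempotent δ U (k + 1))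

theorem wenzlIdempotent_add_two (δ : K) (U : ℕ → R) (k : ℕ) :
    wenzlIdempotent δ U (k + 2) = wenzlIdempotent δ U (k + 1) -
      ((S K (k + 1 : ℕ)).eval δ / (S K k).eval δ)⁻¹ •
        (wenzlIdempotent δ U (k + 1) * U k * wenzlIdempotent δ U (k + 1)) := by
  rw [wenzlIdempotent, inv_div]

theorem commute_wenzlIdempotent {T : R} :
    ∀ k, (∀ l, l + 1 < k → Commute T (U l)) → Commute T (wenzlIdempotent δ U k)
  | 0, _ => Commute.one_right _
  | 1, _ => Commute.one_right _
  | k + 2, h => by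
    have ih := commute_wenzlIdempotent (k + 1) fun l hl => h l (by omega)
    rw [wenzlIdempotent_add_two]
    exact ih.sub_right (((ih.mul_right (h k (by omega))).mul_right ih).smul_right _)

/-- The invariant of Wenzl's recursion: `p` is idempotent, absorbs its predecessor `p₀`, and its
partial trace, taken by means of the next generator `U`, is `c • p₀`. -/
structure IsWenzlPair (c : K) (U p₀ p : R) : Prop where
  mul_self : p * p = p
  absorb : p₀ * p = p
  partialTrace : U * p * U = c • (U * p₀)

namespace IsWenzlPair

variable {c : K} {U V p₀ p : R}

theorem mul_next_eq_zero (h : IsWenzlPair c U p₀ p) (hc : c ≠ 0) :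
    U * (p - c⁻¹ • (p * U * p)) = 0 := by
  rw [mul_sub, mul_smul_comm, ← mul_assoc, ← mul_assoc, h.partialTrace, smul_mul_assoc, smul_smul,
    inv_mul_cancel₀ hc, one_smul, mul_assoc, h.absorb, sub_self]

theorem absorb_next (h : IsWenzlPair c U p₀ p) :
    p * (p - c⁻¹ • (p * U * p)) = p - c⁻¹ • (p * U * p) := by
  rw [mul_sub, mul_smul_comm, ← mul_assoc, ← mul_assoc, h.mul_self]

theorem next_mul_self (h : IsWenzlPair c U p₀ p) (hc : c ≠ 0) :
    (p - c⁻¹ • (p * U * p)) * (p - c⁻¹ • (p * U * p)) = p - c⁻¹ • (p * U * p) := by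
  rw [sub_mul, h.absorb_next, smul_mul_assoc, mul_assoc (p * U) p, h.absorb_next,
    mul_assoc p U (_ - _), h.mul_next_eq_zero hc, mul_zero, smul_zero, sub_zero]

theorem partialTrace_next (h : IsWenzlPair c U p₀ p) (hV : V * V = δ • V)
    (hVUV : V * U * V = V) (hVp : Commute V p) :
    V * (p - c⁻¹ • (p * U * p)) * V = (δ - c⁻¹) • (V * p) := by
  have e₁ : V * p * V = δ • (V * p) := by
    rw [mul_assoc, ← hVp.eq, ← mul_assoc, hV, smul_mul_assoc]
  have e₂ : V * (p * U * p) * V = V * p := by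
    calc V * (p * U * p) * V = (V * p) * U * (p * V) := by simp only [mul_assoc]
      _ = (p * V) * U * (V * p) := by rw [hVp.eq]
      _ = p * (V * U * V) * p := by simp only [mul_assoc]
      _ = V * p := by rw [hVUV, ← hVp.eq, mul_assoc, h.mul_self]
  rw [mul_sub, sub_mul, mul_smul_comm, smul_mul_assoc, e₁, e₂, sub_smul]

theorem next (h : IsWenzlPair c U p₀ p) (hc : c ≠ 0) (hV : V * V = δ • V)
    (hVUV : V * U * V = V) (hVp : Commute V p) :
    IsWenzlPair (δ - c⁻¹) V p (p - c⁻¹ • (p * U * p)) where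
  mul_self := h.next_mul_self hc
  absorb := h.absorb_next
  partialTrace := h.partialTrace_next hV hVUV hVp

end IsWenzlPair

theorem eval_chebyshevS_add_two (δ : K) (k : ℕ) :
    (S K (k + 2 : ℕ)).eval δ = δ * (S K (k + 1 : ℕ)).eval δ - (S K k).eval δ := by
  push_cast
  simp [S_add_two]

theorem IsTemperleyLieb.isWenzlPair (h : IsTemperleyLieb δ U n) :
    ∀ k < n, (∀ i ≤ k, (S K i).eval δ ≠ 0) →
      IsWenzlPair ((S K (k + 1 : ℕ)).eval δ / (S K k).eval δ) (U k)
        (wenzlIdempotent δ U k) (wenzlIdempotent δ U (k + 1))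
  | 0, hk, _ => ⟨mul_one _, mul_one _, by simp [wenzlIdempotent, h.mul_self 0 hk]⟩
  | k + 1, hk, hS => by
    have ih := h.isWenzlPair k (by omega) fun i hi => hS i (by omega)
    have hS₀ := hS k (by omega)
    have hS₁ := hS (k + 1) le_rfl
    rw [wenzlIdempotent_add_two, eval_chebyshevS_add_two, sub_div, mul_div_cancel_right₀ _ hS₁,
      ← inv_div]
    exact ih.next (div_ne_zero hS₁ hS₀) (h.mul_self _ hk)
      (h.mul_mul _ _ hk (by omega) (Or.inr rfl))
      (commute_wenzlIdempotent _ fun l hl => (h.commute _ _ (by omega) hk).symm)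

theorem IsTemperleyLieb.mul_wenzlIdempotent_eq_zero (h : IsTemperleyLieb δ U n) :
    ∀ k ≤ n + 1, (∀ i < k, (S K i).eval δ ≠ 0) → ∀ l, l + 1 < k →
      U l * wenzlIdempotent δ U k = 0
  | 0, _, _, l, hl => absurd hl (by omega)
  | 1, _, _, l, hl => absurd hl (by omega)
  | k + 2, hk, hS, l, hl => by
    rw [wenzlIdempotent_add_two]
    obtain hl | rfl := Nat.lt_or_eq_of_le (Nat.le_of_lt_succ (Nat.lt_of_succ_lt_succ hl))
    · have ih := h.mul_wenzlIdempotent_eq_zero (k + 1) (by omega) (fun i hi => hS i (by omega)) l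
        (by omega)
      rw [mul_sub, mul_smul_comm, ← mul_assoc, ← mul_assoc, ih, zero_mul, zero_mul, smul_zero,
        sub_zero]
    · exact (h.isWenzlPair l (by omega) fun i hi => hS i (by omega)).mul_next_eq_zero
        (div_ne_zero (hS _ (by omega)) (hS _ (by omega)))

/-! ### Kauffman crossings and braid words -/

/-- `a` is a bracket variable for the loop value `δ`. -/
structure IsKauffmanParameter (δ a : K) : Prop where
  ne_zero : a ≠ 0
  loop_eq : -a ^ 2 - a⁻¹ ^ 2 = δ

theorem IsKauffmanParameter.inv (h : IsKauffmanParameter δ a) : IsKauffmanParameter δ a⁻¹ :=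
  ⟨inv_ne_zero h.ne_zero, by rw [inv_inv, ← h.loop_eq]; ring⟩

/-- The Kauffman bracket resolution of a crossing in terms of the Temperley-Lieb generator
`U`. -/
noncomputable def kauffmanCrossing (a : K) (U : R) : R := a • 1 + a⁻¹ • U

theorem commute_kauffmanCrossing (a : K) {T U : R} (h : Commute T U) :
    Commute T (kauffmanCrossing a U) :=
  ((Commute.one_right T).smul_right a).add_right (h.smul_right a⁻¹)

theorem commute_of_commute_kauffmanCrossing (ha : a ≠ 0) {T U : R}
    (h : Commute T (kauffmanCrossing a U)) : Commute T U := by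
  have hU : U = a • (kauffmanCrossing a U - a • 1) := by
    rw [kauffmanCrossing, add_sub_cancel_left, smul_smul, mul_inv_cancel₀ ha, one_smul]
  rw [hU]
  exact (h.sub_right ((Commute.one_right T).smul_right a)).smul_right a

theorem IsKauffmanParameter.crossing_mul_crossing_inv (ha : IsKauffmanParameter δ a) {U : R}
    (hU : U * U = δ • U) : kauffmanCrossing a U * kauffmanCrossing a⁻¹ U = 1 := by
  have := ha.ne_zero
  simp only [kauffmanCrossing, mul_add, add_mul, smul_mul_assoc, mul_smul_comm, one_mul, mul_one,
    hU, inv_inv, ← ha.loop_eq]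
  match_scalars <;> field_simp
  ring

theorem IsKauffmanParameter.crossing_braid (ha : IsKauffmanParameter δ a) {U V : R}
    (hU : U * U = δ • U) (hV : V * V = δ • V) (hUV : U * V * U = U) (hVU : V * U * V = V) :
    kauffmanCrossing a U * kauffmanCrossing a V * kauffmanCrossing a U =
      kauffmanCrossing a V * kauffmanCrossing a U * kauffmanCrossing a V := by
  have := ha.ne_zero
  simp only [kauffmanCrossing, mul_add, add_mul, smul_mul_assoc, mul_smul_comm, one_mul, mul_one,
    hU, hUV, hV, hVU, ← ha.loop_eq]
  match_scalars <;> field_simp <;> ring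

end TemperleyLieb

section BraidWords

variable {M : Type*} [Monoid M] {σ : ℕ → M} {n : ℕ}

/-- The braid relations for `σ 0, …, σ (n - 1)`. -/
structure IsBraided (σ : ℕ → M) (n : ℕ) : Prop where
  commute : ∀ i j, i + 1 < j → j < n → Commute (σ i) (σ j)
  braid : ∀ i, i + 1 < n → σ i * σ (i + 1) * σ i = σ (i + 1) * σ i * σ (i + 1)

/-- The braid word `σ_0 ⋯ σ_{k-1}`. -/
def ascending (σ : ℕ → M) (k : ℕ) : M := (List.ofFn fun i : Fin k => σ i).prod

/-- The braid word `σ_{k-1} ⋯ σ_0`. -/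
def descending (σ : ℕ → M) (k : ℕ) : M := (List.ofFn fun i : Fin k => σ i).reverse.prod

theorem ascending_zero (σ : ℕ → M) : ascending σ 0 = 1 := rfl

theorem ascending_succ (σ : ℕ → M) (k : ℕ) : ascending σ (k + 1) = ascending σ k * σ k := by
  rw [ascending, List.ofFn_succ_last]
  simp [ascending]

theorem ascending_succ' (σ : ℕ → M) (k : ℕ) :
    ascending σ (k + 1) = σ 0 * ascending (fun i => σ (i + 1)) k := by
  simp [ascending, List.ofFn_succ]

theorem descending_succ (σ : ℕ → M) (k : ℕ) : descending σ (k + 1) = σ k * descending σ k := by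
  rw [descending, List.ofFn_succ_last]
  simp [descending]

theorem op_descending (σ : ℕ → M) (k : ℕ) :
    MulOpposite.op (descending σ k) = ascending (fun i => MulOpposite.op (σ i)) k := by
  simp [ascending, descending, MulOpposite.op_list_prod, List.map_ofFn, Function.comp_def]

namespace IsBraided

theorem mono (h : IsBraided σ n) {k : ℕ} (hk : k ≤ n) : IsBraided σ k where
  commute i j hij hj := h.commute i j hij (by omega)
  braid i hi := h.braid i (by omega)

theorem op (h : IsBraided σ n) : IsBraided (fun i => MulOpposite.op (σ i)) n where
  commute i j hij hj := (h.commute i j hij hj).op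
  braid i hi := by
    simpa only [MulOpposite.op_mul, mul_assoc] using congrArg MulOpposite.op (h.braid i hi)

theorem commute_ascending (h : IsBraided σ n) {j : ℕ} (hj : j < n) :
    ∀ k < j, Commute (ascending σ k) (σ j)
  | 0, _ => Commute.one_left _
  | k + 1, hk => by
    rw [ascending_succ]
    exact (h.commute_ascending hj k (by omega)).mul_left (h.commute k j hk hj)

theorem ascending_mul (h : IsBraided σ n) :
    ∀ k i, i + 1 < k → k ≤ n → ascending σ k * σ i = σ (i + 1) * ascending σ k
  | 0, i, hi, _ => absurd hi (by omega)
  | 1, i, hi, _ => absurd hi (by omega)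
  | k + 2, i, hi, hk => by
    rcases Nat.lt_or_ge (i + 1) (k + 1) with hik | hik
    · rw [ascending_succ, mul_assoc, ← (h.commute i (k + 1) (by omega) (by omega)).eq, ← mul_assoc,
        h.ascending_mul (k + 1) i hik (by omega), mul_assoc]
    · obtain rfl : i = k := by omega
      rw [ascending_succ, ascending_succ, mul_assoc, mul_assoc, ← mul_assoc (σ i),
        h.braid i (by omega), mul_assoc, ← mul_assoc,
        (h.commute_ascending (by omega) i (by omega)).eq]
      simp only [mul_assoc]

theorem descending_mul (h : IsBraided σ n) {i : ℕ} (hi : i + 1 < n) :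
    descending σ n * σ (i + 1) = σ i * descending σ n := by
  apply MulOpposite.op_injective
  rw [MulOpposite.op_mul, MulOpposite.op_mul, op_descending]
  exact (h.op.ascending_mul n i hi le_rfl).symm

theorem ascending_mul_descending_commute (h : IsBraided σ n) {i : ℕ}
    (hi : 1 ≤ i) (hin : i < n) : Commute (ascending σ n * descending σ n) (σ i) := by
  obtain ⟨i, rfl⟩ := Nat.exists_eq_add_of_le' hi
  rw [Commute, SemiconjBy, mul_assoc, h.descending_mul hin, ← mul_assoc,
    h.ascending_mul n i hin le_rfl, mul_assoc]

theorem ascending_pow_mul (h : IsBraided σ n) :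
    ∀ l i, i + l < n → ascending σ n ^ l * σ i = σ (i + l) * ascending σ n ^ l
  | 0, i, _ => by simp
  | l + 1, i, hl => by
    rw [pow_succ, mul_assoc, h.ascending_mul n i (by omega) le_rfl, ← mul_assoc,
      h.ascending_pow_mul l (i + 1) (by omega), mul_assoc, ← add_assoc, add_right_comm]

theorem ascending_mul_ascending (h : IsBraided σ n) :
    ∀ k < n, ascending σ n * ascending σ k = ascending (fun i => σ (i + 1)) k * ascending σ n
  | 0, _ => by simp [ascending_zero]
  | k + 1, hk => by
    rw [ascending_succ σ k, ← mul_assoc, h.ascending_mul_ascending k (by omega), mul_assoc,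
      h.ascending_mul n k hk le_rfl, ascending_succ, mul_assoc]

theorem ascending_sq_mul (h : IsBraided σ (n + 1)) :
    ascending σ (n + 1) ^ 2 * σ n = σ 0 * ascending σ (n + 1) ^ 2 := by
  have hsq : ascending σ (n + 1) ^ 2 =
      ascending (fun i => σ (i + 1)) n * ascending σ (n + 1) * σ n := by
    rw [← h.ascending_mul_ascending n n.lt_succ_self, mul_assoc, sq, ascending_succ]
  conv_rhs => rw [hsq, ← mul_assoc, ← mul_assoc, ← ascending_succ']
  rw [sq]

/-- The full twist is central: its factors carry `σ_i` first to the last generator, then to the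
first one, and finally back to `σ_i`. -/
theorem ascending_pow_commute (h : IsBraided σ n) {i : ℕ} (hi : i < n) :
    Commute (ascending σ n ^ (n + 1)) (σ i) := by
  obtain ⟨k, rfl⟩ : ∃ k, n = k + 1 := ⟨n - 1, by omega⟩
  have hpow : ascending σ (k + 1) ^ (k + 1 + 1) =
      ascending σ (k + 1) ^ i * ascending σ (k + 1) ^ 2 * ascending σ (k + 1) ^ (k - i) := by
    rw [← pow_add, ← pow_add]
    congr 1
    omega
  have to_last := h.ascending_pow_mul (k - i) i (by omega)
  have from_first := h.ascending_pow_mul i 0 (by omega)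
  rw [Nat.add_sub_of_le (by omega)] at to_last
  rw [zero_add] at from_first
  rw [Commute, SemiconjBy, hpow, mul_assoc, to_last, ← mul_assoc, mul_assoc (_ ^ i),
    h.ascending_sq_mul, ← mul_assoc, from_first]
  simp only [mul_assoc]

end IsBraided

theorem IsTemperleyLieb.isBraided_crossing {K R : Type*} [Field K] [Ring R] [Algebra K R]
    {δ a : K} {U : ℕ → R} {n : ℕ} (h : IsTemperleyLieb δ U n) (ha : IsKauffmanParameter δ a) :
    IsBraided (fun j => kauffmanCrossing a (U j)) n where
  commute i j hij hj := commute_kauffmanCrossing a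
    (commute_kauffmanCrossing a (h.commute i j hij hj).symm).symm
  braid i hi := ha.crossing_braid (h.mul_self i (by omega)) (h.mul_self _ hi)
    (h.mul_mul i _ (by omega) hi (Or.inl rfl)) (h.mul_mul _ i hi (by omega) (Or.inr rfl))

end BraidWords

/-! ### Gluing arcs to planar matchings -/

section GlueArc

variable {N : ℕ} {f : PlanarMatching N} {x y u v z : Fin N}

namespace PlanarMatching

theorem ext_partner {f g : PlanarMatching N} (h : ∀ z, f.partner z = g.partner z) : f = g :=
  PlanarMatching.ext (Equiv.ext h)

theorem partner_eq_comm (f : PlanarMatching N) : f.partner x = y ↔ f.partner y = x :=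
  ⟨fun h => h ▸ f.invol x, fun h => h ▸ f.invol y⟩

end PlanarMatching

theorem glueArc_partner (f : PlanarMatching N) (h : (x : ℕ) + 1 = y) (z : Fin N) :
    (glueArc f x y h).partner z =
      if z = x then y else if z = y then x else if z = f.partner x then f.partner y else
        if z = f.partner y then f.partner x else f.partner z :=
  glue_apply f.partner f.invol f.noFix x y (by rintro rfl; omega) z

theorem glueArc_of_partner (h : (x : ℕ) + 1 = y) (hf : f.partner x = y) :
    glueArc f x y h = f := by
  have := f.invol x
  refine PlanarMatching.ext_partner fun z => ?_
  rw [glueArc_partner]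
  grind

theorem glueArc_partner_left (f : PlanarMatching N) (h : (x : ℕ) + 1 = y) :
    (glueArc f x y h).partner x = y := by
  rw [glueArc_partner, if_pos rfl]

theorem glueArc_partner_right (f : PlanarMatching N) (h : (x : ℕ) + 1 = y) :
    (glueArc f x y h).partner y = x :=
  (PlanarMatching.partner_eq_comm _).1 (glueArc_partner_left f h)

theorem glueArc_partner_of_ne (h : (x : ℕ) + 1 = y) (hx : z ≠ x) (hy : z ≠ y)
    (hx' : f.partner z ≠ x) (hy' : f.partner z ≠ y) :
    (glueArc f x y h).partner z = f.partner z := by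
  have := f.invol
  rw [glueArc_partner]
  grind

theorem glueArc_glueArc_of_partner (h : (x : ℕ) + 1 = y) (h' : (u : ℕ) + 1 = v)
    (hadj : u = y ∨ v = x) (hf : f.partner x = y) :
    glueArc (glueArc f u v h') x y h = f := by
  have hxy : x ≠ y := by rintro rfl; omega
  have huv : u ≠ v := by rintro rfl; omega
  have hends : u ≠ x ∧ v ≠ y := by
    constructor <;> rintro rfl <;> rcases hadj with rfl | rfl <;> omega
  refine PlanarMatching.ext_partner fun w => ?_
  have := f.invol x
  have := f.invol u
  have := f.invol v
  have := f.invol w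
  have := f.noFix u
  have := f.noFix v
  rw [glueArc_partner]
  simp only [glueArc_partner]
  grind

theorem glueArc_comm (f : PlanarMatching N) (h : (x : ℕ) + 1 = y) (h' : (u : ℕ) + 1 = v)
    (hd : (y : ℕ) < u) :
    glueArc (glueArc f x y h) u v h' = glueArc (glueArc f u v h') x y h := by
  have hne : x ≠ y ∧ u ≠ v ∧ x ≠ u ∧ x ≠ v ∧ y ≠ u ∧ y ≠ v := by
    refine ⟨?_, ?_, ?_, ?_, ?_, ?_⟩ <;> rintro rfl <;> omega
  obtain ⟨-, -, hxu, hxv, hyu, hyv⟩ := hne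
  refine PlanarMatching.ext_partner fun w => ?_
  have := f.invol x
  have := f.invol y
  have := f.invol u
  have := f.invol v
  have := f.invol w
  have := f.noFix x
  have := f.noFix y
  have := f.noFix u
  have := f.noFix v
  simp only [glueArc_partner, hxu, hxv, hyu, hyv, hxu.symm, hxv.symm, hyu.symm, hyv.symm,
    if_false]
  by_cases f.partner x = u <;> by_cases f.partner y = u <;>
    by_cases f.partner x = v <;> by_cases f.partner y = v <;> grind (splits := 20)

/-- The factor created by gluing `∪∩` to `f` at `x`, `y`. -/
noncomputable def arcWeight (r : ℕ) (f : PlanarMatching N) (x y : Fin N) : ℂ :=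
  if f.partner x = y then loopValue r else 1

theorem arcWeight_eq_one (r : ℕ) (h : (x : ℕ) + 1 = y) (h' : (u : ℕ) + 1 = v)
    (hadj : u = y ∨ v = x) (hf : f.partner x = y) : arcWeight r f u v = 1 := by
  have := f.invol x
  have := f.invol u
  rw [arcWeight, if_neg]
  grind

theorem arcWeight_comm (r : ℕ) (f : PlanarMatching N)
    (h : (x : ℕ) + 1 = y) (h' : (u : ℕ) + 1 = v) (hd : (y : ℕ) < u) :
    arcWeight r f x y * arcWeight r (glueArc f x y h) u v =
      arcWeight r f u v * arcWeight r (glueArc f u v h') x y := by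
  have hne : x ≠ y ∧ u ≠ v ∧ x ≠ u ∧ x ≠ v ∧ y ≠ u ∧ y ≠ v := by
    refine ⟨?_, ?_, ?_, ?_, ?_, ?_⟩ <;> rintro rfl <;> omega
  have := f.invol x
  have := f.invol y
  have := f.invol u
  have := f.invol v
  simp only [arcWeight, glueArc_partner]
  grind

theorem cupCap_single (r : ℕ) (f : PlanarMatching N) (h : (x : ℕ) + 1 = y) :
    cupCap r N x (Pi.single f 1) = arcWeight r f x y • Pi.single (glueArc f x y h) (1 : ℂ) := by
  have hx : (x : ℕ) + 1 < N := by omega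
  obtain rfl : y = ⟨x + 1, hx⟩ := Fin.ext h.symm
  rw [cupCap, dif_pos hx, Fintype.linearCombination_apply_single, one_smul]
  rfl

theorem skein_hom_ext {V : Type*} [AddCommMonoid V] [Module ℂ V] {S T : Skein N →ₗ[ℂ] V}
    (h : ∀ f : PlanarMatching N, S (Pi.single f 1) = T (Pi.single f 1)) : S = T := by
  refine LinearMap.pi_ext' fun f => LinearMap.ext_ring ?_
  simpa using h f

theorem cupCap_mul_self (r : ℕ) (h : (x : ℕ) + 1 = y) :
    cupCap r N x * cupCap r N x = loopValue r • cupCap r N x := by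
  refine skein_hom_ext fun f => ?_
  rw [Module.End.mul_apply, cupCap_single r f h, map_smul, cupCap_single r _ h,
    LinearMap.smul_apply, cupCap_single r f h, glueArc_of_partner h (glueArc_partner_left f h),
    arcWeight, arcWeight, if_pos (glueArc_partner_left f h), smul_comm]

theorem cupCap_mul_mul (r : ℕ) (h : (x : ℕ) + 1 = y) (h' : (u : ℕ) + 1 = v)
    (hadj : u = y ∨ v = x) :
    cupCap r N x * cupCap r N u * cupCap r N x = cupCap r N x := by
  refine skein_hom_ext fun f => ?_
  have hf := glueArc_partner_left f h
  rw [Module.End.mul_apply, Module.End.mul_apply, cupCap_single r f h, map_smul,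
    cupCap_single r _ h', map_smul, map_smul, cupCap_single r _ h,
    glueArc_glueArc_of_partner h h' hadj hf, arcWeight_eq_one r h h' hadj hf, one_smul,
    arcWeight_eq_one r h' h (by tauto) (glueArc_partner_left _ h'), one_smul]

theorem cupCap_commute (r : ℕ) (h : (x : ℕ) + 1 = y) (h' : (u : ℕ) + 1 = v)
    (hd : (y : ℕ) < u) : Commute (cupCap r N x) (cupCap r N u) := by
  refine skein_hom_ext fun f => ?_
  rw [Module.End.mul_apply, Module.End.mul_apply, cupCap_single r f h', map_smul,
    cupCap_single r _ h, cupCap_single r f h, map_smul, cupCap_single r _ h', smul_smul, smul_smul,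
    arcWeight_comm r f h h' hd, glueArc_comm f h h' hd]

theorem isTemperleyLieb_cupCap (r N : ℕ) :
    IsTemperleyLieb (loopValue r) (fun j => (cupCap r N j : Module.End ℂ (Skein N))) (N - 1) where
  mul_self j hj := cupCap_mul_self r (x := ⟨j, by omega⟩) (y := ⟨j + 1, by omega⟩) rfl
  mul_mul i j hi hj hij := cupCap_mul_mul r (x := ⟨i, by omega⟩) (y := ⟨i + 1, by omega⟩)
    (u := ⟨j, by omega⟩) (v := ⟨j + 1, by omega⟩) rfl rfl
    (by simpa only [Fin.mk.injEq, eq_comm] using hij)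
  commute i j hij hj := cupCap_commute r (x := ⟨i, by omega⟩) (y := ⟨i + 1, by omega⟩)
    (u := ⟨j, by omega⟩) (v := ⟨j + 1, by omega⟩) rfl rfl hij

end GlueArc

/-! ### Loop counts and adjointness -/

section Loops

variable {N : ℕ} {f g : PlanarMatching N} {x y : Fin N}

/-- Adjacency along an arc of either of two matchings glued along their boundary. -/
def LoopStep (f g : PlanarMatching N) (z w : Fin N) : Prop := f.partner z = w ∨ g.partner z = w

theorem loops_eq_card_quot (f g : PlanarMatching N) : loops f g = Nat.card (Quot (LoopStep f g)) :=
  Nat.card_congr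
    { toFun := Quot.lift (Quot.mk _) fun _ _ => Quot.eqvGen_sound
      invFun := Quot.map id fun _ _ => Relation.EqvGen.rel _ _
      left_inv := by rintro ⟨z⟩; rfl
      right_inv := by rintro ⟨z⟩; rfl }

/-- Adjacency in the closed diagram consisting of `f`, the diagram `∪∩` at `x`, `y`, and `g`.
The two copies of the boundary points are the points where `f` and `g` meet the middle layer. -/
inductive StackStep (f g : PlanarMatching N) (x y : Fin N) : Fin N ⊕ Fin N → Fin N ⊕ Fin N → Prop
  | left (z : Fin N) : StackStep f g x y (.inl z) (.inl (f.partner z))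
  | right (z : Fin N) : StackStep f g x y (.inr z) (.inr (g.partner z))
  | through (z : Fin N) (hx : z ≠ x) (hy : z ≠ y) : StackStep f g x y (.inl z) (.inr z)
  | cup : StackStep f g x y (.inl x) (.inl y)
  | cap : StackStep f g x y (.inr x) (.inr y)

/-- The number of closed loops of `f`, `∪∩` at `x`, `y`, and `g` stacked together. -/
noncomputable def stackedLoops (f g : PlanarMatching N) (x y : Fin N) : ℕ :=
  Nat.card (Quot (StackStep f g x y))

theorem stackedLoops_comm (f g : PlanarMatching N) (x y : Fin N) :
    stackedLoops f g x y = stackedLoops g f x y := by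
  have swap (f g : PlanarMatching N) (a b : Fin N ⊕ Fin N) (h : StackStep f g x y a b) :
      (Quot.mk (StackStep g f x y) a.swap) = Quot.mk _ b.swap := by
    cases h with
    | left z => exact Quot.sound (.right z)
    | right z => exact Quot.sound (.left z)
    | through z hx hy => exact (Quot.sound (.through z hx hy)).symm
    | cup => exact Quot.sound .cap
    | cap => exact Quot.sound .cup
  exact Nat.card_congr
    { toFun := Quot.lift _ (swap f g)
      invFun := Quot.lift _ (swap g f)
      left_inv := by rintro ⟨z | z⟩ <;> rfl
      right_inv := by rintro ⟨z | z⟩ <;> rfl }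

/-- A point of the stack `f`, `∪∩`, `g` pushed to the lower boundary of the arc in `f`, when `f`
does not join `x` to `y`. -/
def collapseStack (f : PlanarMatching N) (x y : Fin N) : Fin N ⊕ Fin N → Fin N :=
  Sum.elim (fun z => if z = x ∨ z = y then f.partner z else z) id

theorem StackStep.collapse (h : (x : ℕ) + 1 = y) (hf : f.partner x ≠ y) {a b : Fin N ⊕ Fin N}
    (hab : StackStep f g x y a b) :
    Quot.mk (LoopStep (glueArc f x y h) g) (collapseStack f x y a) =
      Quot.mk _ (collapseStack f x y b) := by
  have := f.invol
  have := f.noFix x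
  have := f.noFix y
  cases hab with
  | left z =>
    by_cases hz : z = x ∨ z = y ∨ f.partner z = x ∨ f.partner z = y
    · congr 1
      simp only [collapseStack, Sum.elim_inl]
      grind
    · refine Quot.sound (Or.inl ?_)
      rw [glueArc_partner]
      simp only [collapseStack, Sum.elim_inl]
      grind
  | right z => exact Quot.sound (Or.inr rfl)
  | through z hx hy => simp [collapseStack, hx, hy]
  | cup =>
    refine Quot.sound (Or.inl ?_)
    rw [glueArc_partner]
    simp only [collapseStack, Sum.elim_inl]
    grind
  | cap => exact Quot.sound (Or.inl (glueArc_partner_left f h))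

theorem quot_stackStep_inl_partner (f g : PlanarMatching N) (x y z : Fin N) :
    Quot.mk (StackStep f g x y) (Sum.inl (f.partner z)) = Quot.mk _ (Sum.inl z) :=
  (Quot.sound (.left z)).symm

theorem LoopStep.expand (h : (x : ℕ) + 1 = y) {z w : Fin N}
    (hzw : LoopStep (glueArc f x y h) g z w) :
    Quot.mk (StackStep f g x y) (Sum.inr z) = Quot.mk _ (Sum.inr w) := by
  have through (z) (hx : z ≠ x) (hy : z ≠ y) :
      Quot.mk (StackStep f g x y) (Sum.inr z) = Quot.mk _ (Sum.inl z) :=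
    (Quot.sound (.through z hx hy)).symm
  have cup : Quot.mk (StackStep f g x y) (Sum.inl x) = Quot.mk _ (Sum.inl y) := Quot.sound .cup
  have cap : Quot.mk (StackStep f g x y) (Sum.inr x) = Quot.mk _ (Sum.inr y) := Quot.sound .cap
  have left := quot_stackStep_inl_partner f g x y
  have := f.invol
  have := f.noFix x
  have := f.noFix y
  rcases hzw with rfl | rfl
  · rw [glueArc_partner]
    grind
  · exact Quot.sound (.right z)

theorem stackedLoops_of_ne (g : PlanarMatching N) (h : (x : ℕ) + 1 = y)
    (hf : f.partner x ≠ y) : stackedLoops f g x y = loops (glueArc f x y h) g := by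
  have hf' : f.partner y ≠ x := fun hy => hf ((f.partner_eq_comm).1 hy)
  rw [loops_eq_card_quot]
  refine Nat.card_congr
    { toFun := Quot.lift _ fun _ _ => StackStep.collapse h hf
      invFun := Quot.lift (fun z => Quot.mk _ (Sum.inr z)) fun _ _ => LoopStep.expand h
      left_inv := ?_
      right_inv := by rintro ⟨z⟩; rfl }
  have through (z) (hx : z ≠ x) (hy : z ≠ y) :
      Quot.mk (StackStep f g x y) (Sum.inr z) = Quot.mk _ (Sum.inl z) :=
    (Quot.sound (.through z hx hy)).symm
  have left := quot_stackStep_inl_partner f g x y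
  have := f.noFix
  rintro ⟨z | z⟩
  · change Quot.mk _ (Sum.inr (if z = x ∨ z = y then f.partner z else z)) = Quot.mk _ (Sum.inl z)
    grind
  · rfl

theorem stackedLoops_of_partner (g : PlanarMatching N) (h : (x : ℕ) + 1 = y)
    (hf : f.partner x = y) : stackedLoops f g x y = loops f g + 1 := by
  have hfy : f.partner y = x := (f.partner_eq_comm).1 hf
  have through (z) (hx : z ≠ x) (hy : z ≠ y) :
      Quot.mk (StackStep f g x y) (Sum.inr z) = Quot.mk _ (Sum.inl z) :=
    (Quot.sound (.through z hx hy)).symm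
  rw [loops_eq_card_quot, ← Finite.card_option]
  refine Nat.card_congr
    { toFun := Quot.lift (Sum.elim (fun z => if z = x ∨ z = y then none else some (Quot.mk _ z))
        fun z => some (Quot.mk _ z)) ?_
      invFun := fun o =>
        o.elim (Quot.mk _ (Sum.inl x)) (Quot.lift (fun z => Quot.mk _ (Sum.inr z)) ?_)
      left_inv := ?_
      right_inv := ?_ }
  · intro a b hab
    cases hab with
    | left z =>
      have := f.invol z
      have : Quot.mk (LoopStep f g) z = Quot.mk _ (f.partner z) := Quot.sound (Or.inl rfl)
      simp only [Sum.elim_inl]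
      grind
    | right z => exact congrArg some (Quot.sound (Or.inr rfl))
    | through z hx hy => simp [hx, hy]
    | cup => simp
    | cap => exact congrArg some (Quot.sound (Or.inl hf))
  · intro z w hzw
    rw [← glueArc_of_partner h hf] at hzw
    exact hzw.expand
  · rintro ⟨z | z⟩
    · have cup : Quot.mk (StackStep f g x y) (Sum.inl x) = Quot.mk _ (Sum.inl y) := Quot.sound .cup
      simp only [Sum.elim_inl]
      grind [Option.elim]
    · rfl
  · rintro (_ | ⟨⟨z⟩⟩)
    · simp
    · rfl

theorem arcWeight_mul_loopValue_pow (r : ℕ) (f g : PlanarMatching N) (h : (x : ℕ) + 1 = y) :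
    arcWeight r f x y * loopValue r ^ loops (glueArc f x y h) g =
      loopValue r ^ stackedLoops f g x y := by
  by_cases hf : f.partner x = y
  · rw [arcWeight, if_pos hf, glueArc_of_partner h hf, stackedLoops_of_partner g h hf, pow_succ']
  · rw [arcWeight, if_neg hf, stackedLoops_of_ne g h hf, one_mul]

end Loops

section BracketForm

variable {N : ℕ}

/-- The bracket form as a linear functional of its first argument. -/
noncomputable def bracketFunctional (r : ℕ) (y : Skein N) : Skein N →ₗ[ℂ] ℂ where
  toFun x := bracketForm r x y
  map_add' x x' := bracketForm_add_left r x x' y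
  map_smul' c x := bracketForm_smul_left r c x y

theorem bracketForm_single (r : ℕ) (f g : PlanarMatching N) :
    bracketForm r (Pi.single f 1) (Pi.single g 1) = loopValue r ^ loops f g := by
  rw [bracketForm, Finset.sum_eq_single f, Finset.sum_eq_single g]
  · simp
  · intro b _ hb; simp [hb]
  · simp
  · intro b _ hb; simp [Pi.single_apply, hb]
  · simp

theorem bracketForm_add_right (r : ℕ) (x y y' : Skein N) :
    bracketForm r x (y + y') = bracketForm r x y + bracketForm r x y' := by
  rw [← bracketForm_conj, bracketForm_add_left, map_add, bracketForm_conj, bracketForm_conj]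

theorem bracketForm_smul_right (r : ℕ) (c : ℂ) (x y : Skein N) :
    bracketForm r x (c • y) = conj c * bracketForm r x y := by
  rw [← bracketForm_conj, bracketForm_smul_left, map_mul, bracketForm_conj]

theorem bracketForm_adjoint_of_single (r : ℕ) {S T : Skein N →ₗ[ℂ] Skein N}
    (h : ∀ f g : PlanarMatching N, bracketForm r (S (Pi.single f 1)) (Pi.single g 1) =
      bracketForm r (Pi.single f 1) (T (Pi.single g 1))) (x y : Skein N) :
    bracketForm r (S x) y = bracketForm r x (T y) := by
  have left (g : PlanarMatching N) (x : Skein N) :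
      bracketForm r (S x) (Pi.single g 1) = bracketForm r x (T (Pi.single g 1)) :=
    LinearMap.congr_fun (skein_hom_ext (S := bracketFunctional r (Pi.single g 1) ∘ₗ S)
      (T := bracketFunctional r (T (Pi.single g 1))) fun f => h f g) x
  have right : bracketFunctional r (S x) = bracketFunctional r x ∘ₗ T :=
    skein_hom_ext fun g => by
      have := congrArg conj (left g x)
      rwa [bracketForm_conj, bracketForm_conj] at this
  have := congrArg conj (LinearMap.congr_fun right y)
  change conj (bracketForm r y (S x)) = conj (bracketForm r (T y) x) at this
  rwa [bracketForm_conj, bracketForm_conj] at this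

theorem conj_arcWeight (r : ℕ) (f : PlanarMatching N) (x y : Fin N) :
    conj (arcWeight r f x y) = arcWeight r f x y := by
  rw [arcWeight, apply_ite conj, conj_loopValue, map_one]

/-- Both sides count the loops of the diagram `f`, `∪∩`, `g`. -/
theorem bracketForm_cupCap (r N j : ℕ) (x y : Skein N) :
    bracketForm r (cupCap r N j x) y = bracketForm r x (cupCap r N j y) := by
  by_cases hj : j + 1 < N
  · refine bracketForm_adjoint_of_single r (fun f g => ?_) x y
    have cupCap_apply (f : PlanarMatching N) :=
      cupCap_single r f (x := ⟨j, by omega⟩) (y := ⟨j + 1, hj⟩) rfl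
    rw [cupCap_apply, cupCap_apply, bracketForm_smul_left, bracketForm_smul_right,
      bracketForm_single, bracketForm_single, conj_arcWeight, arcWeight_mul_loopValue_pow,
      loops_comm, arcWeight_mul_loopValue_pow, stackedLoops_comm]
  · simp [cupCap, hj, bracketForm]

end BracketForm

/-! ### Quantum integers and Jones-Wenzl idempotents -/

section QuantumInt

variable {r : ℕ}

theorem sin_pi_div_pos (hr : 2 ≤ r) : 0 < Real.sin (Real.pi / r) := by
  have h2 : (2 : ℝ) ≤ r := by exact_mod_cast hr
  refine Real.sin_pos_of_pos_of_lt_pi (by positivity) ?_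
  rw [div_lt_iff₀ (by linarith)]
  nlinarith [Real.pi_pos]

theorem quantumInt_zero (r : ℕ) : quantumInt r 0 = 0 := by simp [quantumInt]

theorem quantumInt_self (hr : r ≠ 0) : quantumInt r r = 0 := by
  have : (r : ℝ) ≠ 0 := by exact_mod_cast hr
  rw [quantumInt, Int.cast_natCast, mul_div_cancel_left₀ _ this, Real.sin_pi, zero_div]

theorem quantumInt_neg (r : ℕ) (k : ℤ) : quantumInt r (-k) = -quantumInt r k := by
  rw [quantumInt, quantumInt, Int.cast_neg, neg_mul, neg_div, Real.sin_neg, neg_div]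

theorem quantumInt_pos {k : ℤ} (h0 : 0 < k) (hk : k < r) : 0 < quantumInt r k := by
  have hr' : (0 : ℝ) < r := by exact_mod_cast h0.trans hk
  have : (0 : ℝ) < k := by exact_mod_cast h0
  have hk' : (k : ℝ) < r := by exact_mod_cast hk
  refine div_pos (Real.sin_pos_of_pos_of_lt_pi (by positivity) ?_) (sin_pi_div_pos (by omega))
  rw [div_lt_iff₀ hr', mul_comm]
  exact mul_lt_mul_of_pos_left hk' Real.pi_pos

theorem quantumInt_two (hr : 2 ≤ r) : quantumInt r 2 = 2 * Real.cos (Real.pi / r) := by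
  rw [quantumInt, Int.cast_ofNat, mul_div_assoc, Real.sin_two_mul, mul_right_comm,
    mul_div_cancel_right₀ _ (sin_pi_div_pos hr).ne']

theorem quantumInt_two_mul (hr : 2 ≤ r) (k : ℤ) :
    quantumInt r 2 * quantumInt r k = quantumInt r (k + 1) + quantumInt r (k - 1) := by
  rw [quantumInt_two hr, quantumInt, quantumInt, quantumInt, ← add_div, ← mul_div_assoc]
  congr 1
  push_cast
  rw [add_mul, sub_mul, one_mul, add_div, sub_div, Real.sin_add, Real.sin_sub]
  ring

theorem kauffmanA_sq (r : ℕ) :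
    kauffmanA r ^ 2 = -Complex.exp (-(Real.pi / r * Complex.I)) := by
  rw [kauffmanA, mul_pow, Complex.I_sq, neg_one_mul, ← Complex.exp_nat_mul]
  congr 2
  by_cases hr : (r : ℂ) = 0
  · simp [hr]
  · field_simp
    norm_num

theorem isKauffmanParameter_kauffmanA (r : ℕ) :
    IsKauffmanParameter (loopValue r) (kauffmanA r) :=
  ⟨by simp [kauffmanA], rfl⟩

theorem loopValue_eq_two_mul_cos (r : ℕ) : loopValue r = 2 * Complex.cos (Real.pi / r) := by
  rw [loopValue, inv_pow, kauffmanA_sq, inv_neg, ← Complex.exp_neg, neg_neg, Complex.two_cos,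
    neg_neg, sub_neg_eq_add, add_comm, neg_mul]

theorem loopValue_eq_quantumInt (hr : 2 ≤ r) : loopValue r = (quantumInt r 2 : ℂ) := by
  rw [loopValue_eq_two_mul_cos, quantumInt_two hr]
  push_cast
  rfl

theorem loopValue_ne_zero (hr : 3 ≤ r) : loopValue r ≠ 0 := by
  rw [loopValue_eq_quantumInt (by omega)]
  exact_mod_cast (quantumInt_pos (r := r) (k := 2) (by norm_num) (by omega)).ne'

theorem conj_eq_inv_of_isKauffmanParameter {a : ℂ} (ha : IsKauffmanParameter (loopValue r) a) :
    conj a = a⁻¹ := by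
  have hA := isKauffmanParameter_kauffmanA r
  have hroots : (a ^ 2 - kauffmanA r ^ 2) * (a ^ 2 - (kauffmanA r ^ 2)⁻¹) = 0 := by
    have h := ha.loop_eq.trans hA.loop_eq.symm
    have := ha.ne_zero
    have := hA.ne_zero
    field_simp at h ⊢
    linear_combination -h
  have hA' : ‖kauffmanA r ^ 2‖ = 1 := by
    rw [kauffmanA_sq, norm_neg, ← neg_mul, ← Complex.ofReal_natCast, ← Complex.ofReal_div,
      ← Complex.ofReal_neg, Complex.norm_exp_ofReal_mul_I]
  have hsq : ‖a ^ 2‖ = 1 := by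
    rcases mul_eq_zero.1 hroots with h | h
    · rw [sub_eq_zero.1 h, hA']
    · rw [sub_eq_zero.1 h, norm_inv, hA', inv_one]
  rw [norm_pow, pow_eq_one_iff_of_nonneg (norm_nonneg a) two_ne_zero] at hsq
  exact (RCLike.inv_eq_conj hsq).symm

open Polynomial.Chebyshev (S)

theorem eval_chebyshevS_loopValue (hr : 2 ≤ r) (k : ℤ) :
    (S ℂ k).eval (loopValue r) = quantumInt r (k + 1) := by
  rw [loopValue_eq_two_mul_cos, quantumInt, Complex.ofReal_div, eq_div_iff]
  · push_cast
    rw [Polynomial.Chebyshev.S_two_mul_complex_cos]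
    ring_nf
  · exact_mod_cast (sin_pi_div_pos hr).ne'

theorem chebyshevDelta_eq (r : ℕ) : ∀ k : ℕ, chebyshevDelta r k = (S ℂ k).eval (loopValue r)
  | 0 => by simp [chebyshevDelta]
  | 1 => by simp [chebyshevDelta]
  | k + 2 => by
    rw [chebyshevDelta, eval_chebyshevS_add_two, chebyshevDelta_eq r k,
      chebyshevDelta_eq r (k + 1)]

theorem jonesWenzl_eq_wenzlIdempotent (r N s : ℕ) : ∀ k, jonesWenzl r N s k =
    wenzlIdempotent (loopValue r) (fun l => (cupCap r N (s + l) : Module.End ℂ (Skein N))) k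
  | 0 => rfl
  | 1 => rfl
  | k + 2 => by
    rw [jonesWenzl, wenzlIdempotent, jonesWenzl_eq_wenzlIdempotent r N s (k + 1),
      chebyshevDelta_eq, chebyshevDelta_eq]
    rfl

theorem cupCap_jonesWenzl {N s k : ℕ} (hk : k < r) (hN : s + k ≤ N) {l : ℕ}
    (hl : l + 1 < k) (x : Skein N) : cupCap r N (s + l) (jonesWenzl r N s k x) = 0 := by
  rw [jonesWenzl_eq_wenzlIdempotent]
  refine LinearMap.congr_fun (((isTemperleyLieb_cupCap r N).shift s).mul_wenzlIdempotent_eq_zero k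
    (by omega) (fun i hi => ?_) l hl) x
  rw [eval_chebyshevS_loopValue (by omega)]
  exact_mod_cast (quantumInt_pos (r := r) (k := i + 1) (by omega) (by omega)).ne'

theorem bracketForm_crossing {a : ℂ} (ha : IsKauffmanParameter (loopValue r) a) {N j : ℕ}
    (hj : j + 1 < N) (x y : Skein N) :
    bracketForm r (crossing r N a j x) (crossing r N a j y) = bracketForm r x y := by
  have adj (x y : Skein N) : bracketForm r (crossing r N a j x) y =
      bracketForm r x (crossing r N a⁻¹ j y) := by
    simp only [crossing, LinearMap.add_apply, LinearMap.smul_apply, LinearMap.id_apply,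
      bracketForm_add_left, bracketForm_add_right, bracketForm_smul_left, bracketForm_smul_right,
      bracketForm_cupCap, map_inv₀, conj_eq_inv_of_isKauffmanParameter ha, inv_inv]
  have inv_mul := ha.inv.crossing_mul_crossing_inv
    ((isTemperleyLieb_cupCap r N).mul_self j (by omega))
  rw [inv_inv] at inv_mul
  rw [adj]
  exact congrArg (bracketForm r x) (LinearMap.congr_fun inv_mul y)

end QuantumInt

/-! ### Generating all matchings from one -/

section Generation

variable {N k : ℕ} {f : PlanarMatching N} {x y : Fin N}

/-- The matching `(0 1)(2 3)⋯`. -/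
def stdMatching (N : ℕ) (hN : Even N) : PlanarMatching N where
  partner :=
    { toFun := fun i => ⟨if (i : ℕ) % 2 = 0 then i + 1 else i - 1, by grind⟩
      invFun := fun i => ⟨if (i : ℕ) % 2 = 0 then i + 1 else i - 1, by grind⟩
      left_inv := fun i => by ext; simp only; grind
      right_inv := fun i => by ext; simp only; grind }
  invol i := by ext; simp only [Equiv.coe_fn_mk]; grind
  noFix i := by rw [ne_eq, Fin.ext_iff]; simp only [Equiv.coe_fn_mk]; grind
  planar i j := by simp only [Equiv.coe_fn_mk, Fin.lt_def]; grind

theorem stdMatching_partner (hN : Even N) (h : (x : ℕ) + 1 = y) (hx : (x : ℕ) % 2 = 0) :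
    (stdMatching N hN).partner x = y := by
  ext
  change (if (x : ℕ) % 2 = 0 then (x : ℕ) + 1 else x - 1) = y
  rw [if_pos hx, h]

namespace PlanarMatching

/-- The restriction of `f` to the first `2 * k` points is `(0 1)(2 3)⋯`. -/
def StdBelow (f : PlanarMatching N) (k : ℕ) : Prop :=
  ∀ x y : Fin N, (x : ℕ) + 1 = y → (x : ℕ) % 2 = 0 → (x : ℕ) < 2 * k → f.partner x = y

theorem eq_stdMatching (hN : Even N) (hk : N ≤ 2 * k) (hf : f.StdBelow k) :
    f = stdMatching N hN := by
  refine ext_partner fun z => ?_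
  rcases Nat.mod_two_eq_zero_or_one z with h | h
  · have hz : (z : ℕ) + 1 < N := by grind
    rw [hf z ⟨z + 1, hz⟩ rfl h (by omega), stdMatching_partner hN (y := ⟨z + 1, hz⟩) rfl h]
  · have hw : (z : ℕ) - 1 + 1 = z := by omega
    have h1 := hf ⟨z - 1, by omega⟩ z hw (by simp only; omega) (by simp only; omega)
    have h2 := stdMatching_partner hN (x := ⟨z - 1, by omega⟩) hw (by simp only; omega)
    rw [f.partner_eq_comm.1 h1, (stdMatching N hN).partner_eq_comm.1 h2]

theorem StdBelow.partner_lt (hf : f.StdBelow k) (hN : 2 * k ≤ N) {z : Fin N}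
    (hz : (z : ℕ) < 2 * k) : (f.partner z : ℕ) < 2 * k := by
  rcases Nat.mod_two_eq_zero_or_one z with h | h
  · rw [hf z ⟨z + 1, by omega⟩ rfl h hz]
    simp only
    omega
  · have hw : (z : ℕ) - 1 + 1 = z := by omega
    have h1 := hf ⟨z - 1, by omega⟩ z hw (by simp only; omega) (by simp only; omega)
    rw [f.partner_eq_comm.1 h1]
    simp only
    omega

theorem StdBelow.glueArc (hf : f.StdBelow k) (hN : 2 * k ≤ N) (h : (x : ℕ) + 1 = y)
    (hx : 2 * k ≤ x) : (glueArc f x y h).StdBelow k := by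
  intro z w hzw hz hzk
  have := hf.partner_lt hN hzk
  rw [glueArc_partner_of_ne h, hf z w hzw hz hzk]
  all_goals rw [ne_eq, Fin.ext_iff]; omega

theorem StdBelow.succ (hf : f.StdBelow k) (h : (x : ℕ) + 1 = y) (hx : (x : ℕ) = 2 * k)
    (hfx : f.partner x = y) : f.StdBelow (k + 1) := by
  intro z w hzw hz hzk
  by_cases hzk' : (z : ℕ) < 2 * k
  · exact hf z w hzw hz hzk'
  · obtain rfl : z = x := Fin.ext (by omega)
    obtain rfl : w = y := Fin.ext (by omega)
    exact hfx

theorem exists_innermost (f : PlanarMatching N) (x : Fin N) (hx : x < f.partner x) :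
    ∃ u v : Fin N, (u : ℕ) + 1 = v ∧ x ≤ u ∧ f.partner u = v := by
  induction hd : (f.partner x : ℕ) - x using Nat.strong_induction_on generalizing x with
  | _ d ih =>
    rw [Fin.lt_def] at hx
    by_cases hxy : (x : ℕ) + 1 = f.partner x
    · exact ⟨x, f.partner x, hxy, le_rfl, rfl⟩
    obtain ⟨u, hu⟩ : ∃ u : Fin N, (u : ℕ) = x + 1 := ⟨⟨x + 1, by omega⟩, rfl⟩
    have hlt := f.planar x u
    simp only [Fin.lt_def] at hlt
    have hux : f.partner u ≠ x := fun h => by rw [f.partner_eq_comm.1 h] at hxy; omega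
    have hgt : (f.partner u : ℕ) ≠ u := fun h => f.noFix u (Fin.ext h)
    have hgt' : (x : ℕ) < f.partner u := by
      by_contra hle
      have := f.planar (f.partner u) x
      simp only [f.invol, Fin.lt_def] at this
      have : (f.partner u : ℕ) ≠ x := fun h => hux (Fin.ext h)
      omega
    obtain ⟨v, w, hvw, huv, hv⟩ := ih _ (by omega) u (by rw [Fin.lt_def]; omega) rfl
    exact ⟨v, w, hvw, by rw [Fin.le_def] at huv ⊢; omega, hv⟩

theorem StdBelow.exists_innermost (hf : f.StdBelow k) (hk : 2 * k < N) :
    ∃ u v : Fin N, (u : ℕ) + 1 = v ∧ 2 * k ≤ u ∧ f.partner u = v := by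
  obtain ⟨z, hzk⟩ : ∃ z : Fin N, (z : ℕ) = 2 * k := ⟨⟨2 * k, hk⟩, rfl⟩
  have hz : ¬ (f.partner z : ℕ) < 2 * k := fun h => by
    have := hf.partner_lt hk.le h
    rw [f.invol] at this
    omega
  have hz' : (f.partner z : ℕ) ≠ z := fun h => f.noFix z (Fin.ext h)
  obtain ⟨u, v, huv, hu, hfu⟩ := PlanarMatching.exists_innermost f z (by rw [Fin.lt_def]; omega)
  exact ⟨u, v, huv, by rw [Fin.le_def] at hu; omega, hfu⟩

section Induction

variable {P : PlanarMatching N → Prop}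
  (hg : ∀ f, ∀ x y : Fin N, ∀ h : (x : ℕ) + 1 = y, 1 ≤ (x : ℕ) → P f → P (CSJones.glueArc f x y h))

include hg

theorem StdBelow.of_short_arc (hP : ∀ g : PlanarMatching N, g.StdBelow (k + 1) → P g)
    (hf : f.StdBelow k) (h : (x : ℕ) + 1 = y) (hx : 2 * k ≤ x) (hfx : f.partner x = y) : P f := by
  induction e : (x : ℕ) - 2 * k generalizing f x y with
  | zero => exact hP f (hf.succ h (by omega) hfx)
  | succ e ih =>
    have hz : (x : ℕ) - 1 + 1 = x := by omega
    let z : Fin N := ⟨x - 1, by omega⟩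
    rw [← glueArc_glueArc_of_partner (u := z) h hz (Or.inr rfl) hfx]
    refine hg _ x y h (by omega) (ih (x := z) (hf.glueArc (by omega) hz ?_) hz ?_
      (glueArc_partner_left f hz) ?_) <;> simp only [z] <;> omega

theorem StdBelow.induction (hN : Even N) (h0 : P (stdMatching N hN)) {d : ℕ}
    (hd : N = 2 * (k + d)) (hf : f.StdBelow k) : P f := by
  induction d generalizing f k with
  | zero => rwa [eq_stdMatching hN hd.le hf]
  | succ d ih =>
    obtain ⟨u, v, huv, hu, hfu⟩ := hf.exists_innermost (by omega)
    exact StdBelow.of_short_arc hg (fun g hgk => ih (by omega) hgk) hf huv hu hfu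

theorem induction (hN : Even N) (h0 : P (stdMatching N hN)) (f : PlanarMatching N) : P f := by
  obtain ⟨M, hM⟩ := hN.two_dvd
  exact StdBelow.induction hg hN h0 (k := 0) (d := M) (by omega) fun x y _ _ h => by omega

end Induction

theorem eq_stdMatching_of_pos (hN : Even N)
    (hf : ∀ x y : Fin N, (x : ℕ) + 1 = y → (x : ℕ) % 2 = 0 → 1 ≤ (x : ℕ) → f.partner x = y) :
    f = stdMatching N hN := by
  refine eq_stdMatching (k := N) hN (by omega) fun x y hxy hx _ => ?_
  by_cases h1 : 1 ≤ (x : ℕ)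
  · exact hf x y hxy hx h1
  by_contra hfx
  obtain ⟨z, hz⟩ : ∃ z, z = f.partner x := ⟨_, rfl⟩
  have hfz : f.partner z = x := f.partner_eq_comm.1 hz.symm
  have hzx : (z : ℕ) ≠ x := fun h => f.noFix x (hz ▸ Fin.ext h)
  have hzy : (z : ℕ) ≠ y := fun h => hfx (hz ▸ Fin.ext h)
  have hpos : 2 ≤ (f.partner z : ℕ) := by
    rcases Nat.mod_two_eq_zero_or_one z with h | h
    · rw [hf z ⟨z + 1, by grind⟩ rfl h (by omega)]
      simp only
      omega
    · rw [f.partner_eq_comm.1 (hf ⟨z - 1, by omega⟩ z (by simp only; omega) (by simp only; omega)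
        (by simp only; omega))]
      simp only
      omega
  rw [hfz] at hpos
  omega

end PlanarMatching

end Generation

/-! ### Operators commuting with the Temperley-Lieb action -/

section Commutant

variable {r N : ℕ} {x y : Fin N}

theorem partner_eq_of_cupCap_apply_ne_zero (h : (x : ℕ) + 1 = y) {f : PlanarMatching N}
    {v : Skein N} (hv : cupCap r N x v f ≠ 0) : f.partner x = y := by
  by_contra hf
  refine hv (LinearMap.congr_fun (?_ : LinearMap.proj f ∘ₗ cupCap r N x = 0) v)
  refine skein_hom_ext fun g => ?_
  rw [LinearMap.comp_apply, cupCap_single r g h, LinearMap.proj_apply, Pi.smul_apply,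
    Pi.single_eq_of_ne, smul_zero, LinearMap.zero_apply]
  rintro rfl
  exact hf (glueArc_partner_left g h)

theorem arcWeight_ne_zero (hr : 3 ≤ r) (f : PlanarMatching N) (x y : Fin N) :
    arcWeight r f x y ≠ 0 := by
  rw [arcWeight]
  split_ifs
  exacts [loopValue_ne_zero hr, one_ne_zero]

theorem single_glueArc (hr : 3 ≤ r) (f : PlanarMatching N) (h : (x : ℕ) + 1 = y) :
    Pi.single (glueArc f x y h) (1 : ℂ) =
      cupCap r N x ((arcWeight r f x y)⁻¹ • Pi.single f (1 : ℂ)) := by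
  rw [map_smul, cupCap_single r f h, smul_smul, inv_mul_cancel₀ (arcWeight_ne_zero hr f x y),
    one_smul]

theorem cupCap_stdMatching (r : ℕ) (hN : Even N) (h : (x : ℕ) + 1 = y) (hx : (x : ℕ) % 2 = 0) :
    cupCap r N x (Pi.single (stdMatching N hN) 1) =
      loopValue r • Pi.single (stdMatching N hN) (1 : ℂ) := by
  have hpartner := stdMatching_partner hN h hx
  rw [cupCap_single r _ h, arcWeight, if_pos hpartner, glueArc_of_partner h hpartner]

variable {T : Module.End ℂ (Skein N)}

theorem exists_apply_stdMatching (hr : 3 ≤ r) (hN : Even N)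
    (hT : ∀ j, 1 ≤ j → j + 1 < N → Commute T (cupCap r N j)) :
    ∃ c : ℂ, T (Pi.single (stdMatching N hN) 1) = c • Pi.single (stdMatching N hN) (1 : ℂ) := by
  set v := T (Pi.single (stdMatching N hN) 1) with hv
  have hsupp (f : PlanarMatching N) (hf : v f ≠ 0) : f = stdMatching N hN := by
    refine PlanarMatching.eq_stdMatching_of_pos hN fun x y hxy hx h1 => ?_
    have heig : cupCap r N x v = loopValue r • v := by
      rw [hv, ← Module.End.mul_apply, ← (hT x h1 (by omega)).eq, Module.End.mul_apply,
        cupCap_stdMatching r hN hxy hx, map_smul]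
    refine partner_eq_of_cupCap_apply_ne_zero (r := r) (v := v) hxy ?_
    rw [heig]
    exact mul_ne_zero (loopValue_ne_zero hr) hf
  refine ⟨v (stdMatching N hN), ?_⟩
  ext f
  by_cases hf : f = stdMatching N hN
  · simp [hf]
  · simp [hf, not_imp_comm.1 (hsupp f) hf]

theorem exists_eq_smul_of_commute (hr : 3 ≤ r) (hN : Even N)
    (hT : ∀ j, 1 ≤ j → j + 1 < N → Commute T (cupCap r N j)) : ∃ c : ℂ, T = c • 1 := by
  obtain ⟨c, hc⟩ := exists_apply_stdMatching hr hN hT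
  refine ⟨c, skein_hom_ext (PlanarMatching.induction (fun f x y hxy hx ih => ?_) hN hc)⟩
  rw [single_glueArc hr f hxy, ← Module.End.mul_apply, (hT x hx (by omega)).eq,
    Module.End.mul_apply, map_smul T, ih]
  simp only [LinearMap.smul_apply, Module.End.one_apply, map_smul]

theorem exists_ascending_mul_descending_crossing (hr : 3 ≤ r) {a : ℂ}
    (ha : IsKauffmanParameter (loopValue r) a) {n : ℕ} (hn : Odd n) :
    ∃ c : ℂ, ascending (fun i => (crossing r (n + 1) a i : Module.End ℂ (Skein (n + 1)))) n *
      descending (fun i => (crossing r (n + 1) a i : Module.End ℂ (Skein (n + 1)))) n = c • 1 :=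
  exists_eq_smul_of_commute hr hn.add_one fun _ h1 h2 =>
    commute_of_commute_kauffmanCrossing ha.ne_zero
      (((isTemperleyLieb_cupCap r (n + 1)).isBraided_crossing ha).ascending_mul_descending_commute
        h1 (by omega))

theorem exists_ascending_pow_crossing (hr : 3 ≤ r) {a : ℂ}
    (ha : IsKauffmanParameter (loopValue r) a) {n : ℕ} (hn : Odd n) :
    ∃ c : ℂ, ascending (fun i => (crossing r (n + 1) a i : Module.End ℂ (Skein (n + 1)))) n ^
      (n + 1) = c • 1 :=
  exists_eq_smul_of_commute hr hn.add_one fun _ _ h2 =>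
    commute_of_commute_kauffmanCrossing ha.ne_zero
      (((isTemperleyLieb_cupCap r (n + 1)).isBraided_crossing ha).ascending_pow_commute (by omega))

end Commutant

/-! ### The path model -/

/-- Height functions of lattice paths from `0` to `0` of length `N` with heights in `[0, r - 2]`,
extended by `0` beyond `N`. They index an orthonormal basis of the truncated skein space. -/
structure IsPath (r N : ℕ) (h : ℕ → ℤ) : Prop where
  zero : h 0 = 0
  step : ∀ i < N, h (i + 1) = h i + 1 ∨ h (i + 1) = h i - 1
  nonneg : ∀ i, 0 ≤ h i
  le : ∀ i, h i + 2 ≤ r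
  eq_zero : ∀ i, N ≤ i → h i = 0

/-- The type of lattice paths of `IsPath`. -/
abbrev Path (r N : ℕ) : Type := {h : ℕ → ℤ // IsPath r N h}

instance (r N : ℕ) : Finite (Path r N) := by
  refine Finite.of_injective (fun (h : Path r N) (i : Fin N) =>
    (⟨h.1 i, Finset.mem_Icc.2 ⟨h.2.nonneg i, by have := h.2.le i; omega⟩⟩ :
      Finset.Icc (0 : ℤ) r)) fun h k hk => Subtype.ext (funext fun i => ?_)
  by_cases hi : i < N
  · exact congrArg Subtype.val (congrFun hk ⟨i, hi⟩)
  · rw [h.2.eq_zero i (by omega), k.2.eq_zero i (by omega)]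

noncomputable instance (r N : ℕ) : Fintype (Path r N) := Fintype.ofFinite _

noncomputable instance (r N : ℕ) : DecidableEq (Path r N) := Classical.decEq _

/-- The quantum dimension `[k + 1]` of the label `k`. -/
noncomputable def qdim (r : ℕ) (k : ℤ) : ℝ := quantumInt r (k + 1)

/-- The square root of the quantum dimension of the label `k`. -/
noncomputable def sqdim (r : ℕ) (k : ℤ) : ℝ := √(qdim r k)

theorem IsPath.qdim_pos {r N : ℕ} {h : ℕ → ℤ} (hh : IsPath r N h) (i : ℕ) : 0 < qdim r (h i) :=
  quantumInt_pos (by have := hh.nonneg i; omega) (by have := hh.le i; omega)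

theorem IsPath.sqdim_pos {r N : ℕ} {h : ℕ → ℤ} (hh : IsPath r N h) (i : ℕ) : 0 < sqdim r (h i) :=
  Real.sqrt_pos.2 (hh.qdim_pos i)

theorem IsPath.sqdim_mul_self {r N : ℕ} {h : ℕ → ℤ} (hh : IsPath r N h) (i : ℕ) :
    sqdim r (h i) * sqdim r (h i) = qdim r (h i) :=
  Real.mul_self_sqrt (hh.qdim_pos i).le

/-- Two height functions agree except possibly at `j + 1`. -/
def AgreeOff (j : ℕ) (h k : ℕ → ℤ) : Prop := ∀ i, i ≠ j + 1 → h i = k i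

theorem AgreeOff.symm {j : ℕ} {h k : ℕ → ℤ} (hk : AgreeOff j h k) : AgreeOff j k h :=
  fun i hi => (hk i hi).symm

theorem AgreeOff.eq_update {j : ℕ} {h k : ℕ → ℤ} (hk : AgreeOff j h k) :
    k = Function.update h (j + 1) (k (j + 1)) := by
  ext i
  by_cases hi : i = j + 1
  · rw [hi, Function.update_self]
  · rw [Function.update_of_ne hi, hk i hi]

theorem agreeOff_update (j : ℕ) (h : ℕ → ℤ) (c : ℤ) :
    AgreeOff j h (Function.update h (j + 1) c) :=
  fun i hi => by rw [Function.update_of_ne hi]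

theorem AgreeOff.step_eq {j : ℕ} {h k : ℕ → ℤ} (hk : AgreeOff j h k) {z : ℕ} (h1 : z ≠ j)
    (h2 : z ≠ j + 1) : k z = h z ∧ k (z + 1) = h (z + 1) :=
  ⟨(hk z h2).symm, (hk (z + 1) (by omega)).symm⟩

theorem IsPath.update {r N : ℕ} {h : ℕ → ℤ} (hh : IsPath r N h) {j : ℕ} (hj : j + 1 < N)
    (hb : h j = h (j + 2)) {c : ℤ} (hc : c = h j + 1 ∨ c = h j - 1) (h0 : 0 ≤ c)
    (hr : c + 2 ≤ r) : IsPath r N (Function.update h (j + 1) c) where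
  zero := by rw [Function.update_of_ne (by omega), hh.zero]
  step i hi := by
    by_cases h1 : i = j
    · subst h1
      rwa [Function.update_self, Function.update_of_ne (by omega)]
    by_cases h2 : i = j + 1
    · subst h2
      rw [Function.update_self, Function.update_of_ne (by omega), ← hb]
      omega
    rw [Function.update_of_ne (by omega), Function.update_of_ne h2]
    exact hh.step i hi
  nonneg i := by
    by_cases h1 : i = j + 1
    · rwa [h1, Function.update_self]
    · rw [Function.update_of_ne h1]
      exact hh.nonneg i
  le i := by
    by_cases h1 : i = j + 1
    · rwa [h1, Function.update_self]
    · rw [Function.update_of_ne h1]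
      exact hh.le i
  eq_zero i hi := by rw [Function.update_of_ne (by omega), hh.eq_zero i hi]

open Classical in
/-- The matrix entries of `U_j` in the path model. -/
noncomputable def pathEntry (r : ℕ) (j : ℕ) (h k : ℕ → ℤ) : ℝ :=
  if h j = h (j + 2) ∧ AgreeOff j h k then
    sqdim r (h (j + 1)) * sqdim r (k (j + 1)) / qdim r (h j) else 0

theorem pathEntry_symm (r j : ℕ) (h k : ℕ → ℤ) : pathEntry r j h k = pathEntry r j k h := by
  by_cases hk : AgreeOff j h k
  · simp only [pathEntry, hk, hk.symm, hk j (by omega), hk (j + 2) (by omega),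
      mul_comm (sqdim r (h _))]
  · rw [pathEntry, pathEntry, if_neg fun e => hk e.2, if_neg fun e => hk e.2.symm]

open Classical in
theorem sum_agreeOff_eq_sum_filter {r N : ℕ} (h : Path r N) {j : ℕ} (hj : j + 1 < N)
    (hb : h.1 j = h.1 (j + 2)) (F : ℤ → ℝ) :
    ∑ k : Path r N with AgreeOff j h.1 k.1, F (k.1 (j + 1)) =
      ∑ c ∈ ({h.1 j + 1, h.1 j - 1} : Finset ℤ) with 0 ≤ c ∧ c + 2 ≤ (r : ℤ), F c := by
  refine Finset.sum_bij' (fun k _ => k.1 (j + 1))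
    (fun c hc => ⟨Function.update h.1 (j + 1) c, ?_⟩) ?_ ?_ ?_ ?_ fun _ _ => rfl
  · simp only [Finset.mem_filter, Finset.mem_insert, Finset.mem_singleton] at hc
    exact h.2.update hj hb hc.1 hc.2.1 hc.2.2
  · intro k hk
    rw [Finset.mem_filter_univ] at hk
    simp only [Finset.mem_filter, Finset.mem_insert, Finset.mem_singleton]
    refine ⟨?_, k.2.nonneg _, k.2.le _⟩
    rw [hk j (by omega)]
    exact k.2.step j (by omega)
  · exact fun c _ => (Finset.mem_filter_univ _).2 (agreeOff_update j h.1 c)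
  · exact fun k hk => Subtype.ext ((Finset.mem_filter_univ _).1 hk).eq_update.symm
  · exact fun c _ => Function.update_self ..

open Classical in
theorem sum_agreeOff_qdim {r N : ℕ} (hr : 2 ≤ r) (h : Path r N) {j : ℕ} (hj : j + 1 < N)
    (hb : h.1 j = h.1 (j + 2)) :
    ∑ k : Path r N with AgreeOff j h.1 k.1, qdim r (k.1 (j + 1)) =
      quantumInt r 2 * qdim r (h.1 j) := by
  have nonneg := h.2.nonneg j
  have le := h.2.le j
  have qdim_eq_zero : ∀ c ∈ ({h.1 j + 1, h.1 j - 1} : Finset ℤ),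
      qdim r c ≠ 0 → 0 ≤ c ∧ c + 2 ≤ (r : ℤ) := by
    refine fun c hc hne => by_contra fun hout => hne ?_
    rw [Finset.mem_insert, Finset.mem_singleton] at hc
    obtain rfl | hc' : c = -1 ∨ c + 1 = r := by omega
    · exact quantumInt_zero r
    · rw [qdim, hc', quantumInt_self (by omega)]
  rw [sum_agreeOff_eq_sum_filter h hj hb, Finset.sum_filter_of_ne qdim_eq_zero,
    Finset.sum_pair (by omega), qdim, qdim, qdim, quantumInt_two_mul hr]
  congr 2
  ring

/-! ### Matchings as vectors in the path model -/

/-- The arcs of `f` join opposite steps of `h`. -/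
def Fits {N : ℕ} (f : PlanarMatching N) (h : ℕ → ℤ) : Prop :=
  ∀ x : Fin N, h (x + 1) - h x = -(h (f.partner x + 1) - h (f.partner x))

theorem PlanarMatching.inside {N : ℕ} (f : PlanarMatching N) {x z : Fin N} (h1 : x < z)
    (h2 : z < f.partner x) : x < f.partner z ∧ f.partner z < f.partner x := by
  have p1 := f.planar x z
  have p2 := f.planar (f.partner z) x
  rw [f.invol] at p2
  have n1 : f.partner z ≠ f.partner x := fun e => h1.ne' (f.partner.injective e)
  have n2 : f.partner z ≠ x := fun e => h2.ne' (f.partner_eq_comm.1 e)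
  grind

/-- The steps of `h` strictly inside an arc of `f` cancel in pairs. -/
theorem Fits.inner_eq {N : ℕ} {f : PlanarMatching N} {h : ℕ → ℤ} (hf : Fits f h) {x : Fin N}
    (hx : x < f.partner x) : h (x + 1) = h (f.partner x) := by
  have sum_steps : ∑ i ∈ Finset.Ico ((x : ℕ) + 1) (f.partner x), (h (i + 1) - h i) = 0 := by
    have hlt : ∀ i ∈ Finset.Ico ((x : ℕ) + 1) (f.partner x), i < N := fun i hi =>
      (Finset.mem_Ico.1 hi).2.trans (f.partner x).isLt
    refine Finset.sum_involution (fun i hi => (f.partner ⟨i, hlt i hi⟩ : ℕ)) ?_ ?_ ?_ ?_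
    · intro i hi
      have := hf ⟨i, hlt i hi⟩
      simp only at this
      omega
    · exact fun i hi _ e => f.noFix ⟨i, hlt i hi⟩ (Fin.ext e)
    · intro i hi
      have hi' := Finset.mem_Ico.1 hi
      have := f.inside (x := x) (z := ⟨i, hlt i hi⟩) (Fin.lt_def.2 hi'.1) (Fin.lt_def.2 hi'.2)
      exact Finset.mem_Ico.2 this
    · intro i hi
      simp only [Fin.eta, f.invol]
  rw [Fin.lt_def] at hx
  rw [Finset.sum_Ico_eq_sub _ (by omega), Finset.sum_range_sub, Finset.sum_range_sub] at sum_steps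
  omega

theorem Fits.partner_eq {N : ℕ} {f : PlanarMatching N} {h : ℕ → ℤ} (hf : Fits f h) (x : Fin N) :
    h (f.partner x) = h (x + 1) ∧ h (f.partner x + 1) = h x := by
  have h1 := hf x
  rcases lt_or_gt_of_ne (f.noFix x) with hx | hx
  · have := hf.inner_eq (x := f.partner x) (by rwa [f.invol])
    rw [f.invol] at this
    omega
  · have := hf.inner_eq hx
    omega

/-- The factor of `matchingVec` at the point `x`: the arc of `f` that starts at `x` contributes
the square root of the ratio of the quantum dimensions below and above it. -/
noncomputable def openWeight (r : ℕ) {N : ℕ} (f : PlanarMatching N) (h : ℕ → ℤ) (x : Fin N) : ℝ :=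
  if x < f.partner x then sqdim r (h (x + 1)) / sqdim r (h x) else 1

open Classical in
/-- The coordinates of the matching `f` in the path model. -/
noncomputable def matchingVec (r : ℕ) {N : ℕ} (f : PlanarMatching N) (h : ℕ → ℤ) : ℝ :=
  if Fits f h then ∏ x, openWeight r f h x else 0

section Intertwining

variable {r N : ℕ} {f : PlanarMatching N} {x y : Fin N}

theorem Fits.eq_add_two {h : ℕ → ℤ} (hfit : Fits f h) (hxy : (x : ℕ) + 1 = y)
    (hf : f.partner x = y) : h x = h (x + 2) := by
  have := (hfit.partner_eq x).2
  rw [hf, ← hxy] at this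
  exact this.symm

theorem Fits.of_agreeOff {h k : ℕ → ℤ} (hxy : (x : ℕ) + 1 = y) (hf : f.partner x = y)
    (hk : AgreeOff x h k) (hfit : Fits f h) : Fits f k := by
  have hb := hfit.eq_add_two hxy hf
  have hf' := f.partner_eq_comm.1 hf
  have hx := hk x (by omega)
  have hx2 := hk (x + 2) (by omega)
  intro z
  by_cases zx : z = x
  · subst zx
    rw [hf, ← hxy, show (z : ℕ) + 1 + 1 = z + 2 from rfl]
    omega
  by_cases zy : z = y
  · subst zy
    rw [hf', ← hxy, show (x : ℕ) + 1 + 1 = x + 2 from rfl]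
    omega
  have hz : ∀ {w : Fin N}, w ≠ x → w ≠ y → k w = h w ∧ k (w + 1) = h (w + 1) :=
    fun wx wy => hk.step_eq (fun e => wx (Fin.ext e)) (fun e => wy (Fin.ext (e.trans hxy)))
  have px : f.partner z ≠ x := fun e => zy (by rw [← hf, f.partner_eq_comm.1 e])
  have py : f.partner z ≠ y := fun e => zx (by rw [← hf', f.partner_eq_comm.1 e])
  rw [(hz zx zy).1, (hz zx zy).2, (hz px py).1, (hz px py).2]
  exact hfit z

theorem matchingVec_agreeOff {h k : Path r N} (hxy : (x : ℕ) + 1 = y) (hf : f.partner x = y)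
    (hk : AgreeOff x h.1 k.1) :
    matchingVec r f k.1 * sqdim r (h.1 (x + 1)) = matchingVec r f h.1 * sqdim r (k.1 (x + 1)) := by
  by_cases hfit : Fits f h.1
  · have hlt : x < f.partner x := by rw [hf, Fin.lt_def]; omega
    have rest : ∏ z ∈ Finset.univ.erase x, openWeight r f k.1 z =
        ∏ z ∈ Finset.univ.erase x, openWeight r f h.1 z := by
      refine Finset.prod_congr rfl fun z hz => ?_
      have zx : (z : ℕ) ≠ x := fun e => (Finset.mem_erase.1 hz).1 (Fin.ext e)
      by_cases zy : z = y
      · rw [openWeight, openWeight, zy, f.partner_eq_comm.1 hf, if_neg, if_neg] <;>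
          rw [Fin.lt_def] <;> omega
      · obtain ⟨hz, hz'⟩ := hk.step_eq zx (fun e => zy (Fin.ext (e.trans hxy)))
        rw [openWeight, openWeight, hz, hz']
    rw [matchingVec, matchingVec, if_pos hfit, if_pos (hfit.of_agreeOff hxy hf hk),
      ← Finset.mul_prod_erase _ _ (Finset.mem_univ x),
      ← Finset.mul_prod_erase _ (openWeight r f h.1) (Finset.mem_univ x), rest, openWeight,
      openWeight, if_pos hlt, if_pos hlt, hk x (by omega)]
    ring
  · rw [matchingVec, matchingVec, if_neg hfit, if_neg, zero_mul, zero_mul]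
    exact fun hfit' => hfit (hfit'.of_agreeOff hxy hf hk.symm)

theorem sum_pathEntry_of_partner (hr : 2 ≤ r) (hxy : (x : ℕ) + 1 = y) (hf : f.partner x = y)
    (h : Path r N) : ∑ k : Path r N, pathEntry r x h.1 k.1 * matchingVec r f k.1 =
      quantumInt r 2 * matchingVec r f h.1 := by
  classical
  by_cases hb : h.1 x = h.1 (x + 2)
  · have hq := (h.2.qdim_pos x).ne'
    have term : ∀ k : Path r N, pathEntry r x h.1 k.1 * matchingVec r f k.1 =
        matchingVec r f h.1 / qdim r (h.1 x) *
          (if AgreeOff x h.1 k.1 then qdim r (k.1 (x + 1)) else 0) := by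
      intro k
      by_cases hk : AgreeOff x h.1 k.1
      · rw [pathEntry, if_pos ⟨hb, hk⟩, if_pos hk, ← k.2.sqdim_mul_self]
        field_simp
        linear_combination sqdim r (k.1 (x + 1)) * matchingVec_agreeOff hxy hf hk
      · rw [pathEntry, if_neg (fun h => hk h.2), if_neg hk, zero_mul, mul_zero]
    rw [Finset.sum_congr rfl fun k _ => term k, ← Finset.mul_sum, ← Finset.sum_filter,
      sum_agreeOff_qdim hr h (by omega) hb]
    field_simp
  · rw [Finset.sum_eq_zero, matchingVec, if_neg fun hfit => hb (hfit.eq_add_two hxy hf), mul_zero]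
    intro k _
    rw [pathEntry, if_neg (fun h => hb h.1), zero_mul]

theorem AgreeOff.step_eq_of_ne {h k : ℕ → ℤ} (hk : AgreeOff x h k) (hxy : (x : ℕ) + 1 = y)
    {z : Fin N} (zx : z ≠ x) (zy : z ≠ y) : k z = h z ∧ k (z + 1) = h (z + 1) :=
  hk.step_eq (fun e => zx (Fin.ext e)) (fun e => zy (Fin.ext (e.trans hxy)))

theorem Fits.glueArc {h k : ℕ → ℤ} (hxy : (x : ℕ) + 1 = y) (hf : f.partner x ≠ y)
    (hb : h x = h (x + 2)) (hk : AgreeOff x h k) (hfit : Fits f k) :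
    Fits (glueArc f x y hxy) h := by
  have hf' : f.partner y ≠ x := fun e => hf (f.partner_eq_comm.1 e)
  have hx := hk x (by omega)
  have hx2 := hk (x + 2) (by omega)
  obtain ⟨px, px'⟩ := hk.step_eq_of_ne hxy (f.noFix x) hf
  obtain ⟨py, py'⟩ := hk.step_eq_of_ne hxy hf' (f.noFix y)
  have hy2 : (y : ℕ) + 1 = x + 2 := by omega
  have fx := hfit x
  have fy := hfit y
  rw [hy2, ← hxy] at fy
  intro z
  by_cases zx : z = x
  · subst zx
    rw [glueArc_partner_left, hy2, ← hxy]
    omega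
  by_cases zy : z = y
  · subst zy
    rw [glueArc_partner_right, hy2, ← hxy]
    omega
  obtain ⟨hz, hz'⟩ := hk.step_eq_of_ne hxy zx zy
  rw [glueArc_partner, if_neg zx, if_neg zy]
  split_ifs with h1 h2
  · rw [h1]
    omega
  · rw [h2]
    omega
  · obtain ⟨pz, pz'⟩ := hk.step_eq_of_ne hxy (fun e => h1 (f.partner_eq_comm.1 e).symm)
      (fun e => h2 (f.partner_eq_comm.1 e).symm)
    have := hfit z
    omega

theorem Fits.of_glueArc {h k : ℕ → ℤ} (hxy : (x : ℕ) + 1 = y) (hf : f.partner x ≠ y)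
    (hk : AgreeOff x h k) (hfit : Fits (CSJones.glueArc f x y hxy) h)
    (hc : k (x + 1) = h x - (h (f.partner x + 1) - h (f.partner x))) : Fits f k := by
  have hf' : f.partner y ≠ x := fun e => hf (f.partner_eq_comm.1 e)
  have hb := hfit.eq_add_two hxy (glueArc_partner_left f hxy)
  have hx := hk x (by omega)
  have hx2 := hk (x + 2) (by omega)
  obtain ⟨px, px'⟩ := hk.step_eq_of_ne hxy (f.noFix x) hf
  obtain ⟨py, py'⟩ := hk.step_eq_of_ne hxy hf' (f.noFix y)
  have hy2 : (y : ℕ) + 1 = x + 2 := by omega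
  have fx := hfit (f.partner x)
  rw [glueArc_partner, if_neg (f.noFix x), if_neg hf, if_pos rfl] at fx
  intro z
  by_cases zx : z = x
  · subst zx
    omega
  by_cases zy : z = y
  · subst zy
    rw [hy2, ← hxy]
    omega
  by_cases gx : f.partner z = x
  · rw [gx, ← f.partner_eq_comm.1 gx]
    omega
  by_cases gy : f.partner z = y
  · rw [gy, hy2, ← hxy, ← f.partner_eq_comm.1 gy]
    omega
  obtain ⟨hz, hz'⟩ := hk.step_eq_of_ne hxy zx zy
  obtain ⟨pz, pz'⟩ := hk.step_eq_of_ne hxy gx gy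
  have := hfit z
  rw [glueArc_partner_of_ne hxy zx zy gx gy] at this
  omega

theorem Fits.openWeight_mul_openWeight_partner {h : ℕ → ℤ} (hfit : Fits f h) (z : Fin N) :
    openWeight r f h z * openWeight r f h (f.partner z) =
      if z < f.partner z then sqdim r (h (z + 1)) / sqdim r (h z)
      else sqdim r (h z) / sqdim r (h (z + 1)) := by
  rw [openWeight, openWeight, f.invol, (hfit.partner_eq z).1, (hfit.partner_eq z).2]
  rcases lt_or_gt_of_ne (f.noFix z) with hz | hz
  · rw [if_neg hz.asymm, if_pos hz, if_neg hz.asymm, one_mul]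
  · rw [if_pos hz, if_neg hz.asymm, if_pos hz, mul_one]

theorem PlanarMatching.partner_trichotomy (hxy : (x : ℕ) + 1 = y) (hf : f.partner x ≠ y) :
    (f.partner x < x ∧ y < f.partner y ∧ f.partner x < f.partner y) ∨
      (x < f.partner x ∧ y < f.partner y ∧ f.partner y < f.partner x) ∨
      (f.partner x < x ∧ f.partner y < y ∧ f.partner y < f.partner x) := by
  have p1 := f.planar x y
  have p2 := f.planar (f.partner x) (f.partner y)
  have p3 := f.planar (f.partner y) x
  have n1 := f.noFix x
  have n2 := f.noFix y
  have n3 : f.partner y ≠ x := fun e => hf (f.partner_eq_comm.1 e)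
  have n4 : f.partner x ≠ f.partner y := fun e => by
    have := f.partner.injective e
    omega
  simp only [f.invol] at p2 p3
  grind

theorem prod_eq_mul_prod_sdiff (hxy : x ≠ y) (hf : f.partner x ≠ y) (F : Fin N → ℝ) :
    ∏ z, F z = (∏ z ∈ Finset.univ \ {x, y, f.partner x, f.partner y}, F z) *
      ((F x * F (f.partner x)) * (F y * F (f.partner y))) := by
  have hf' : f.partner y ≠ x := fun e => hf (f.partner_eq_comm.1 e)
  have hxx := f.noFix x
  have hyy := f.noFix y
  have hpp : f.partner x ≠ f.partner y := fun e => hxy (f.partner.injective e)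
  rw [← Finset.prod_sdiff (Finset.subset_univ {x, y, f.partner x, f.partner y}),
    Finset.prod_insert (by simp [hxy, hxx.symm, hf'.symm]),
    Finset.prod_insert (by simp [hf.symm, hyy.symm]), Finset.prod_pair hpp]
  ring

theorem mul_openWeight_endpoints {h k : Path r N} (hxy : (x : ℕ) + 1 = y) (hf : f.partner x ≠ y)
    (hb : h.1 x = h.1 (x + 2)) (hk : AgreeOff x h.1 k.1) (hfit : Fits f k.1) :
    sqdim r (h.1 (x + 1)) * sqdim r (k.1 (x + 1)) / qdim r (h.1 x) *
        ((openWeight r f k.1 x * openWeight r f k.1 (f.partner x)) *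
          (openWeight r f k.1 y * openWeight r f k.1 (f.partner y))) =
      (openWeight r (glueArc f x y hxy) h.1 x * openWeight r (glueArc f x y hxy) h.1 y) *
        (openWeight r (glueArc f x y hxy) h.1 (f.partner x) *
          openWeight r (glueArc f x y hxy) h.1 (f.partner y)) := by
  have hfit' := hfit.glueArc hxy hf hb hk
  have glue_left := glueArc_partner_left f hxy
  have glue_partner : (glueArc f x y hxy).partner (f.partner x) = f.partner y := by
    rw [glueArc_partner, if_neg (f.noFix x), if_neg hf, if_pos rfl]
  have outer := hfit'.openWeight_mul_openWeight_partner (r := r) (f.partner x)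
  have inner := hfit'.openWeight_mul_openWeight_partner (r := r) x
  rw [glue_partner] at outer
  rw [glue_left, if_pos (by rw [Fin.lt_def]; omega)] at inner
  rw [outer, inner, hfit.openWeight_mul_openWeight_partner, hfit.openWeight_mul_openWeight_partner]
  have k_left : k.1 x = h.1 x := (hk x (by omega)).symm
  have k_right : k.1 (y + 1) = h.1 x := by
    rw [← hxy, hb]
    exact (hk (x + 2) (by omega)).symm
  obtain ⟨px, px'⟩ := hk.step_eq_of_ne hxy (f.noFix x) hf
  rw [← px, ← px', (hfit.partner_eq x).1, (hfit.partner_eq x).2, k_left, k_right, ← hxy,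
    ← h.2.sqdim_mul_self]
  have := (h.2.sqdim_pos x).ne'
  have := (k.2.sqdim_pos (x + 1)).ne'
  rcases f.partner_trichotomy hxy hf with ⟨h1, h2, h3⟩ | ⟨h1, h2, h3⟩ | ⟨h1, h2, h3⟩
  · rw [if_neg h1.asymm, if_pos h2, if_pos h3]
    field_simp
  · rw [if_pos h1, if_pos h2, if_neg h3.asymm]
    field_simp
  · rw [if_neg h1.asymm, if_neg h2.asymm, if_neg h3.asymm]
    field_simp

theorem prod_openWeight_glueArc {h k : Path r N} (hxy : (x : ℕ) + 1 = y) (hf : f.partner x ≠ y)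
    (hb : h.1 x = h.1 (x + 2)) (hk : AgreeOff x h.1 k.1) (hfit : Fits f k.1) :
    sqdim r (h.1 (x + 1)) * sqdim r (k.1 (x + 1)) / qdim r (h.1 x) * ∏ z, openWeight r f k.1 z =
      ∏ z, openWeight r (glueArc f x y hxy) h.1 z := by
  have hne : x ≠ y := fun e => by rw [e] at hxy; omega
  have rest : ∏ z ∈ Finset.univ \ {x, y, f.partner x, f.partner y}, openWeight r f k.1 z =
      ∏ z ∈ Finset.univ \ {x, y, f.partner x, f.partner y},
        openWeight r (glueArc f x y hxy) h.1 z := by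
    refine Finset.prod_congr rfl fun z hz => ?_
    simp only [Finset.mem_sdiff, Finset.mem_univ, true_and, Finset.mem_insert,
      Finset.mem_singleton, not_or] at hz
    obtain ⟨zx, zy, gx, gy⟩ := hz
    obtain ⟨hz, hz'⟩ := hk.step_eq_of_ne hxy zx zy
    rw [openWeight, openWeight, hz, hz', glueArc_partner_of_ne hxy zx zy
      (fun e => gx (f.partner_eq_comm.1 e).symm) (fun e => gy (f.partner_eq_comm.1 e).symm)]
  rw [prod_eq_mul_prod_sdiff hne hf, prod_eq_mul_prod_sdiff hne hf, rest, mul_left_comm,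
    mul_openWeight_endpoints hxy hf hb hk hfit]
  ring

theorem existsUnique_fits_of_fits_glueArc (hxy : (x : ℕ) + 1 = y) (hf : f.partner x ≠ y)
    (h : Path r N) (hfit : Fits (glueArc f x y hxy) h.1) :
    ∃! k : Path r N, AgreeOff x h.1 k.1 ∧ Fits f k.1 := by
  have hb := hfit.eq_add_two hxy (glueArc_partner_left f hxy)
  let c := h.1 x - (h.1 (f.partner x + 1) - h.1 (f.partner x))
  have hagree := agreeOff_update x h.1 c
  have hfit' : Fits f (Function.update h.1 (x + 1) c) :=
    hfit.of_glueArc hxy hf hagree (Function.update_self ..)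
  have hc : c = h.1 (f.partner x) := by
    rw [← (hagree.step_eq_of_ne hxy (f.noFix x) hf).1, (hfit'.partner_eq x).1,
      Function.update_self]
  have hstep : c = h.1 x + 1 ∨ c = h.1 x - 1 := by
    have := h.2.step (f.partner x) (f.partner x).isLt
    omega
  refine ⟨⟨_, h.2.update (by omega) hb hstep (hc ▸ h.2.nonneg _) (hc ▸ h.2.le _)⟩,
    ⟨hagree, hfit'⟩, fun k ⟨hk, hfk⟩ => Subtype.ext ?_⟩
  have hkc : k.1 (x + 1) = c := by
    have := hfk.partner_eq x
    have := hk x (by omega)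
    have := hk.step_eq_of_ne hxy (f.noFix x) hf
    omega
  rw [hk.eq_update, hkc]

theorem sum_pathEntry_of_not_partner (hxy : (x : ℕ) + 1 = y) (hf : f.partner x ≠ y)
    (h : Path r N) : ∑ k : Path r N, pathEntry r x h.1 k.1 * matchingVec r f k.1 =
      matchingVec r (glueArc f x y hxy) h.1 := by
  have term_eq_zero : ∀ k : Path r N, ¬ (h.1 x = h.1 (x + 2) ∧ AgreeOff x h.1 k.1 ∧ Fits f k.1) →
      pathEntry r x h.1 k.1 * matchingVec r f k.1 = 0 := by
    intro k hk
    rw [pathEntry, matchingVec]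
    split_ifs with h1 h2 <;> simp_all
  by_cases hfit : Fits (glueArc f x y hxy) h.1
  · have hb := hfit.eq_add_two hxy (glueArc_partner_left f hxy)
    obtain ⟨k, ⟨hk, hfk⟩, hunique⟩ := existsUnique_fits_of_fits_glueArc hxy hf h hfit
    rw [Finset.sum_eq_single k (fun l _ hl => term_eq_zero l fun hl' => hl (hunique l hl'.2))
      (fun hk => absurd (Finset.mem_univ k) hk), pathEntry, if_pos ⟨hb, hk⟩, matchingVec,
      if_pos hfk, matchingVec, if_pos hfit, prod_openWeight_glueArc hxy hf hb hk hfk]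
  · rw [matchingVec, if_neg hfit]
    exact Finset.sum_eq_zero fun k _ => term_eq_zero k fun ⟨hb, hk, hfk⟩ =>
      hfit (hfk.glueArc hxy hf hb hk)

end Intertwining

/-- The operator `U_j` in the path model. -/
noncomputable def pathOp (r N j : ℕ) : (Path r N → ℂ) →ₗ[ℂ] (Path r N → ℂ) :=
  Matrix.mulVecLin (Matrix.of fun h k : Path r N => (pathEntry r j h.1 k.1 : ℂ))

theorem pathOp_apply (r N j : ℕ) (v : Path r N → ℂ) (h : Path r N) :
    pathOp r N j v h = ∑ k : Path r N, (pathEntry r j h.1 k.1 : ℂ) * v k := rfl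

/-- The map from skeins to the path model. Its kernel is the radical of the bracket form. -/
noncomputable def toPaths (r N : ℕ) : Skein N →ₗ[ℂ] (Path r N → ℂ) :=
  Fintype.linearCombination ℂ fun (f : PlanarMatching N) (h : Path r N) =>
    (matchingVec r f h.1 : ℂ)

theorem toPaths_single (r N : ℕ) (f : PlanarMatching N) (h : Path r N) :
    toPaths r N (Pi.single f 1) h = (matchingVec r f h.1 : ℂ) := by
  rw [toPaths, Fintype.linearCombination_apply_single, one_smul]

theorem toPaths_cupCap {r : ℕ} (hr : 2 ≤ r) {N j : ℕ} (hj : j + 1 < N) (v : Skein N) :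
    toPaths r N (cupCap r N j v) = pathOp r N j (toPaths r N v) := by
  suffices toPaths r N ∘ₗ cupCap r N j = pathOp r N j ∘ₗ toPaths r N from
    LinearMap.congr_fun this v
  refine skein_hom_ext fun f => funext fun h => ?_
  have hcup := cupCap_single r f (x := ⟨j, by omega⟩) (y := ⟨j + 1, hj⟩) rfl
  simp only at hcup
  rw [LinearMap.comp_apply, LinearMap.comp_apply, hcup, map_smul, Pi.smul_apply, toPaths_single,
    pathOp_apply, arcWeight, smul_eq_mul]
  simp only [toPaths_single]
  split_ifs with hf
  · rw [loopValue_eq_quantumInt hr, glueArc_of_partner rfl hf]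
    exact_mod_cast (sum_pathEntry_of_partner (x := ⟨j, by omega⟩) hr rfl hf h).symm
  · rw [one_mul]
    exact_mod_cast (sum_pathEntry_of_not_partner (x := ⟨j, by omega⟩) rfl hf h).symm

/-! ### The path model is isometric -/

section StandardPath

variable {r N : ℕ} {h : ℕ → ℤ}

/-- The zigzag path `0, 1, 0, 1, …, 0`. -/
def stdHeight (N i : ℕ) : ℤ := if i < N ∧ i % 2 = 1 then 1 else 0

theorem isPath_stdHeight (hr : 3 ≤ r) (hN : Even N) : IsPath r N (stdHeight N) where
  zero := by simp [stdHeight]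
  step i hi := by
    rw [stdHeight, stdHeight]
    have := Nat.even_iff.1 hN
    split_ifs <;> omega
  nonneg i := by rw [stdHeight]; split_ifs <;> omega
  le i := by rw [stdHeight]; split_ifs <;> omega
  eq_zero i hi := by rw [stdHeight, if_neg (by omega)]

/-- The zigzag path as an index of the path model. -/
def stdPath (hr : 3 ≤ r) (hN : Even N) : Path r N := ⟨stdHeight N, isPath_stdHeight hr hN⟩

theorem IsPath.mod_two (hh : IsPath r N h) : ∀ i ≤ N, h i % 2 = (i : ℤ) % 2
  | 0, _ => by rw [hh.zero]; rfl
  | i + 1, hi => by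
    have := hh.mod_two i (by omega)
    have := hh.step i (by omega)
    push_cast
    omega

theorem IsPath.eq_stdHeight (hh : IsPath r N h) (h1 : ∀ i, h i ≤ 1) : h = stdHeight N := by
  ext i
  rw [stdHeight]
  by_cases hi : i < N
  · have := hh.mod_two i hi.le
    have := hh.nonneg i
    have := h1 i
    split_ifs <;> omega
  · rw [hh.eq_zero i (by omega), if_neg (by omega)]

theorem exists_stdMatching_arc (hN : Even N) (z : Fin N) : ∃ x y : Fin N, (x : ℕ) + 1 = y ∧
    (x : ℕ) % 2 = 0 ∧ (stdMatching N hN).partner x = y ∧ (stdMatching N hN).partner y = x ∧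
      (z = x ∨ z = y) := by
  suffices ∃ x y : Fin N, (x : ℕ) + 1 = y ∧ (x : ℕ) % 2 = 0 ∧ (z = x ∨ z = y) by
    obtain ⟨x, y, hxy, hx, hz⟩ := this
    have hpartner := stdMatching_partner hN hxy hx
    exact ⟨x, y, hxy, hx, hpartner, (PlanarMatching.partner_eq_comm _).1 hpartner, hz⟩
  have := Nat.even_iff.1 hN
  rcases Nat.mod_two_eq_zero_or_one z with hz | hz
  · exact ⟨z, ⟨z + 1, by omega⟩, rfl, hz, Or.inl rfl⟩
  · exact ⟨⟨z - 1, by omega⟩, z, by simp only; omega, by simp only; omega, Or.inr rfl⟩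

theorem fits_stdHeight (hN : Even N) : Fits (stdMatching N hN) (stdHeight N) := by
  have := Nat.even_iff.1 hN
  intro z
  obtain ⟨x, y, hxy, hx, hxp, hyp, rfl | rfl⟩ := exists_stdMatching_arc hN z <;>
  · simp only [hxp, hyp, stdHeight]
    split_ifs <;> omega

theorem Fits.eq_stdHeight {hN : Even N} (hfit : Fits (stdMatching N hN) h) (hh : IsPath r N h) :
    h = stdHeight N := by
  have heven : ∀ i, 2 * i ≤ N → h (2 * i) = 0 := by
    intro i
    induction i with
    | zero => exact fun _ => hh.zero
    | succ i ih =>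
      intro hi
      have hpartner := stdMatching_partner hN (x := ⟨2 * i, by omega⟩) (y := ⟨2 * i + 1, by omega⟩)
        rfl (by simp)
      rw [← ih (by omega)]
      exact (hfit.eq_add_two rfl hpartner).symm
  refine hh.eq_stdHeight fun i => ?_
  by_cases hi : i < N
  · have h0 := heven (i / 2) (by omega)
    have hs := hh.step (2 * (i / 2)) (by omega)
    obtain e | e : i = 2 * (i / 2) ∨ i = 2 * (i / 2) + 1 := by omega
    · rw [e, h0]
      exact zero_le_one
    · rw [e]
      omega
  · rw [hh.eq_zero i (by omega)]
    exact zero_le_one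

theorem prod_openWeight_stdMatching (hr : 2 ≤ r) (hN : Even N) :
    ∏ x, openWeight r (stdMatching N hN) (stdHeight N) x = sqdim r 1 ^ (N / 2) := by
  have sqdim_zero : sqdim r 0 = 1 := by
    rw [sqdim, qdim, zero_add, quantumInt, Int.cast_one, one_mul, div_self (sin_pi_div_pos hr).ne',
      Real.sqrt_one]
  have factor : ∀ x : Fin N, openWeight r (stdMatching N hN) (stdHeight N) x =
      if (x : ℕ) % 2 = 0 then sqdim r 1 else 1 := by
    intro z
    obtain ⟨x, y, hxy, hx, hxp, hyp, rfl | rfl⟩ := exists_stdMatching_arc hN z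
    · rw [openWeight, hxp, if_pos (Fin.lt_def.2 (by omega)), if_pos hx, stdHeight, stdHeight,
        if_pos (by omega), if_neg (by omega), sqdim_zero, div_one]
    · rw [openWeight, hyp, if_neg (by rw [Fin.lt_def]; omega), if_neg (by omega)]
  rw [Finset.prod_congr rfl fun x _ => factor x,
    Fin.prod_univ_eq_prod_range (fun i => if i % 2 = 0 then sqdim r 1 else 1) N]
  obtain ⟨M, rfl⟩ := hN.two_dvd
  rw [Nat.mul_div_cancel_left M two_pos]
  clear factor
  induction M with
  | zero => rfl
  | succ M ih =>
    rw [show 2 * (M + 1) = 2 * M + 1 + 1 by ring, Finset.prod_range_succ, Finset.prod_range_succ,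
      ih (even_two_mul M), if_pos (by omega), if_neg (by omega), mul_one, pow_succ]

theorem toPaths_stdMatching (hr : 3 ≤ r) (hN : Even N) :
    toPaths r N (Pi.single (stdMatching N hN) 1) =
      Pi.single (stdPath hr hN) ((sqdim r 1 ^ (N / 2) : ℝ) : ℂ) := by
  ext h
  rw [toPaths_single]
  by_cases hh : h = stdPath hr hN
  · rw [hh, Pi.single_eq_same, matchingVec, stdPath, if_pos (fits_stdHeight hN),
      prod_openWeight_stdMatching (by omega) hN]
  · rw [Pi.single_eq_of_ne hh, matchingVec,
      if_neg fun hfit => hh (Subtype.ext (hfit.eq_stdHeight h.2)), Complex.ofReal_zero]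

theorem loops_stdMatching (hN : Even N) :
    loops (stdMatching N hN) (stdMatching N hN) = N / 2 := by
  have := Nat.even_iff.1 hN
  rw [loops_eq_card_quot, ← Nat.card_fin (N / 2)]
  refine Nat.card_congr
    { toFun := Quot.lift (fun z => (⟨z / 2, by omega⟩ : Fin (N / 2))) fun z w hzw => ?_
      invFun := fun i => Quot.mk _ ⟨2 * i, by omega⟩
      left_inv := ?_
      right_inv := fun i => Fin.ext (Nat.mul_div_cancel_left _ two_pos) }
  · obtain rfl : (stdMatching N hN).partner z = w := (or_self _).mp hzw
    obtain ⟨x, y, hxy, hx, hxp, hyp, rfl | rfl⟩ := exists_stdMatching_arc hN z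
    · rw [Fin.ext_iff, hxp]
      simp only
      omega
    · rw [Fin.ext_iff, hyp]
      simp only
      omega
  · rintro ⟨z⟩
    obtain ⟨x, y, hxy, hx, hxp, hyp, rfl | rfl⟩ := exists_stdMatching_arc hN z
    · exact congrArg (Quot.mk _) (Fin.ext (by simp only; omega))
    · refine (congrArg (Quot.mk _) (Fin.ext ?_)).trans (Quot.sound (Or.inl hxp))
      simp only
      omega

end StandardPath

section Isometry

variable {r N : ℕ}

theorem PlanarMatching.induction_of_glueArc {P : PlanarMatching N → Prop}
    (hP : ∀ (f : PlanarMatching N) (x y : Fin N) (h : (x : ℕ) + 1 = y), (x : ℕ) % 2 = 0 →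
      P (glueArc f x y h) → P f) (hN : Even N)
    (h0 : P (stdMatching N hN)) (f : PlanarMatching N) : P f := by
  obtain ⟨M, hM⟩ := hN.two_dvd
  suffices ∀ d k, k + d = M → ∀ f : PlanarMatching N, f.StdBelow k → P f from
    this M 0 (by omega) f fun x y _ _ h => by omega
  intro d
  induction d with
  | zero => exact fun k hk f hf => by rwa [eq_stdMatching hN (by omega) hf]
  | succ d ih =>
    intro k hk f hf
    have hxy : ((⟨2 * k, by omega⟩ : Fin N) : ℕ) + 1 = (⟨2 * k + 1, by omega⟩ : Fin N) := rfl
    refine hP f _ _ hxy (Nat.mul_mod_right 2 k) (ih (k + 1) (by omega) _ ?_)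
    exact (hf.glueArc (by omega) hxy le_rfl).succ hxy rfl (glueArc_partner_left ..)

theorem eq_zero_of_cupCap_adjoint (hr : 3 ≤ r) (hN : Even N)
    {D : Skein N →ₗ[ℂ] Skein N →ₗ⋆[ℂ] ℂ}
    (hD : ∀ j, j + 1 < N → ∀ u v, D (cupCap r N j u) v = D u (cupCap r N j v))
    (h0 : D (Pi.single (stdMatching N hN) 1) (Pi.single (stdMatching N hN) 1) = 0) : D = 0 := by
  have hstd : D.flip (Pi.single (stdMatching N hN) 1) = 0 := by
    refine skein_hom_ext (PlanarMatching.induction_of_glueArc (fun f x y hxy hx ih => ?_) hN h0)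
    rw [LinearMap.flip_apply, LinearMap.zero_apply, single_glueArc hr f hxy, hD x (by omega),
      cupCap_stdMatching r hN hxy hx, map_smulₛₗ, map_smul, conj_loopValue, LinearMap.smul_apply,
      smul_eq_mul, smul_eq_mul] at ih
    simpa [loopValue_ne_zero hr, arcWeight_ne_zero hr] using ih
  have hflip : ∀ g, D.flip (Pi.single g 1) = 0 := by
    refine PlanarMatching.induction (fun g x y hxy _ ih => ?_) hN hstd
    refine LinearMap.ext fun u => ?_
    rw [LinearMap.flip_apply, single_glueArc hr g hxy, ← hD x (by omega), map_smulₛₗ,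
      ← LinearMap.flip_apply, ih, LinearMap.zero_apply, smul_zero, LinearMap.zero_apply]
  refine LinearMap.ext fun u => LinearMap.ext fun v => ?_
  refine LinearMap.congr_fun ((Pi.basisFun ℂ _).ext (f₁ := D u) (f₂ := 0) fun g => ?_) v
  rw [Pi.basisFun_apply]
  exact LinearMap.congr_fun (hflip g) u

theorem pathOp_dotProduct (r N j : ℕ) (u v : Path r N → ℂ) :
    pathOp r N j u ⬝ᵥ star v = u ⬝ᵥ star (pathOp r N j v) := by
  have hermitian : (Matrix.of fun h k : Path r N => (pathEntry r j h.1 k.1 : ℂ)).IsHermitian :=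
    Matrix.IsHermitian.ext fun h k => by
      rw [Matrix.of_apply, Matrix.of_apply, pathEntry_symm]
      exact Complex.conj_ofReal _
  rw [pathOp, Matrix.mulVecLin_apply, Matrix.mulVecLin_apply, Matrix.star_mulVec, hermitian.eq,
    dotProduct_comm u, ← Matrix.dotProduct_mulVec, dotProduct_comm]

/-- The defect of isometry of `toPaths`. -/
noncomputable def isometryDefect (r N : ℕ) : Skein N →ₗ[ℂ] Skein N →ₗ⋆[ℂ] ℂ :=
  LinearMap.mk₂'ₛₗ _ _ (fun u v => bracketForm r u v - toPaths r N u ⬝ᵥ star (toPaths r N v))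
    (fun u u' v => by rw [bracketForm_add_left, map_add, add_dotProduct]; ring)
    (fun c u v => by
      rw [bracketForm_smul_left, map_smul, smul_dotProduct, smul_eq_mul, ← mul_sub]; rfl)
    (fun u v v' => by rw [bracketForm_add_right, map_add, star_add, dotProduct_add]; ring)
    (fun c u v => by
      rw [bracketForm_smul_right, map_smul, star_smul, dotProduct_smul]
      exact (mul_sub _ _ _).symm)

theorem isometryDefect_eq_zero (hr : 3 ≤ r) (hN : Even N) : isometryDefect r N = 0 := by
  refine eq_zero_of_cupCap_adjoint hr hN (fun j hj u v => ?_) (sub_eq_zero.2 ?_)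
  · change bracketForm r _ _ - _ = bracketForm r _ _ - _
    rw [bracketForm_cupCap, toPaths_cupCap (by omega) hj, toPaths_cupCap (by omega) hj,
      pathOp_dotProduct]
  · have hδ : sqdim r 1 * sqdim r 1 = quantumInt r 2 :=
      Real.mul_self_sqrt (quantumInt_pos two_pos (by omega)).le
    rw [bracketForm_single, loops_stdMatching, toPaths_stdMatching hr, ← Pi.single_star,
      single_dotProduct, Pi.single_eq_same, loopValue_eq_quantumInt (by omega), ← hδ,
      ← Complex.ofReal_pow, mul_pow, Complex.ofReal_mul]
    exact congrArg _ (Complex.conj_ofReal _).symm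

theorem bracketForm_eq_dotProduct (hr : 3 ≤ r) (hN : Even N) (u v : Skein N) :
    bracketForm r u v = toPaths r N u ⬝ᵥ star (toPaths r N v) :=
  sub_eq_zero.1 (LinearMap.congr_fun₂ (isometryDefect_eq_zero hr hN) u v)

end Isometry

/-! ### Peaks and areas of paths -/

section Peaks

variable {r N j : ℕ} {h k : ℕ → ℤ}

/-- The area under a path. Truncating at `0` loses nothing, as heights of paths are nonnegative. -/
def area (N : ℕ) (h : ℕ → ℤ) : ℕ := ∑ i ∈ Finset.range N, (h i).toNat

/-- The path `h` of length `N` has a peak right after time `j`. -/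
structure IsPeak (N j : ℕ) (h : ℕ → ℤ) : Prop where
  lt : j + 1 < N
  eq : h j = h (j + 2)
  up : h (j + 1) = h j + 1

theorem AgreeOff.ext (hk : AgreeOff j h k) (e : h (j + 1) = k (j + 1)) : h = k := by
  ext i
  by_cases hi : i = j + 1
  · rw [hi, e]
  · exact hk i hi

theorem IsPeak.eq_or_down (hp : IsPeak N j h) (hk : AgreeOff j h k) (hh : IsPath r N k) :
    k = h ∨ k (j + 1) = h j - 1 := by
  have := hp.lt
  rw [hk j (by omega)]
  exact (hh.step j (by omega)).imp_left fun e => hk.symm.ext (by rw [e, hp.up, hk j (by omega)])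

theorem IsPeak.area_lt (hp : IsPeak N j h) (hk : AgreeOff j h k) (hh : IsPath r N k)
    (hne : k ≠ h) : area N k < area N h := by
  have hdown := (hp.eq_or_down hk hh).resolve_left hne
  have hup := hp.up
  refine Finset.sum_lt_sum (fun i _ => ?_) ⟨j + 1, Finset.mem_range.2 hp.lt, ?_⟩
  · by_cases hi : i = j + 1
    · rw [hi]
      omega
    · rw [hk i hi]
  · have := hh.nonneg (j + 1)
    omega

theorem IsPath.le_of_add (hh : IsPath r N h) : ∀ m n, n + m = N → h n ≤ m
  | 0, n, e => by rw [hh.eq_zero n (by omega), Nat.cast_zero]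
  | m + 1, n, e => by
    have := hh.le_of_add m (n + 1) (by omega)
    have := hh.step n (by omega)
    push_cast
    omega

theorem IsPath.descent {n m : ℕ} (hh : IsPath r (n + m) h) (hend : h n = m) :
    ∀ l ≤ m, h (n + l) = m - l
  | 0, _ => by simpa using hend
  | l + 1, hl => by
    have := hh.descent hend l (by omega)
    have := hh.step (n + l) (by omega)
    have := hh.le_of_add (m - (l + 1)) (n + l + 1) (by omega)
    rw [← add_assoc]
    push_cast
    omega

theorem IsPath.exists_isPeak_ge (hh : IsPath r N h) :
    ∀ m n, n + m = N → h n ≠ m → ∃ j, n ≤ j ∧ IsPeak N j h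
  | 0, n, e, hne => absurd (hh.eq_zero n (by omega)) hne
  | m + 1, n, e, hne => by
    by_cases h1 : h (n + 1) = m
    · have hup : h (n + 1) = h n + 1 := by
        have := hh.step n (by omega)
        push_cast at hne
        omega
      have hm : m ≠ 0 := by
        rintro rfl
        have := hh.nonneg n
        omega
      have := hh.le_of_add (m - 1) (n + 1 + 1) (by omega)
      have := hh.step (n + 1) (by omega)
      have hb : h n = h (n + 1 + 1) := by omega
      exact ⟨n, le_rfl, by omega, hb, hup⟩
    · obtain ⟨j, hj, hp⟩ := hh.exists_isPeak_ge m (n + 1) (by omega) h1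
      exact ⟨j, by omega, hp⟩

theorem IsPath.exists_isPeak (hh : IsPath r N h) (hne : h ≠ stdHeight N) :
    ∃ j, IsPeak N j h ∧ 1 ≤ h j := by
  obtain ⟨i₀, hi₀⟩ : ∃ i, 2 ≤ h i := by
    by_contra! hle
    exact hne (hh.eq_stdHeight fun i => by have := hle i; omega)
  obtain ⟨i, hi, hmax⟩ := Finset.exists_max_image (Finset.range (N + 1)) h ⟨0, by simp⟩
  simp only [Finset.mem_range] at hi hmax
  have hi₀N : i₀ < N + 1 := by
    by_contra hlt
    rw [hh.eq_zero i₀ (by omega)] at hi₀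
    omega
  have h2 : 2 ≤ h i := hi₀.trans (hmax i₀ hi₀N)
  have hi0 : i ≠ 0 := by
    rintro rfl
    rw [hh.zero] at h2
    omega
  have hiN : i ≠ N := by
    rintro rfl
    rw [hh.eq_zero i le_rfl] at h2
    omega
  obtain ⟨j, rfl⟩ : ∃ j, i = j + 1 := ⟨i - 1, by omega⟩
  have := hh.step j (by omega)
  have := hh.step (j + 1) (by omega)
  have := hmax j (by omega)
  have := hmax (j + 1 + 1) (by omega)
  have hb : h j = h (j + 1 + 1) := by omega
  exact ⟨j, ⟨by omega, hb, by omega⟩, by omega⟩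

theorem pathEntry_of_not_agreeOff (r : ℕ) (hk : ¬ AgreeOff j h k) : pathEntry r j h k = 0 :=
  if_neg fun H => hk H.2

theorem IsPath.pathEntry_pos (hh : IsPath r N h) (hk : IsPath r N k) (hb : h j = h (j + 2))
    (hag : AgreeOff j h k) : 0 < pathEntry r j h k := by
  rw [pathEntry, if_pos ⟨hb, hag⟩]
  exact div_pos (mul_pos (hh.sqdim_pos _) (hk.sqdim_pos _)) (hh.qdim_pos _)

end Peaks

section Surjective

variable {r N j : ℕ}

theorem pathOp_single (r N j : ℕ) (k l : Path r N) :
    pathOp r N j (Pi.single k 1) l = (pathEntry r j l.1 k.1 : ℂ) := by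
  rw [pathOp, Matrix.mulVecLin_apply, Matrix.mulVec_single_one, Matrix.col_apply, Matrix.of_apply]

theorem IsPeak.exists_pathOp_single {h : Path r N} (hp : IsPeak N j h.1) (h1 : 1 ≤ h.1 j) :
    ∃ k : Path r N, area N k.1 < area N h.1 ∧ ∃ c d : ℂ, c ≠ 0 ∧
      pathOp r N j (Pi.single k 1) = c • Pi.single h 1 + d • Pi.single k 1 := by
  have hpath := h.2.update hp.lt hp.eq (c := h.1 j - 1) (Or.inr rfl) (by omega)
    (by have := h.2.le j; omega)
  have hup := hp.up
  let k : Path r N := ⟨_, hpath⟩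
  have hk : AgreeOff j h.1 k.1 := agreeOff_update j h.1 _
  have hkj : k.1 (j + 1) = h.1 j - 1 := Function.update_self ..
  have hkh : k ≠ h := fun e => by
    rw [e] at hkj
    omega
  refine ⟨k, hp.area_lt hk k.2 fun e => hkh (Subtype.ext e), pathEntry r j h.1 k.1,
    pathEntry r j k.1 k.1, mod_cast (h.2.pathEntry_pos k.2 hp.eq hk).ne', ?_⟩
  ext l
  rw [pathOp_single, Pi.add_apply, Pi.smul_apply, Pi.smul_apply, smul_eq_mul, smul_eq_mul]
  by_cases hlk : AgreeOff j l.1 k.1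
  · rcases hp.eq_or_down (fun i hi => (hk i hi).trans (hlk i hi).symm) l.2 with e | e
    · obtain rfl : l = h := Subtype.ext e
      rw [Pi.single_eq_same, Pi.single_eq_of_ne hkh.symm, mul_one, mul_zero, add_zero]
    · obtain rfl : l = k := Subtype.ext (hlk.ext (e.trans hkj.symm))
      rw [Pi.single_eq_same, Pi.single_eq_of_ne hkh, mul_one, mul_zero, zero_add]
  · have hlh : l ≠ h := fun e => hlk (e ▸ hk)
    have hlk' : l ≠ k := fun e => hlk (e ▸ fun _ _ => rfl)
    rw [pathEntry_of_not_agreeOff r hlk, Pi.single_eq_of_ne hlh, Pi.single_eq_of_ne hlk', mul_zero,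
      mul_zero, add_zero, Complex.ofReal_zero]

theorem eq_top_of_pathOp_mem (hr : 3 ≤ r) (hN : Even N) {W : Submodule ℂ (Path r N → ℂ)}
    (hW : ∀ j, j + 1 < N → ∀ v ∈ W, pathOp r N j v ∈ W)
    (hstd : Pi.single (stdPath hr hN) 1 ∈ W) : W = ⊤ := by
  suffices ∀ A, ∀ h : Path r N, area N h.1 = A → Pi.single h (1 : ℂ) ∈ W by
    rw [eq_top_iff, ← (Pi.basisFun ℂ (Path r N)).span_eq, Submodule.span_le]
    rintro _ ⟨h, rfl⟩
    rw [Pi.basisFun_apply]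
    exact this _ h rfl
  intro A
  induction A using Nat.strong_induction_on with
  | _ A ih =>
    intro h hA
    by_cases hne : h.1 = stdHeight N
    · rwa [show h = stdPath hr hN from Subtype.ext hne]
    · obtain ⟨j, hp, h1⟩ := h.2.exists_isPeak hne
      obtain ⟨k, hlt, c, d, hc, e⟩ := hp.exists_pathOp_single h1
      have hk := ih _ (hA ▸ hlt) k rfl
      refine (W.smul_mem_iff hc).1 ((W.add_mem_iff_left (W.smul_mem d hk)).1 ?_)
      rw [← e]
      exact hW j hp.lt _ hk

theorem toPaths_surjective (hr : 3 ≤ r) (hN : Even N) : Function.Surjective (toPaths r N) := by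
  refine LinearMap.range_eq_top.1 (eq_top_of_pathOp_mem hr hN ?_ ?_)
  · rintro j hj _ ⟨v, rfl⟩
    exact ⟨cupCap r N j v, toPaths_cupCap (by omega) hj v⟩
  · have hc : ((sqdim r 1 ^ (N / 2) : ℝ) : ℂ) ≠ 0 :=
      mod_cast pow_ne_zero _ (Real.sqrt_pos.2 (quantumInt_pos two_pos (by omega))).ne'
    refine ((LinearMap.range (toPaths r N)).smul_mem_iff hc).1
      ⟨Pi.single (stdMatching N hN) 1, ?_⟩
    rw [toPaths_stdMatching hr, ← Pi.single_smul, smul_eq_mul, mul_one]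

end Surjective

section Descending

variable {r n m : ℕ} {v : Path r (n + m) → ℂ}

theorem eq_zero_of_pathOp_eq_zero
    (hv : ∀ j, n ≤ j → j + 1 < n + m → pathOp r (n + m) j v = 0) (h : Path r (n + m))
    (hne : h.1 n ≠ m) : v h = 0 := by
  induction hA : area (n + m) h.1 using Nat.strong_induction_on generalizing h with
  | _ A ih =>
    obtain ⟨j, hnj, hp⟩ := h.2.exists_isPeak_ge m n rfl hne
    have entry_mul : ∀ k ≠ h, (pathEntry r j h.1 k.1 : ℂ) * v k = 0 := by
      intro k hkh
      by_cases hk : AgreeOff j h.1 k.1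
      · rw [ih _ (hA ▸ hp.area_lt hk k.2 fun e => hkh (Subtype.ext e)) k
          (hk n (by omega) ▸ hne) rfl, mul_zero]
      · rw [pathEntry_of_not_agreeOff r hk, Complex.ofReal_zero, zero_mul]
    have hsum := congrFun (hv j hnj hp.lt) h
    rw [pathOp_apply, Fintype.sum_eq_single h entry_mul] at hsum
    exact (mul_eq_zero.1 hsum).resolve_left
      (mod_cast (h.2.pathEntry_pos h.2 hp.eq fun _ _ => rfl).ne')

theorem pathOp_eq_zero (hv : ∀ h : Path r (n + m), h.1 n ≠ m → v h = 0) {j : ℕ} (hnj : n ≤ j)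
    (hj : j + 1 < n + m) : pathOp r (n + m) j v = 0 := by
  ext h
  rw [pathOp_apply, Pi.zero_apply]
  refine Finset.sum_eq_zero fun k _ => ?_
  by_cases hk : k.1 n = m
  · rw [pathEntry, if_neg, Complex.ofReal_zero, zero_mul]
    rintro ⟨hb, hagree⟩
    rw [hagree j (by omega), hagree (j + 2) (by omega)] at hb
    obtain ⟨l, rfl⟩ := Nat.exists_eq_add_of_le hnj
    have := k.2.descent hk l (by omega)
    have := k.2.descent hk (l + 2) (by omega)
    rw [← add_assoc] at this
    omega
  · rw [hv k hk, mul_zero]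

end Descending

/-! ### Tableaux as paths -/

section RowCount

variable {n : ℕ} (ρ : Fin n → ℕ)

/-- The number of entries before the `k`-th which are in row `i`, when the `a`-th entry is in row
`ρ a`. -/
def rowCount (i k : ℕ) : ℕ := (Finset.univ.filter fun a : Fin n => (a : ℕ) < k ∧ ρ a = i).card

theorem rowCount_zero (i : ℕ) : rowCount ρ i 0 = 0 := by simp [rowCount]

theorem rowCount_mono (i : ℕ) {k l : ℕ} (h : k ≤ l) : rowCount ρ i k ≤ rowCount ρ i l :=
  Finset.card_le_card <| Finset.monotone_filter_right _ fun _ _ ha => ⟨ha.1.trans_le h, ha.2⟩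

theorem rowCount_succ (a : Fin n) (i : ℕ) :
    rowCount ρ i (a + 1) = rowCount ρ i a + if ρ a = i then 1 else 0 := by
  have before : ∀ b : Fin n, (b : ℕ) < a + 1 ↔ b = a ∨ (b : ℕ) < a := fun b => by
    rw [Fin.ext_iff]
    omega
  simp only [rowCount, before, or_and_right, Finset.filter_or]
  rw [Finset.card_union_of_disjoint, ← Finset.filter_filter, Finset.filter_eq',
    if_pos (Finset.mem_univ a), Finset.filter_singleton, add_comm]
  · split_ifs <;> rfl
  · exact Finset.disjoint_filter.2 fun b _ hb hb' => by simp [hb.1] at hb'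

theorem rowCount_lt (a : Fin n) {k : ℕ} (h : (a : ℕ) < k) :
    rowCount ρ (ρ a) a < rowCount ρ (ρ a) k := by
  have hsucc := rowCount_succ ρ a (ρ a)
  rw [if_pos rfl] at hsucc
  have := rowCount_mono ρ (ρ a) (show (a : ℕ) + 1 ≤ k from h)
  omega

variable {ρ}

theorem rowCount_add (hρ : ∀ a, ρ a = 0 ∨ ρ a = 1) {k : ℕ} (hk : k ≤ n) :
    rowCount ρ 0 k + rowCount ρ 1 k = k := by
  induction k with
  | zero => simp only [rowCount_zero]
  | succ k ih =>
    have h0 := rowCount_succ ρ ⟨k, hk⟩ 0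
    have h1 := rowCount_succ ρ ⟨k, hk⟩ 1
    have := ih (by omega)
    rcases hρ ⟨k, hk⟩ with h | h <;> simp only [h, if_true, zero_ne_one, one_ne_zero,
      if_false] at h0 h1 <;> omega

theorem exists_rowCount_eq {i c k : ℕ} (hk : k ≤ n) (hc : c < rowCount ρ i k) :
    ∃ a : Fin n, (a : ℕ) < k ∧ ρ a = i ∧ rowCount ρ i a = c := by
  induction k with
  | zero => simp [rowCount_zero] at hc
  | succ k ih =>
    by_cases hck : c < rowCount ρ i k
    · obtain ⟨a, ha, hai⟩ := ih (by omega) hck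
      exact ⟨a, by omega, hai⟩
    · have hsucc := rowCount_succ ρ ⟨k, hk⟩ i
      split_ifs at hsucc with hi
      · exact ⟨⟨k, hk⟩, by simp, hi, by simp only at hsucc ⊢; omega⟩
      · simp only at hsucc
        omega

theorem rowCount_swap {ρ' : Fin n → ℕ} {a b : Fin n} (hab : (a : ℕ) + 1 = b)
    (h : ∀ c, ρ' c = ρ (Equiv.swap a b c)) (i : ℕ) {k : ℕ} (hk : k ≠ b) :
    rowCount ρ' i k = rowCount ρ i k := by
  refine Finset.card_equiv (Equiv.swap a b) fun c => ?_
  simp only [Finset.mem_filter, Finset.mem_univ, true_and, h]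
  refine and_congr ?_ Iff.rfl
  rw [Equiv.swap_apply_def]
  split_ifs with h1 h2
  · rw [h1]; omega
  · rw [h2]; omega
  · rfl

variable (ρ) in
/-- The cell of the `a`-th entry when the `a`-th entry is put at the end of row `ρ a`. -/
def rowCell (a : Fin n) : ℕ × ℕ := (ρ a, rowCount ρ (ρ a) a)

theorem rowCell_injective : Function.Injective (rowCell ρ) := by
  intro a b hab
  obtain ⟨hrow, hcount⟩ := Prod.mk.inj hab
  rcases lt_trichotomy a b with hlt | rfl | hlt
  · have := rowCount_lt ρ a hlt
    rw [hcount, hrow] at this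
    exact absurd this (lt_irrefl _)
  · rfl
  · have := rowCount_lt ρ b hlt
    rw [← hcount, hrow] at this
    exact absurd this (lt_irrefl _)

end RowCount

section Ballot

variable {r n : ℕ} {ρ : Fin n → ℕ}

theorem mem_twoRowDiagram {A B : ℕ} (h : B ≤ A) {c : ℕ × ℕ} :
    c ∈ (twoRowDiagram A B h).cells ↔ c.1 = 0 ∧ c.2 < A ∨ c.1 = 1 ∧ c.2 < B := by
  rw [YoungDiagram.mem_cells, twoRowDiagram, YoungDiagram.mem_ofRowLens]
  obtain ⟨i, j⟩ := c
  rcases i with _ | _ | i <;> simp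

theorem rowLen_twoRowDiagram {A B : ℕ} (h : B ≤ A) :
    (twoRowDiagram A B h).rowLen 0 = A ∧ (twoRowDiagram A B h).rowLen 1 = B := by
  have lt_iff : ∀ i j, j < (twoRowDiagram A B h).rowLen i ↔ i = 0 ∧ j < A ∨ i = 1 ∧ j < B := by
    intro i j
    rw [← YoungDiagram.mem_iff_lt_rowLen, ← YoungDiagram.mem_cells, mem_twoRowDiagram]
  exact ⟨eq_of_forall_lt_iff fun j => by simp [lt_iff], eq_of_forall_lt_iff fun j => by
    simp [lt_iff]⟩

theorem colLen_twoRowDiagram_le {A B : ℕ} (h : B ≤ A) : (twoRowDiagram A B h).colLen 0 ≤ 2 := by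
  refine le_of_not_gt fun hcol => ?_
  rw [← YoungDiagram.mem_iff_lt_colLen, ← YoungDiagram.mem_cells, mem_twoRowDiagram] at hcol
  simp at hcol

/-- Ballot sequences: `ρ` is a sequence of votes for the candidates `0` and `1` in which `1` never
leads. -/
structure IsBallot (ρ : Fin n → ℕ) : Prop where
  eq_zero_or_one : ∀ a, ρ a = 0 ∨ ρ a = 1
  le : ∀ k ≤ n, rowCount ρ 1 k ≤ rowCount ρ 0 k

theorem IsBallot.cells_eq_image (hρ : IsBallot ρ) {k : ℕ} (hk : k ≤ n) :
    (twoRowDiagram (rowCount ρ 0 k) (rowCount ρ 1 k) (hρ.le k hk)).cells =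
      (Finset.univ.filter fun a : Fin n => (a : ℕ) < k).image (rowCell ρ) := by
  ext ⟨i, c⟩
  simp only [mem_twoRowDiagram, Finset.mem_image, Finset.mem_filter, Finset.mem_univ, true_and]
  constructor
  · intro hc
    have hlt : c < rowCount ρ i k := by
      rcases hc with ⟨rfl, h⟩ | ⟨rfl, h⟩ <;> exact h
    obtain ⟨a, ha, rfl, rfl⟩ := exists_rowCount_eq hk hlt
    exact ⟨a, ha, rfl⟩
  · rintro ⟨a, ha, e⟩
    obtain ⟨rfl, rfl⟩ := Prod.mk.inj e
    have := rowCount_lt ρ a ha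
    rcases hρ.eq_zero_or_one a with e0 | e0 <;> rw [e0] at this ⊢
    · exact Or.inl ⟨rfl, this⟩
    · exact Or.inr ⟨rfl, this⟩

theorem IsBallot.bijOn_rowCell (hρ : IsBallot ρ) :
    Set.BijOn (rowCell ρ) Set.univ
      (twoRowDiagram (rowCount ρ 0 n) (rowCount ρ 1 n) (hρ.le n le_rfl)).cells := by
  rw [hρ.cells_eq_image le_rfl]
  simpa using rowCell_injective.injOn.bijOn_image (s := Set.univ)

/-- The standard tableau whose `a`-th entry is at the end of row `ρ a`. -/
noncomputable def IsBallot.tableau (hρ : IsBallot ρ) :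
    StdTableau (twoRowDiagram (rowCount ρ 0 n) (rowCount ρ 1 n) (hρ.le n le_rfl)) n where
  cell := (Equiv.Set.univ (Fin n)).symm.trans hρ.bijOn_rowCell.equiv
  row_lt a b hrow hcol := by
    change ρ a = ρ b at hrow
    change rowCount ρ (ρ a) a < rowCount ρ (ρ b) b at hcol
    rw [hrow] at hcol
    by_contra hab
    have := rowCount_mono ρ (ρ b) (show (b : ℕ) ≤ a from not_lt.1 hab)
    omega
  col_lt a b hcol hrow := by
    change rowCount ρ (ρ a) a = rowCount ρ (ρ b) b at hcol
    change ρ a < ρ b at hrow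
    have ha : ρ a = 0 := (hρ.eq_zero_or_one a).resolve_right fun ha => by
      have := hρ.eq_zero_or_one b
      omega
    have hb : ρ b = 1 := (hρ.eq_zero_or_one b).resolve_left (by omega)
    by_contra hab
    have mono := rowCount_mono ρ 0 (show (b : ℕ) ≤ a from not_lt.1 hab)
    have succ_zero := rowCount_succ ρ b 0
    have succ_one := rowCount_succ ρ b 1
    have := hρ.le (b + 1) b.isLt
    simp only [ha, hb, if_true, one_ne_zero, if_false] at hcol succ_zero succ_one
    omega

/-- The row of an entry of a tableau. -/
def StdTableau.row {μ : YoungDiagram} (t : StdTableau μ n) (a : Fin n) : ℕ := (t.cell a).1.1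

theorem IsBallot.exists_tab (hρ : IsBallot ρ)
    (hr : ∀ k ≤ n, (rowCount ρ 0 k : ℤ) - rowCount ρ 1 k + 2 ≤ r) :
    ∃ t : Tab r (twoRowDiagram (rowCount ρ 0 n) (rowCount ρ 1 n) (hρ.le n le_rfl)) n,
      t.1.row = ρ := by
  refine ⟨⟨hρ.tableau, fun k hk => ⟨_, hρ.cells_eq_image hk, colLen_twoRowDiagram_le _, ?_⟩⟩, rfl⟩
  rw [(rowLen_twoRowDiagram _).1, (rowLen_twoRowDiagram _).2]
  have := hr k hk
  omega

end Ballot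

section Tab

variable {r n : ℕ} {μ : YoungDiagram}

theorem StdTableau.rowLen_eq (t : StdTableau μ n) {k : ℕ} {ν : YoungDiagram}
    (hν : ν.cells = t.remaining k) (i : ℕ) : ν.rowLen i = rowCount t.row i k := by
  have hinj : Function.Injective fun a : Fin n => (t.cell a).1 :=
    Subtype.val_injective.comp t.cell.injective
  rw [YoungDiagram.rowLen_eq_card, YoungDiagram.row, hν, StdTableau.remaining, Finset.filter_image,
    Finset.card_image_of_injective _ hinj, Finset.filter_filter]
  rfl

theorem Tab.cell_eq (t : Tab r μ n) (a : Fin n) : (t.1.cell a).1 = rowCell t.1.row a := by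
  refine Prod.ext rfl ?_
  change (t.1.cell a).1.2 = rowCount t.1.row (t.1.row a) a
  obtain ⟨ν, hν, -⟩ := t.2 a a.isLt.le
  obtain ⟨ν', hν', -⟩ := t.2 (a + 1) a.isLt
  have hcell : (t.1.cell a).1 = (t.1.row a, (t.1.cell a).1.2) := rfl
  have mem : (t.1.cell a).1 ∈ ν'.cells := by
    rw [hν', StdTableau.remaining, Finset.mem_image]
    exact ⟨a, by simp, rfl⟩
  have notMem : (t.1.cell a).1 ∉ ν.cells := by
    rw [hν, StdTableau.remaining, Finset.mem_image]
    rintro ⟨b, hb, e⟩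
    have : b = a := t.1.cell.injective (Subtype.ext e)
    simp [this] at hb
  rw [YoungDiagram.mem_cells, hcell, YoungDiagram.mem_iff_lt_rowLen, t.1.rowLen_eq hν',
    rowCount_succ, if_pos rfl] at mem
  rw [YoungDiagram.mem_cells, hcell, YoungDiagram.mem_iff_lt_rowLen, t.1.rowLen_eq hν] at notMem
  omega

theorem Tab.ext_row {s t : Tab r μ n} (h : s.1.row = t.1.row) : s = t :=
  Subtype.ext <| StdTableau.ext <| Equiv.ext fun a => Subtype.ext <| by
    rw [s.cell_eq, t.cell_eq, h]

theorem Tab.rowCount_bounds (t : Tab r μ n) {k : ℕ} (hk : k ≤ n) :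
    rowCount t.1.row 1 k ≤ rowCount t.1.row 0 k ∧
      (rowCount t.1.row 0 k : ℤ) - rowCount t.1.row 1 k + 2 ≤ r := by
  obtain ⟨ν, hν, -, hbound⟩ := t.2 k hk
  have anti := ν.rowLen_anti 0 1 (by omega)
  rw [t.1.rowLen_eq hν, t.1.rowLen_eq hν] at hbound anti
  exact ⟨anti, by omega⟩

end Tab

section TabPath

variable {r n m A B : ℕ} {hBA : B ≤ A}

theorem StdTableau.row_eq (t : StdTableau (twoRowDiagram A B hBA) n) (a : Fin n) :
    t.row a = 0 ∨ t.row a = 1 := by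
  have := (mem_twoRowDiagram hBA).1 (t.cell a).2
  rw [StdTableau.row]
  omega

theorem StdTableau.rowCount_total (t : StdTableau (twoRowDiagram A B hBA) n) :
    rowCount t.row 0 n = A ∧ rowCount t.row 1 n = B := by
  have hν : (twoRowDiagram A B hBA).cells = t.remaining n := by
    ext c
    rw [StdTableau.remaining, Finset.mem_image]
    constructor
    · intro hc
      exact ⟨t.cell.symm ⟨c, hc⟩, by simp, by simp⟩
    · rintro ⟨a, -, rfl⟩
      exact (t.cell a).2
  rw [← t.rowLen_eq hν, ← t.rowLen_eq hν]
  exact rowLen_twoRowDiagram hBA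

/-- The difference of the row lengths of the truncations of a tableau, followed by a descent
from `m` to `0`. -/
def tabHeight (m : ℕ) {μ : YoungDiagram} (t : StdTableau μ n) (k : ℕ) : ℤ :=
  if k < n then (rowCount t.row 0 k : ℤ) - rowCount t.row 1 k else ((n + m - k : ℕ) : ℤ)

theorem tabHeight_of_le (hm : A = B + m) (t : StdTableau (twoRowDiagram A B hBA) n) {k : ℕ}
    (hk : k ≤ n) : tabHeight m t k = (rowCount t.row 0 k : ℤ) - rowCount t.row 1 k := by
  rw [tabHeight]
  split_ifs with h
  · rfl
  · obtain rfl : k = n := by omega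
    rw [t.rowCount_total.1, t.rowCount_total.2]
    omega

theorem tabHeight_of_ge (m : ℕ) {μ : YoungDiagram} (t : StdTableau μ n) {k : ℕ} (hk : n ≤ k) :
    tabHeight m t k = ((n + m - k : ℕ) : ℤ) :=
  if_neg hk.not_gt

theorem tabHeight_succ (hm : A = B + m) (t : StdTableau (twoRowDiagram A B hBA) n) (a : Fin n) :
    tabHeight m t (a + 1) = tabHeight m t a + 1 - 2 * t.row a := by
  rw [tabHeight_of_le hm t a.isLt, tabHeight_of_le hm t a.isLt.le, rowCount_succ, rowCount_succ]
  rcases t.row_eq a with h | h <;>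
    simp only [h, if_true, one_ne_zero, zero_ne_one, if_false] <;> push_cast <;> ring

theorem isPath_tabHeight (hm : A = B + m) (hmr : m + 2 ≤ r)
    (t : Tab r (twoRowDiagram A B hBA) n) : IsPath r (n + m) (tabHeight m t.1) where
  zero := by rw [tabHeight_of_le hm _ (Nat.zero_le _), rowCount_zero, rowCount_zero]; rfl
  step i hi := by
    by_cases hin : i < n
    · have hsucc := tabHeight_succ hm t.1 ⟨i, hin⟩
      rcases t.1.row_eq ⟨i, hin⟩ with h | h <;> simp only [h] at hsucc <;> omega
    · rw [tabHeight_of_ge m _ (by omega), tabHeight_of_ge m _ (by omega)]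
      omega
  nonneg i := by
    by_cases hin : i ≤ n
    · rw [tabHeight_of_le hm _ hin]
      have := (t.rowCount_bounds hin).1
      omega
    · rw [tabHeight_of_ge m _ (by omega)]
      omega
  le i := by
    by_cases hin : i ≤ n
    · rw [tabHeight_of_le hm _ hin]
      exact (t.rowCount_bounds hin).2
    · rw [tabHeight_of_ge m _ (by omega)]
      omega
  eq_zero i hi := by
    rw [tabHeight_of_ge m _ (by omega)]
    omega

/-- The path of a tableau. -/
def tabPath (hm : A = B + m) (hmr : m + 2 ≤ r) (t : Tab r (twoRowDiagram A B hBA) n) :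
    Path r (n + m) :=
  ⟨tabHeight m t.1, isPath_tabHeight hm hmr t⟩

theorem tabPath_end (hm : A = B + m) (hmr : m + 2 ≤ r) (t : Tab r (twoRowDiagram A B hBA) n) :
    (tabPath hm hmr t).1 n = m :=
  (tabHeight_of_ge m t.1 le_rfl).trans (by rw [Nat.add_sub_cancel_left])

theorem tabPath_injective (hm : A = B + m) (hmr : m + 2 ≤ r) :
    Function.Injective (tabPath (n := n) (hBA := hBA) hm hmr) := by
  intro s t h
  have h : tabHeight m s.1 = tabHeight m t.1 := congrArg Subtype.val h
  refine Tab.ext_row (funext fun a => ?_)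
  have hs := tabHeight_succ hm s.1 a
  rw [h, tabHeight_succ hm t.1 a] at hs
  omega

/-- The row sequence of a path: ascents are in row `0` and descents in row `1`. -/
def pathRow (n : ℕ) (h : ℕ → ℤ) (a : Fin n) : ℕ := if h (a + 1) = h a + 1 then 0 else 1

theorem pathRow_eq (h : ℕ → ℤ) (a : Fin n) : pathRow n h a = 0 ∨ pathRow n h a = 1 := by
  rw [pathRow]
  split_ifs <;> simp

theorem IsPath.rowCount_sub {N : ℕ} {h : ℕ → ℤ} (hh : IsPath r N h) (hn : n ≤ N) {k : ℕ}
    (hk : k ≤ n) : (rowCount (pathRow n h) 0 k : ℤ) - rowCount (pathRow n h) 1 k = h k := by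
  induction k with
  | zero => rw [rowCount_zero, rowCount_zero, hh.zero]; rfl
  | succ k ih =>
    have ih := ih (by omega)
    have hs := hh.step k (by omega)
    have h0 := rowCount_succ (pathRow n h) ⟨k, hk⟩ 0
    have h1 := rowCount_succ (pathRow n h) ⟨k, hk⟩ 1
    by_cases hup : h (k + 1) = h k + 1 <;> simp only [pathRow, hup, if_true, if_false, one_ne_zero,
      zero_ne_one] at h0 h1 ih ⊢ <;> omega

theorem IsPath.isBallot_pathRow {N : ℕ} {h : ℕ → ℤ} (hh : IsPath r N h) (hn : n ≤ N) :
    IsBallot (pathRow n h) where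
  eq_zero_or_one := pathRow_eq h
  le k hk := by
    have := hh.rowCount_sub hn hk
    have := hh.nonneg k
    omega

theorem exists_tabPath_eq (hm : A = B + m) (hn : n = A + B) (hmr : m + 2 ≤ r)
    (h : Path r (n + m)) (hend : h.1 n = m) :
    ∃ t : Tab r (twoRowDiagram A B hBA) n, tabPath hm hmr t = h := by
  have hsub {k : ℕ} (hk : k ≤ n) := h.2.rowCount_sub (n := n) (by omega) hk
  have hballot : IsBallot (pathRow n h.1) := h.2.isBallot_pathRow (by omega)
  have htotal := hsub le_rfl
  have := rowCount_add (pathRow_eq (n := n) h.1) le_rfl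
  rw [hend] at htotal
  obtain rfl : rowCount (pathRow n h.1) 0 n = A := by omega
  obtain rfl : rowCount (pathRow n h.1) 1 n = B := by omega
  obtain ⟨t, ht⟩ := hballot.exists_tab (r := r) fun k hk => by
    rw [hsub hk]
    exact h.2.le k
  refine ⟨t, Subtype.ext (funext fun k => ?_)⟩
  change tabHeight m t.1 k = h.1 k
  by_cases hk : k ≤ n
  · rw [tabHeight_of_le hm t.1 hk, ht, hsub hk]
  rw [tabHeight_of_ge m t.1 (by omega)]
  by_cases hkm : k ≤ n + m
  · have := h.2.descent hend (k - n) (by omega)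
    rw [show n + (k - n) = k by omega] at this
    omega
  · rw [h.2.eq_zero k (by omega)]
    omega

end TabPath

/-! ### Matrix entries of the Jones sectors -/

theorem quantumInt_two_mul_qdim {r : ℕ} (hr : 2 ≤ r) (k : ℤ) :
    quantumInt r 2 * qdim r k = qdim r (k + 1) + qdim r (k - 1) := by
  rw [qdim, quantumInt_two_mul hr, qdim, qdim]
  congr 2
  ring

theorem qdim_nonneg {r : ℕ} {k : ℤ} (h0 : 0 ≤ k + 1) (hk : k + 1 ≤ r) : 0 ≤ qdim r k := by
  rcases h0.eq_or_lt with h0 | h0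
  · rw [qdim, ← h0, quantumInt_zero]
  rcases hk.eq_or_lt with hk | hk
  · rw [qdim, hk, quantumInt_self (by omega)]
  · exact (quantumInt_pos h0 hk).le

section Entries

variable {r n m A B : ℕ} {hBA : B ≤ A} {a b : Fin n}

theorem Tab.axial_of_row_eq (t : Tab r (twoRowDiagram A B hBA) n) (hab : (a : ℕ) + 1 = b)
    (h : t.1.row a = t.1.row b) : t.axial a b = -1 := by
  rw [Tab.axial, t.cell_eq, t.cell_eq]
  simp only [rowCell, ← h, ← hab, rowCount_succ, if_true]
  push_cast
  ring

theorem Tab.axial_of_row_ne (hm : A = B + m) (t : Tab r (twoRowDiagram A B hBA) n)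
    (hab : (a : ℕ) + 1 = b) (h : t.1.row a ≠ t.1.row b) :
    t.axial a b = (1 - 2 * t.1.row a) * (tabHeight m t.1 a + 1) := by
  rw [Tab.axial, t.cell_eq, t.cell_eq, tabHeight_of_le hm t.1 a.isLt.le]
  simp only [rowCell, ← hab, rowCount_succ, if_neg h]
  rcases t.1.row_eq a with ha | ha <;> rcases t.1.row_eq b with hb | hb
  · omega
  · rw [ha, hb]
    push_cast
    ring
  · rw [ha, hb]
    push_cast
    ring
  · omega

theorem Tab.alpha_of_row_eq (t : Tab r (twoRowDiagram A B hBA) n) (hab : (a : ℕ) + 1 = b)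
    (h : t.1.row a = t.1.row b) : t.alpha a b = 0 := by
  rw [Tab.alpha, t.axial_of_row_eq hab h, neg_add_cancel, quantumInt_zero, zero_div]

theorem Tab.alpha_of_row_ne (hm : A = B + m) (t : Tab r (twoRowDiagram A B hBA) n)
    (hab : (a : ℕ) + 1 = b) (h : t.1.row a ≠ t.1.row b) :
    t.alpha a b = qdim r (tabHeight m t.1 (a + 1)) /
      (quantumInt r 2 * qdim r (tabHeight m t.1 a)) := by
  rw [Tab.alpha, t.axial_of_row_ne hm hab h, tabHeight_succ hm]
  rcases t.1.row_eq a with ha | ha <;> rw [ha, qdim, qdim]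
  · simp only [Nat.cast_zero, mul_zero, sub_zero, one_mul]
  · rw [← neg_div_neg_eq, ← quantumInt_neg, ← mul_neg, ← quantumInt_neg]
    congr 2 <;> push_cast <;> ring_nf

theorem Tab.quantumInt_two_mul_beta (hm : A = B + m) (hmr : m + 2 ≤ r)
    (t : Tab r (twoRowDiagram A B hBA) n) (q2 : 0 < quantumInt r 2)
    (hab : (a : ℕ) + 1 = b) (h : t.1.row a ≠ t.1.row b) :
    quantumInt r 2 * t.beta a b = sqdim r (tabHeight m t.1 a + 1) *
      sqdim r (tabHeight m t.1 a - 1) / qdim r (tabHeight m t.1 a) := by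
  have path := isPath_tabHeight hm hmr t
  have nonneg := path.nonneg a
  have le := path.le a
  have qa := path.qdim_pos a
  have hrec := quantumInt_two_mul_qdim (r := r) (by omega) (tabHeight m t.1 a)
  have key : t.alpha a b * (1 - t.alpha a b) =
      qdim r (tabHeight m t.1 a + 1) * qdim r (tabHeight m t.1 a - 1) /
        (quantumInt r 2 * qdim r (tabHeight m t.1 a)) ^ 2 := by
    rw [t.alpha_of_row_ne hm hab h, tabHeight_succ hm]
    rcases t.1.row_eq a with ha | ha <;> rw [ha]
    · simp only [Nat.cast_zero, mul_zero, sub_zero]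
      field_simp
      rw [hrec]
      ring
    · rw [show tabHeight m t.1 a + 1 - 2 * (1 : ℕ) = tabHeight m t.1 a - 1 by push_cast; ring]
      field_simp
      rw [hrec]
      ring
  rw [Tab.beta, key, Real.sqrt_div' _ (by positivity), Real.sqrt_sq (by positivity),
    Real.sqrt_mul (qdim_nonneg (by omega) (by omega))]
  simp only [sqdim]
  field_simp

theorem tabHeight_eq_iff (hm : A = B + m) (t : StdTableau (twoRowDiagram A B hBA) n)
    (hab : (a : ℕ) + 1 = b) :
    tabHeight m t a = tabHeight m t (a + 2) ↔ t.row a ≠ t.row b := by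
  have ha := tabHeight_succ hm t a
  have hb : tabHeight m t (a + 2) = tabHeight m t (a + 1) + 1 - 2 * t.row b := by
    rw [hab, ← tabHeight_succ hm t b, ← hab]
  have := t.row_eq a
  have := t.row_eq b
  omega

theorem agreeOff_tabHeight (m : ℕ) {s t : StdTableau (twoRowDiagram A B hBA) n}
    (hab : (a : ℕ) + 1 = b) (h : ∀ c, s.row c = t.row (Equiv.swap a b c)) :
    AgreeOff a (tabHeight m s) (tabHeight m t) := by
  intro k hk
  rw [tabHeight, tabHeight, rowCount_swap hab h 0 (by omega), rowCount_swap hab h 1 (by omega)]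

theorem Tab.row_ne_of_row_swap {s t : Tab r (twoRowDiagram A B hBA) n} (hst : s ≠ t)
    (h : ∀ c, s.1.row c = t.1.row (Equiv.swap a b c)) : t.1.row a ≠ t.1.row b := by
  refine fun hrow => hst (Tab.ext_row (funext fun c => ?_))
  rw [h, Equiv.swap_apply_def]
  split_ifs with h1 h2
  · rw [h1, hrow]
  · rw [h2, hrow]
  · rfl

theorem Tab.cell_swap_of_row_swap {s t : Tab r (twoRowDiagram A B hBA) n}
    (hab : (a : ℕ) + 1 = b) (h : ∀ c, s.1.row c = t.1.row (Equiv.swap a b c))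
    (hrow : t.1.row a ≠ t.1.row b) (c : Fin n) :
    s.1.cell c = t.1.cell (Equiv.swap a b c) := by
  refine Subtype.ext ?_
  rw [s.cell_eq, t.cell_eq, rowCell, rowCell, h]
  congr 1
  by_cases hca : c = a
  · rw [hca, Equiv.swap_apply_left, rowCount_swap hab h _ (by omega), ← hab, rowCount_succ,
      if_neg hrow, add_zero]
  by_cases hcb : c = b
  · have hsa : s.1.row a ≠ t.1.row a := by
      rw [h, Equiv.swap_apply_left]
      exact hrow.symm
    rw [hcb, Equiv.swap_apply_right, ← hab, rowCount_succ, if_neg hsa, add_zero,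
      rowCount_swap hab h _ (by omega)]
  · rw [Equiv.swap_apply_of_ne_of_ne hca hcb, rowCount_swap hab h _ (fun e => hcb (Fin.ext e))]

theorem Tab.row_swap_of_agreeOff (hm : A = B + m) {s t : Tab r (twoRowDiagram A B hBA) n}
    (hab : (a : ℕ) + 1 = b) (hst : s ≠ t) (hs : tabHeight m s.1 a = tabHeight m s.1 (a + 2))
    (hagree : AgreeOff a (tabHeight m s.1) (tabHeight m t.1)) (c : Fin n) :
    s.1.row c = t.1.row (Equiv.swap a b c) := by
  have ht : tabHeight m t.1 a = tabHeight m t.1 (a + 2) := by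
    rw [← hagree a (by omega), ← hagree (a + 2) (by omega), hs]
  have hsab := (tabHeight_eq_iff hm s.1 hab).1 hs
  have htab := (tabHeight_eq_iff hm t.1 hab).1 ht
  have hsa := s.1.row_eq a
  have hsb := s.1.row_eq b
  have hta := t.1.row_eq a
  have htb := t.1.row_eq b
  have hother : ∀ d : Fin n, d ≠ a → d ≠ b → s.1.row d = t.1.row d := by
    intro d hda hdb
    have hsd := tabHeight_succ hm s.1 d
    rw [hagree d (fun e => hdb (Fin.ext (by omega))),
      hagree (d + 1) (fun e => hda (Fin.ext (by omega))), tabHeight_succ hm t.1 d] at hsd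
    omega
  have ha : s.1.row a ≠ t.1.row a := by
    refine fun e => hst (Tab.ext_row (funext fun d => ?_))
    by_cases hda : d = a
    · rw [hda, e]
    by_cases hdb : d = b
    · rw [hdb]
      omega
    · exact hother d hda hdb
  by_cases hca : c = a
  · rw [hca, Equiv.swap_apply_left]
    omega
  by_cases hcb : c = b
  · rw [hcb, Equiv.swap_apply_right]
    omega
  · rw [Equiv.swap_apply_of_ne_of_ne hca hcb, hother c hca hcb]

theorem Tab.cell_swap_iff (hm : A = B + m) {s t : Tab r (twoRowDiagram A B hBA) n}
    (hab : (a : ℕ) + 1 = b) (hst : s ≠ t) :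
    (∀ c, s.1.cell c = t.1.cell (Equiv.swap a b c)) ↔
      tabHeight m s.1 a = tabHeight m s.1 (a + 2) ∧
        AgreeOff a (tabHeight m s.1) (tabHeight m t.1) := by
  constructor
  · intro h
    have hrow : ∀ c, s.1.row c = t.1.row (Equiv.swap a b c) := fun c =>
      congrArg (fun x => x.1.1) (h c)
    refine ⟨(tabHeight_eq_iff hm s.1 hab).2 ?_, agreeOff_tabHeight m hab hrow⟩
    rw [hrow, hrow, Equiv.swap_apply_left, Equiv.swap_apply_right]
    exact (Tab.row_ne_of_row_swap hst hrow).symm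
  · rintro ⟨hs, hagree⟩
    have hrow := Tab.row_swap_of_agreeOff hm hab hst hs hagree
    exact Tab.cell_swap_of_row_swap hab hrow (Tab.row_ne_of_row_swap hst hrow)

theorem quantumInt_two_mul_alpha (hm : A = B + m) (hmr : m + 2 ≤ r) (q2 : quantumInt r 2 ≠ 0)
    (t : Tab r (twoRowDiagram A B hBA) n) (hab : (a : ℕ) + 1 = b) :
    quantumInt r 2 * t.alpha a b = pathEntry r a (tabHeight m t.1) (tabHeight m t.1) := by
  have heq := tabHeight_eq_iff hm t.1 hab
  by_cases hrow : t.1.row a = t.1.row b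
  · rw [t.alpha_of_row_eq hab hrow, mul_zero, pathEntry, if_neg fun h => heq.1 h.1 hrow]
  · rw [t.alpha_of_row_ne hm hab hrow, pathEntry, if_pos ⟨heq.2 hrow, fun _ _ => rfl⟩,
      (isPath_tabHeight hm hmr t).sqdim_mul_self]
    field_simp

theorem quantumInt_two_mul_beta_eq_pathEntry (hm : A = B + m) (hmr : m + 2 ≤ r)
    (q2 : 0 < quantumInt r 2) {s t : Tab r (twoRowDiagram A B hBA) n} (hab : (a : ℕ) + 1 = b)
    (hst : s ≠ t) (hs : tabHeight m s.1 a = tabHeight m s.1 (a + 2))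
    (hagree : AgreeOff a (tabHeight m s.1) (tabHeight m t.1)) :
    quantumInt r 2 * t.beta a b = pathEntry r a (tabHeight m s.1) (tabHeight m t.1) := by
  have hswap := Tab.row_swap_of_agreeOff hm hab hst hs hagree
  have hrow := Tab.row_ne_of_row_swap hst hswap
  have hsa : s.1.row a = t.1.row b := by rw [hswap, Equiv.swap_apply_left]
  rw [t.quantumInt_two_mul_beta hm hmr q2 hab hrow, pathEntry, if_pos ⟨hs, hagree⟩,
    tabHeight_succ hm, tabHeight_succ hm, hagree a (by omega), hsa]
  rcases t.1.row_eq a with ha | ha <;> rcases t.1.row_eq b with hb | hb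
  · omega
  · rw [ha, hb, mul_comm]
    congr 3 <;> push_cast <;> ring
  · rw [ha, hb]
    congr 3 <;> push_cast <;> ring
  · omega

theorem loopValue_mul_projMatrix (hr : 3 ≤ r) (hm : A = B + m) (hmr : m + 2 ≤ r)
    (s t : Tab r (twoRowDiagram A B hBA) n) (hab : (a : ℕ) + 1 = b) :
    loopValue r * projMatrix r (twoRowDiagram A B hBA) n a b s t =
      (pathEntry r a (tabHeight m s.1) (tabHeight m t.1) : ℂ) := by
  have q2 : 0 < quantumInt r 2 := quantumInt_pos (by omega) (by omega)
  rw [loopValue_eq_quantumInt (by omega), projMatrix, Matrix.of_apply]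
  by_cases hst : s = t
  · subst hst
    have hswap : ¬ ∀ c, s.1.cell c = s.1.cell (Equiv.swap a b c) := by
      intro h
      have hne : a ≠ b := fun e => by rw [e] at hab; omega
      exact hne (by simpa using s.1.cell.injective (h a))
    rw [if_pos rfl, if_neg hswap, add_zero, ← quantumInt_two_mul_alpha hm hmr q2.ne' s hab,
      Complex.ofReal_mul]
  · rw [if_neg hst, zero_add]
    split_ifs with hswap
    · obtain ⟨hs, hagree⟩ := (Tab.cell_swap_iff hm hab hst).1 hswap
      rw [← quantumInt_two_mul_beta_eq_pathEntry hm hmr q2 hab hst hs hagree, Complex.ofReal_mul]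
    · rw [pathEntry, if_neg fun h => hswap ((Tab.cell_swap_iff hm hab hst).2 h),
        Complex.ofReal_zero, mul_zero]

theorem pathOp_tabPath (hr : 3 ≤ r) (hm : A = B + m) (hn : n = A + B) (hmr : m + 2 ≤ r)
    (hab : (a : ℕ) + 1 = b) (v : Path r (n + m) → ℂ) (t : Tab r (twoRowDiagram A B hBA) n) :
    pathOp r (n + m) a v (tabPath hm hmr t) =
      loopValue r * Matrix.mulVec (projMatrix r (twoRowDiagram A B hBA) n a b)
        (fun s => v (tabPath hm hmr s)) t := by
  rw [pathOp_apply, Matrix.mulVec, dotProduct, Finset.mul_sum]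
  symm
  refine Fintype.sum_of_injective (tabPath hm hmr) (tabPath_injective hm hmr) _ _ ?_ fun s => ?_
  · intro k hk
    rw [pathEntry, if_neg, Complex.ofReal_zero, zero_mul]
    rintro ⟨-, hagree⟩
    exact hk (exists_tabPath_eq hm hn hmr k (by rw [← hagree n (by omega), tabPath_end]))
  · rw [← mul_assoc, loopValue_mul_projMatrix hr hm hmr t s hab]
    rfl

end Entries

/-! ### The state space in the path model -/

section StateIso

variable {r n m A B : ℕ} {hBA : B ≤ A}

theorem toPaths_labelledSkein (hmr : m + 2 ≤ r) {x : Skein (n + m)} (hx : x ∈ labelledSkein r n m)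
    (h : Path r (n + m)) (hne : h.1 n ≠ m) : toPaths r (n + m) x h = 0 := by
  obtain ⟨y, rfl⟩ := hx
  refine eq_zero_of_pathOp_eq_zero (fun j hnj hj => ?_) h hne
  obtain ⟨l, rfl⟩ := Nat.exists_eq_add_of_le hnj
  rw [← toPaths_cupCap (by omega) hj, cupCap_jonesWenzl (by omega) le_rfl (by omega), map_zero]

theorem toPaths_jonesWenzl (hr : 2 ≤ r) : ∀ k ≤ m, ∀ x : Skein (n + m),
    (∀ l, l + 1 < k → pathOp r (n + m) (n + l) (toPaths r (n + m) x) = 0) →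
      toPaths r (n + m) (jonesWenzl r (n + m) n k x) = toPaths r (n + m) x
  | 0, _, _, _ => rfl
  | 1, _, _, _ => rfl
  | k + 2, hk, x, hx => by
    have ih := toPaths_jonesWenzl hr (k + 1) (by omega)
    have fixed := ih x fun l hl => hx l (by omega)
    have killed : toPaths r (n + m)
        (cupCap r (n + m) (n + k) (jonesWenzl r (n + m) n (k + 1) x)) = 0 := by
      rw [toPaths_cupCap hr (by omega), fixed, hx k (by omega)]
    have killed' := ih _ fun l _ => by rw [killed, map_zero]
    rw [jonesWenzl, LinearMap.sub_apply, LinearMap.smul_apply, map_sub, map_smul,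
      LinearMap.comp_apply, LinearMap.comp_apply, killed', killed, smul_zero, sub_zero, fixed]

/-- The coordinates of a labelled skein at the paths given by the tableaux of a Jones sector. -/
noncomputable def skeinCoords (hm : A = B + m) (hmr : m + 2 ≤ r) :
    labelledSkein r n m →ₗ[ℂ] (Tab r (twoRowDiagram A B hBA) n → ℂ) :=
  LinearMap.funLeft ℂ ℂ (tabPath hm hmr) ∘ₗ toPaths r (n + m) ∘ₗ (labelledSkein r n m).subtype

theorem skeinCoords_apply (hm : A = B + m) (hmr : m + 2 ≤ r) (x : labelledSkein r n m)
    (t : Tab r (twoRowDiagram A B hBA) n) :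
    skeinCoords hm hmr x t = toPaths r (n + m) x (tabPath hm hmr t) := rfl

theorem bracketForm_eq_skeinCoords (hr : 3 ≤ r) (hm : A = B + m) (hn : n = A + B)
    (hmr : m + 2 ≤ r) (x y : labelledSkein r n m) :
    bracketForm r (x : Skein (n + m)) y =
      skeinCoords (hBA := hBA) hm hmr x ⬝ᵥ star (skeinCoords hm hmr y) := by
  rw [bracketForm_eq_dotProduct (by omega) ⟨A, by omega⟩]
  symm
  refine Fintype.sum_of_injective (tabPath hm hmr) (tabPath_injective hm hmr) _ _ ?_ fun t => rfl
  intro h hh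
  rw [toPaths_labelledSkein hmr x.2 h fun e => hh (exists_tabPath_eq hm hn hmr h e), zero_mul]

open scoped ComplexOrder in
theorem ker_skeinCoords (hr : 3 ≤ r) (hm : A = B + m) (hn : n = A + B) (hmr : m + 2 ≤ r) :
    LinearMap.ker (skeinCoords (n := n) (hBA := hBA) hm hmr) = radical r n m := by
  ext x
  constructor
  · intro hx y
    rw [bracketForm_eq_skeinCoords (hBA := hBA) hr hm hn hmr, LinearMap.mem_ker.1 hx,
      zero_dotProduct]
  · intro hx
    have hxx := hx x
    rw [bracketForm_eq_skeinCoords (hBA := hBA) hr hm hn hmr] at hxx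
    exact LinearMap.mem_ker.2 (dotProduct_self_star_eq_zero.1 hxx)

theorem skeinCoords_surjective (hr : 3 ≤ r) (hm : A = B + m) (hn : n = A + B)
    (hmr : m + 2 ≤ r) : Function.Surjective (skeinCoords (n := n) (hBA := hBA) hm hmr) := by
  intro w
  let v : Path r (n + m) → ℂ := Function.extend (tabPath hm hmr) w 0
  have hv (h : Path r (n + m)) (hne : h.1 n ≠ m) : v h = 0 := by
    refine Function.extend_apply' _ _ _ ?_
    rintro ⟨t, rfl⟩
    exact hne (tabPath_end hm hmr t)
  obtain ⟨x, hx⟩ := toPaths_surjective hr (show Even (n + m) from ⟨A, by omega⟩) v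
  have hx' : toPaths r (n + m) (jonesWenzl r (n + m) n m x) = v := by
    rw [toPaths_jonesWenzl (by omega) m le_rfl x, hx]
    intro l hl
    rw [hx, pathOp_eq_zero hv (by omega) (by omega)]
  refine ⟨⟨jonesWenzl r (n + m) n m x, x, rfl⟩, funext fun t => ?_⟩
  rw [skeinCoords_apply, hx']
  exact (tabPath_injective hm hmr).extend_apply _ _ _

/-- The state space in the orthonormal basis given by the tableaux of a Jones sector. -/
noncomputable def stateIso (hr : 3 ≤ r) (hm : A = B + m) (hn : n = A + B) (hmr : m + 2 ≤ r) :
    StateSpace r n m ≃ₗ[ℂ] (Tab r (twoRowDiagram A B hBA) n → ℂ) :=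
  (Submodule.quotEquivOfEq _ _ (ker_skeinCoords hr hm hn hmr).symm).trans
    ((skeinCoords hm hmr).quotKerEquivOfSurjective (skeinCoords_surjective hr hm hn hmr))

theorem stateIso_mk (hr : 3 ≤ r) (hm : A = B + m) (hn : n = A + B) (hmr : m + 2 ≤ r)
    (x : labelledSkein r n m) : stateIso (hBA := hBA) hr hm hn hmr (Submodule.Quotient.mk x) =
      skeinCoords hm hmr x := rfl

theorem stateForm_mk (x y : labelledSkein r n m) :
    stateForm r n m (Submodule.Quotient.mk x) (Submodule.Quotient.mk y) =
      bracketForm r (x : Skein (n + m)) y := rfl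

theorem isUnitaryIso_stateIso (hr : 3 ≤ r) (hm : A = B + m) (hn : n = A + B) (hmr : m + 2 ≤ r) :
    IsUnitaryIso r n m (stateIso (hBA := hBA) hr hm hn hmr) := by
  intro v w
  obtain ⟨x, rfl⟩ := Submodule.Quotient.mk_surjective _ v
  obtain ⟨y, rfl⟩ := Submodule.Quotient.mk_surjective _ w
  rw [stateForm_mk, stateIso_mk, stateIso_mk, bracketForm_eq_skeinCoords hr hm hn hmr]

end StateIso

/-! ### Operators induced on the state space -/

section Induced

variable {r n m : ℕ}

namespace IsInducedBy

variable {u u' : stateUnitary r n m} {T T' : Module.End ℂ (Skein (n + m))}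

theorem unique (hu : IsInducedBy r n m u T) (hu' : IsInducedBy r n m u' T) : u = u' := by
  refine Subtype.ext (LinearEquiv.ext fun v => ?_)
  obtain ⟨x, rfl⟩ := Submodule.Quotient.mk_surjective _ v
  obtain ⟨y, hy, e⟩ := hu x
  obtain ⟨y', hy', e'⟩ := hu' x
  rw [e, e', show y = y' from Subtype.ext (hy.trans hy'.symm)]

theorem one : IsInducedBy r n m 1 (1 : Module.End ℂ (Skein (n + m))) :=
  fun x => ⟨x, rfl, rfl⟩

theorem mul (hu : IsInducedBy r n m u T) (hu' : IsInducedBy r n m u' T') :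
    IsInducedBy r n m (u * u') (T * T') := by
  intro x
  obtain ⟨y, hy, e⟩ := hu' x
  obtain ⟨z, hz, e'⟩ := hu y
  refine ⟨z, by rw [hz, hy]; rfl, ?_⟩
  rw [Subgroup.coe_mul, LinearEquiv.mul_apply, e, e']

theorem pow (hu : IsInducedBy r n m u T) (k : ℕ) : IsInducedBy r n m (u ^ k) (T ^ k) := by
  induction k with
  | zero => exact one
  | succ k ih => exact ih.mul hu

variable {v : ℕ → stateUnitary r n m} {V : ℕ → Module.End ℂ (Skein (n + m))}

theorem ascending : ∀ k, (∀ i < k, IsInducedBy r n m (v i) (V i)) →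
    IsInducedBy r n m (ascending v k) (ascending V k)
  | 0, _ => one
  | k + 1, hv => by
    rw [ascending_succ, ascending_succ]
    exact (ascending k fun i hi => hv i (by omega)).mul (hv k (by omega))

theorem descending : ∀ k, (∀ i < k, IsInducedBy r n m (v i) (V i)) →
    IsInducedBy r n m (descending v k) (descending V k)
  | 0, _ => one
  | k + 1, hv => by
    rw [descending_succ, descending_succ]
    exact (hv k (by omega)).mul (descending k fun i hi => hv i (by omega))

theorem isBraided {k : ℕ} (hV : IsBraided V k) (hv : ∀ i < k, IsInducedBy r n m (v i) (V i)) :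
    IsBraided v k where
  commute i j hij hj := ((hv i (by omega)).mul (hv j hj)).unique
    ((hV.commute i j hij hj).eq ▸ (hv j hj).mul (hv i (by omega)))
  braid i hi :=
    have hi' := hv i (by omega)
    ((hi'.mul (hv _ hi)).mul hi').unique (hV.braid i hi ▸ ((hv _ hi).mul hi').mul (hv _ hi))

end IsInducedBy

theorem map_labelledSkein {T : Skein (n + m) ≃ₗ[ℂ] Skein (n + m)}
    (hT : Commute (T.toLinearMap : Module.End ℂ (Skein (n + m))) (jonesWenzl r (n + m) n m)) :
    (labelledSkein r n m).map T.toLinearMap = labelledSkein r n m := by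
  rw [labelledSkein, ← LinearMap.range_comp, ← Module.End.mul_eq_comp, hT.eq,
    Module.End.mul_eq_comp, LinearMap.range_comp_of_range_eq_top _ T.range]

theorem map_radical {T : labelledSkein r n m ≃ₗ[ℂ] labelledSkein r n m}
    (hT : ∀ x y, bracketForm r (T x : Skein (n + m)) (T y) = bracketForm r (x : Skein (n + m)) y) :
    (radical r n m).map T.toLinearMap = radical r n m := by
  ext x
  obtain ⟨x, rfl⟩ := T.surjective x
  rw [Submodule.mem_map_equiv, T.symm_apply_apply]
  change (∀ y, _) ↔ ∀ y : labelledSkein r n m, _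
  refine ⟨fun h y => ?_, fun h y => (hT x y).symm.trans (h (T y))⟩
  obtain ⟨y, rfl⟩ := T.surjective y
  exact (hT x y).trans (h y)

theorem exists_isInducedBy {T : Skein (n + m) ≃ₗ[ℂ] Skein (n + m)}
    (hT : Commute (T.toLinearMap : Module.End ℂ (Skein (n + m))) (jonesWenzl r (n + m) n m))
    (hform : ∀ x y, bracketForm r (T x) (T y) = bracketForm r x y) :
    ∃ u : stateUnitary r n m, IsInducedBy r n m u T.toLinearMap := by
  let T' := T.ofSubmodules _ _ (map_labelledSkein hT)
  let u := Submodule.Quotient.equiv _ _ T' (map_radical fun x y => hform x y)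
  refine ⟨⟨u, fun v w => ?_⟩, fun x => ⟨T' x, rfl, rfl⟩⟩
  obtain ⟨x, rfl⟩ := Submodule.Quotient.mk_surjective _ v
  obtain ⟨y, rfl⟩ := Submodule.Quotient.mk_surjective _ w
  exact hform x y

theorem exists_isInducedBy_crossing {a : ℂ} (ha : IsKauffmanParameter (loopValue r) a)
    {i : ℕ} (hi : i + 1 < n + m) (him : i + 1 < n ∨ m ≤ 1) :
    ∃ u : stateUnitary r n m, IsInducedBy r n m u (crossing r (n + m) a i) := by
  have hTL := isTemperleyLieb_cupCap r (n + m)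
  have hsq := hTL.mul_self i (by omega)
  let T : Skein (n + m) ≃ₗ[ℂ] Skein (n + m) := LinearEquiv.ofLinearMap
    (crossing r (n + m) a i) (crossing r (n + m) a⁻¹ i) (ha.crossing_mul_crossing_inv hsq) (by
      have := ha.inv.crossing_mul_crossing_inv hsq
      rwa [inv_inv] at this)
  refine exists_isInducedBy (T := T) ?_ (bracketForm_crossing ha hi)
  rw [jonesWenzl_eq_wenzlIdempotent]
  exact commute_wenzlIdempotent _ fun l hl =>
    (commute_kauffmanCrossing a (hTL.commute i (n + l) (by omega) (by omega)).symm).symm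

end Induced

/-! ### Representations of the braid group -/

theorem IsBraided.lift_eq_one {G : Type*} [Group G] {σ : ℕ → G} {k : ℕ} (h : IsBraided σ k) :
    ∀ w ∈ braidRels k, FreeGroup.lift (fun i : Fin k => σ i) w = 1 := by
  rintro w (⟨i, j, hij, rfl⟩ | ⟨i, j, hij, rfl⟩)
  · simp only [map_mul, map_inv, FreeGroup.lift_apply_of]
    rw [h.commute i j hij j.2, mul_inv_cancel_right, mul_inv_cancel]
  · simp only [map_mul, map_inv, FreeGroup.lift_apply_of]
    rw [← hij, h.braid i (hij ▸ j.2), mul_inv_cancel]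

/-- The character of the braid group sending all generators to `z`. -/
noncomputable def braidCharacter (n : ℕ) (z : Circle) : BraidGroup n →* Circle :=
  PresentedGroup.toGroup (f := fun _ => z)
    (IsBraided.lift_eq_one (σ := fun _ => z) ⟨fun _ _ _ _ => rfl, fun _ _ => rfl⟩)

theorem braidCharacter_of (n : ℕ) (z : Circle) (i : Fin (n - 1)) :
    braidCharacter n z (PresentedGroup.of i) = z :=
  PresentedGroup.toGroup.of _

theorem exists_coe_circle_eq {c : ℂ} (h : c * conj c = 1) : ∃ z : Circle, (z : ℂ) = c := by
  refine ⟨⟨c, mem_sphere_zero_iff_norm.2 ?_⟩, rfl⟩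
  rw [Complex.mul_conj'] at h
  exact (pow_eq_one_iff_of_nonneg (norm_nonneg c) two_ne_zero).1 (by exact_mod_cast h)

theorem coe_circle_mem_unitary (z : Circle) : (z : ℂ) ∈ unitary ℂ := by
  rw [Unitary.mem_iff_self_mul_star, Complex.star_def, ← Circle.coe_inv_eq_conj, ← Circle.coe_mul,
    mul_inv_cancel, Circle.coe_one]

section PhaseTwist

variable {G ι : Type*} [Group G] [Fintype ι] [DecidableEq ι]

/-- The unitary representation `ρ` multiplied by the character `χ`. -/
noncomputable def phaseTwist (χ : G →* Circle) (ρ : G →* Matrix.unitaryGroup ι ℂ) :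
    G →* Matrix.unitaryGroup ι ℂ where
  toFun g := ⟨(χ g : ℂ) • (ρ g : Matrix ι ι ℂ),
    Unitary.smul_mem_of_mem (coe_circle_mem_unitary (χ g)) (ρ g).2⟩
  map_one' := Subtype.ext (by simp)
  map_mul' g g' := Subtype.ext (by
    simp only [map_mul, Circle.coe_mul, Matrix.UnitaryGroup.mul_val, smul_mul_smul_comm])

theorem coe_phaseTwist (χ : G →* Circle) (ρ : G →* Matrix.unitaryGroup ι ℂ) (g : G) :
    (phaseTwist χ ρ g : Matrix ι ι ℂ) = (χ g : ℂ) • (ρ g : Matrix ι ι ℂ) := rfl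

end PhaseTwist

section UnitaryMatrix

variable {r n m : ℕ} {ι : Type} [Fintype ι] [DecidableEq ι]

theorem mem_unitaryGroup_of_dotProduct {M : Matrix ι ι ℂ}
    (h : ∀ v w, M.mulVec v ⬝ᵥ star (M.mulVec w) = v ⬝ᵥ star w) : M ∈ Matrix.unitaryGroup ι ℂ := by
  rw [Matrix.mem_unitaryGroup_iff']
  ext i j
  calc (star M * M) i j = M.col j ⬝ᵥ star (M.col i) := dotProduct_comm _ _
    _ = Pi.single j 1 ⬝ᵥ star (Pi.single i 1) := by
      rw [← Matrix.mulVec_single_one, ← Matrix.mulVec_single_one, h]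
    _ = (1 : Matrix ι ι ℂ) i j := by simp [Matrix.one_apply, Pi.single_apply]

/-- The matrix of a unitary operator on the state space with respect to a unitary isomorphism. -/
noncomputable def unitaryMatrix {S : StateSpace r n m ≃ₗ[ℂ] (ι → ℂ)} (hS : IsUnitaryIso r n m S) :
    stateUnitary r n m →* Matrix.unitaryGroup ι ℂ where
  toFun u := ⟨LinearMap.toMatrix' (S.conj u.1.toLinearMap), by
    refine mem_unitaryGroup_of_dotProduct fun v w => ?_
    rw [LinearMap.toMatrix'_mulVec, LinearMap.toMatrix'_mulVec, LinearEquiv.conj_apply_apply,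
      LinearEquiv.conj_apply_apply, ← hS]
    refine (u.2 _ _).trans ?_
    rw [hS, LinearEquiv.apply_symm_apply, LinearEquiv.apply_symm_apply]⟩
  map_one' := Subtype.ext (by
    change LinearMap.toMatrix' (S.conj LinearMap.id) = 1
    rw [LinearEquiv.conj_id, LinearMap.toMatrix'_id])
  map_mul' u u' := Subtype.ext (by
    rw [Matrix.UnitaryGroup.mul_val, ← LinearMap.toMatrix'_comp, ← LinearEquiv.conj_comp]
    rfl)

theorem unitaryMatrix_mulVec {S : StateSpace r n m ≃ₗ[ℂ] (ι → ℂ)} (hS : IsUnitaryIso r n m S)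
    (u : stateUnitary r n m) (v : StateSpace r n m) :
    (unitaryMatrix hS u).1.mulVec (S v) = S (u.1 v) := by
  change (LinearMap.toMatrix' _).mulVec _ = _
  rw [LinearMap.toMatrix'_mulVec, LinearEquiv.conj_apply_apply, LinearEquiv.symm_apply_apply]
  rfl

end UnitaryMatrix

namespace IsBraidAction

variable {r n m : ℕ} {a : ℂ}

theorem unique {ρ ρ' : BraidGroup n →* stateUnitary r n m}
    (h : IsBraidAction r n m a ρ) (h' : IsBraidAction r n m a ρ') : ρ = ρ' :=
  PresentedGroup.ext fun i => (h i).unique (h' i)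

theorem existsUnique (ha : IsKauffmanParameter (loopValue r) a) :
    ∃! ρ : BraidGroup n →* stateUnitary r n m, IsBraidAction r n m a ρ := by
  choose! u hu using fun i (hi : i < n - 1) =>
    exists_isInducedBy_crossing (n := n) (m := m) ha (i := i) (by omega) (Or.inl (by omega))
  have hbraid : IsBraided u (n - 1) := IsInducedBy.isBraided
    (((isTemperleyLieb_cupCap r (n + m)).isBraided_crossing ha).mono (by omega)) hu
  have hρ : IsBraidAction r n m a (PresentedGroup.toGroup hbraid.lift_eq_one) := fun i => by
    rw [PresentedGroup.toGroup.of]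
    exact hu i i.2
  exact ⟨_, hρ, fun _ h => h.unique hρ⟩

end IsBraidAction

/-! ### The equivalence with a Jones sector -/

theorem IsJonesSector.unique {r n : ℕ} {q : ℂ} {μ : YoungDiagram}
    {ρ ρ' : BraidGroup n →* Matrix.unitaryGroup (Tab r μ n) ℂ}
    (h : IsJonesSector r q μ n ρ) (h' : IsJonesSector r q μ n ρ') : ρ = ρ' :=
  PresentedGroup.ext fun i => Subtype.ext ((h i).trans (h' i).symm)

section Equivalence

variable {r n m A B : ℕ} {hBA : B ≤ A} {a : ℂ}

theorem stateIso_crossing (hr : 3 ≤ r) (hm : A = B + m) (hn : n = A + B) (hmr : m + 2 ≤ r)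
    {i j : Fin n} (hij : (i : ℕ) + 1 = j) {u : stateUnitary r n m}
    (hu : IsInducedBy r n m u (crossing r (n + m) a i)) (v : StateSpace r n m) :
    stateIso (hBA := hBA) hr hm hn hmr (u.1 v) =
      Matrix.mulVec (a • 1 + a⁻¹ • loopValue r • projMatrix r (twoRowDiagram A B hBA) n i j)
        (stateIso hr hm hn hmr v) := by
  obtain ⟨x, rfl⟩ := Submodule.Quotient.mk_surjective _ v
  obtain ⟨y, hy, e⟩ := hu x
  have hpaths : toPaths r (n + m) y = a • toPaths r (n + m) x +
      a⁻¹ • pathOp r (n + m) i (toPaths r (n + m) x) := by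
    rw [hy, ← toPaths_cupCap (by omega) (by omega), ← map_smul, ← map_smul, ← map_add]
    rfl
  ext t
  rw [e, stateIso_mk, stateIso_mk, skeinCoords_apply, hpaths, Pi.add_apply, Pi.smul_apply,
    Pi.smul_apply, pathOp_tabPath hr hm hn hmr hij]
  simp only [Matrix.add_mulVec, Matrix.smul_mulVec, Matrix.one_mulVec]
  rfl

theorem unitaryMatrix_stateIso (hr : 3 ≤ r) (hm : A = B + m) (hn : n = A + B) (hmr : m + 2 ≤ r)
    {i j : Fin n} (hij : (i : ℕ) + 1 = j) {u : stateUnitary r n m}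
    (hu : IsInducedBy r n m u (crossing r (n + m) a i)) :
    (unitaryMatrix (isUnitaryIso_stateIso (hBA := hBA) hr hm hn hmr) u).1 =
      a • 1 + a⁻¹ • loopValue r • projMatrix r (twoRowDiagram A B hBA) n i j := by
  refine Matrix.ext_of_mulVec_single fun t => ?_
  obtain ⟨v, hv⟩ := (stateIso (hBA := hBA) hr hm hn hmr).surjective (Pi.single t 1)
  rw [← hv, unitaryMatrix_mulVec, stateIso_crossing hr hm hn hmr hij hu]

namespace IsBraidAction

theorem isJonesSector_phaseTwist (hr : 3 ≤ r) (hm : A = B + m) (hn : n = A + B)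
    (hmr : m + 2 ≤ r) (ha : IsKauffmanParameter (loopValue r) a) {z : Circle} (hz : (z : ℂ) = a)
    {ρ : BraidGroup n →* stateUnitary r n m} (hρ : IsBraidAction r n m a ρ) :
    IsJonesSector r (a ^ 4) (twoRowDiagram A B hBA) n
      (phaseTwist (braidCharacter n (z ^ 3))
        ((unitaryMatrix (isUnitaryIso_stateIso (hBA := hBA) hr hm hn hmr)).comp ρ)) := by
  intro i
  have ha0 := ha.ne_zero
  have hcoef : a ^ 3 * (a⁻¹ * loopValue r) = -(1 + a ^ 4) := by
    rw [← ha.loop_eq]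
    field_simp
    ring
  rw [coe_phaseTwist, braidCharacter_of, Circle.coe_pow, hz, MonoidHom.comp_apply,
    unitaryMatrix_stateIso hr hm hn hmr (i := ⟨i, by omega⟩) (j := ⟨i + 1, by omega⟩) rfl (hρ i),
    smul_add, smul_smul, smul_smul, smul_smul, mul_assoc, hcoef, ← pow_succ, neg_smul,
    ← sub_eq_add_neg]

end IsBraidAction

theorem IsJonesSector.existsUnique (hr : 3 ≤ r) (hm : A = B + m) (hn : n = A + B)
    (hmr : m + 2 ≤ r) (ha : IsKauffmanParameter (loopValue r) a) :
    ∃! ρ : BraidGroup n →* Matrix.unitaryGroup (Tab r (twoRowDiagram A B hBA) n) ℂ,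
      IsJonesSector r (a ^ 4) (twoRowDiagram A B hBA) n ρ := by
  obtain ⟨ρ, hρ, -⟩ := IsBraidAction.existsUnique (n := n) (m := m) ha
  obtain ⟨z, hz⟩ := exists_coe_circle_eq
    (by rw [conj_eq_inv_of_isKauffmanParameter ha, mul_inv_cancel₀ ha.ne_zero] : a * conj a = 1)
  have hJ := hρ.isJonesSector_phaseTwist (hBA := hBA) hr hm hn hmr ha hz
  exact ⟨_, hJ, fun _ h => h.unique hJ⟩

theorem IsBraidAction.exists_unitaryIso (hr : 3 ≤ r) (hm : A = B + m) (hn : n = A + B)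
    (hmr : m + 2 ≤ r) (ha : IsKauffmanParameter (loopValue r) a)
    {ρr : BraidGroup n →* stateUnitary r n m} (hρr : IsBraidAction r n m a ρr)
    {ρJ : BraidGroup n →* Matrix.unitaryGroup (Tab r (twoRowDiagram A B hBA) n) ℂ}
    (hρJ : IsJonesSector r (a ^ 4) (twoRowDiagram A B hBA) n ρJ) :
    ∃ S : StateSpace r n m ≃ₗ[ℂ] (Tab r (twoRowDiagram A B hBA) n → ℂ), IsUnitaryIso r n m S ∧
      ∃ χ : BraidGroup n →* Circle, ∀ (b : BraidGroup n) (v : StateSpace r n m),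
        S ((ρr b).1 v) = (χ b : ℂ) • Matrix.mulVec (ρJ b).1 (S v) := by
  obtain ⟨z, hz⟩ := exists_coe_circle_eq
    (by rw [conj_eq_inv_of_isKauffmanParameter ha, mul_inv_cancel₀ ha.ne_zero] : a * conj a = 1)
  have hS := isUnitaryIso_stateIso (hBA := hBA) hr hm hn hmr
  refine ⟨_, hS, (braidCharacter n (z ^ 3))⁻¹, fun b v => ?_⟩
  rw [hρJ.unique (hρr.isJonesSector_phaseTwist hr hm hn hmr ha hz), coe_phaseTwist,
    Matrix.smul_mulVec, smul_smul, MonoidHom.inv_apply, ← Circle.coe_mul, inv_mul_cancel,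
    Circle.coe_one, one_smul]
  exact (unitaryMatrix_mulVec hS _ _).symm

end Equivalence

/-! ### The action of the mapping class group of the punctured sphere -/

theorem lift_coxeterWord {G : Type*} [Group G] (σ : ℕ → G) (k : ℕ) :
    FreeGroup.lift (fun i : Fin k => σ i) (coxeterWord k) = ascending σ k := by
  rw [coxeterWord, map_list_prod, List.map_ofFn, ascending]
  congr 2
  funext i
  exact FreeGroup.lift_apply_of

theorem lift_coxeterWordRev {G : Type*} [Group G] (σ : ℕ → G) (k : ℕ) :
    FreeGroup.lift (fun i : Fin k => σ i) (coxeterWordRev k) = descending σ k := by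
  rw [coxeterWordRev, map_list_prod, List.map_reverse, List.map_ofFn, descending]
  congr 3
  funext i
  exact FreeGroup.lift_apply_of

section Sphere

variable {r n : ℕ} {a : ℂ}

theorem mem_phases_of_isInducedBy (hr : 3 ≤ r) (hn : Odd n) {u : stateUnitary r n 1} {c : ℂ}
    (hu : IsInducedBy r n 1 u (c • (1 : Module.End ℂ (Skein (n + 1))))) :
    u ∈ phases r n 1 := by
  have hc (x : labelledSkein r n 1) :
      u.1 (Submodule.Quotient.mk x) = Submodule.Quotient.mk (c • x) := by
    obtain ⟨y, hy, e⟩ := hu x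
    rw [e, show y = c • x from Subtype.ext hy]
  let f := stdMatching (n + 1) hn.add_one
  let x : labelledSkein r n 1 := ⟨Pi.single f 1, Pi.single f 1, rfl⟩
  have hx : bracketForm r (x : Skein (n + 1)) x ≠ 0 := by
    rw [show (x : Skein (n + 1)) = Pi.single f 1 from rfl, bracketForm_single]
    exact pow_ne_zero _ (loopValue_ne_zero hr)
  have hform := u.2 (Submodule.Quotient.mk x) (Submodule.Quotient.mk x)
  rw [hc, stateForm_mk, stateForm_mk, Submodule.coe_smul, bracketForm_smul_left,
    bracketForm_smul_right, ← mul_assoc] at hform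
  obtain ⟨z, rfl⟩ := exists_coe_circle_eq (mul_right_cancel₀ hx (hform.trans (one_mul _).symm))
  refine ⟨z, fun v => ?_⟩
  obtain ⟨x, rfl⟩ := Submodule.Quotient.mk_surjective _ v
  exact hc x

namespace IsSphereAction

theorem unique {ρ ρ' : SphereMCG (n + 1) →* ProjStateUnitary r n 1}
    (h : IsSphereAction r n a ρ) (h' : IsSphereAction r n a ρ') : ρ = ρ' := by
  refine PresentedGroup.ext fun i => ?_
  obtain ⟨u, hu, e⟩ := h i
  obtain ⟨u', hu', e'⟩ := h' i
  rw [e, e', hu.unique hu']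

theorem lift_mem_phases (hr : 3 ≤ r) (hn : Odd n) (ha : IsKauffmanParameter (loopValue r) a)
    {u : ℕ → stateUnitary r n 1} (hu : ∀ i < n, IsInducedBy r n 1 (u i) (crossing r (n + 1) a i)) :
    ∀ w ∈ sphereRels n, FreeGroup.lift (fun i : Fin n => u i) w ∈ phases r n 1 := by
  rintro w (hw | rfl | rfl)
  · have hbraid : IsBraided u n :=
      IsInducedBy.isBraided ((isTemperleyLieb_cupCap r (n + 1)).isBraided_crossing ha) hu
    rw [hbraid.lift_eq_one w hw]
    exact one_mem _
  · obtain ⟨c, hc⟩ := exists_ascending_mul_descending_crossing hr ha hn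
    rw [map_mul, lift_coxeterWord, lift_coxeterWordRev]
    exact mem_phases_of_isInducedBy hr hn
      (hc ▸ (IsInducedBy.ascending n hu).mul (IsInducedBy.descending n hu))
  · obtain ⟨c, hc⟩ := exists_ascending_pow_crossing hr ha hn
    rw [map_pow, lift_coxeterWord]
    exact mem_phases_of_isInducedBy hr hn (hc ▸ (IsInducedBy.ascending n hu).pow (n + 1))

theorem existsUnique (hr : 3 ≤ r) (hn : Odd n) (ha : IsKauffmanParameter (loopValue r) a) :
    ∃! ρ : SphereMCG (n + 1) →* ProjStateUnitary r n 1, IsSphereAction r n a ρ := by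
  choose! u hu using fun i (hi : i < n) =>
    exists_isInducedBy_crossing (n := n) (m := 1) ha (i := i) (by omega) (Or.inr le_rfl)
  have hmk : FreeGroup.lift (fun i : Fin n => (QuotientGroup.mk (u i) : ProjStateUnitary r n 1)) =
      (QuotientGroup.mk' (phases r n 1)).comp (FreeGroup.lift fun i : Fin n => u i) := by
    ext i
    simp only [FreeGroup.lift_apply_of, MonoidHom.comp_apply, QuotientGroup.mk'_apply]
  have hrels : ∀ w ∈ sphereRels n,
      FreeGroup.lift (fun i : Fin n => (QuotientGroup.mk (u i) : ProjStateUnitary r n 1)) w = 1 :=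
    fun w hw => by
      rw [hmk, MonoidHom.comp_apply, QuotientGroup.mk'_apply, QuotientGroup.eq_one_iff]
      exact lift_mem_phases hr hn ha hu w hw
  have hρ : IsSphereAction r n a (PresentedGroup.toGroup (rels := sphereRels n) hrels) :=
    fun i => ⟨u i, hu i i.2, PresentedGroup.toGroup.of (rels := sphereRels n) hrels⟩
  exact ⟨_, hρ, fun _ h => h.unique hρ⟩

theorem apply_braidToSphere {ρ : SphereMCG (n + 1) →* ProjStateUnitary r n 1}
    (hρ : IsSphereAction r n a ρ) {ρ' : BraidGroup n →* stateUnitary r n 1}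
    (hρ' : IsBraidAction r n 1 a ρ') (b : BraidGroup n) :
    ρ (braidToSphere n b) = (QuotientGroup.mk (ρ' b) : ProjStateUnitary r n 1) := by
  have : ρ.comp (braidToSphere n) = (QuotientGroup.mk' (phases r n 1)).comp ρ' := by
    refine PresentedGroup.ext fun i => ?_
    obtain ⟨u, hu, e⟩ := hρ ⟨i, by omega⟩
    rw [MonoidHom.comp_apply, MonoidHom.comp_apply, braidToSphere, PresentedGroup.toGroup.of,
      inclGen, e, hu.unique (hρ' i)]
    rfl
  exact DFunLike.congr_fun this b

theorem exists_unitaryIso {A B : ℕ} {hBA : B ≤ A} (hr : 3 ≤ r) (hm : A = B + 1) (hn : n = A + B)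
    (ha : IsKauffmanParameter (loopValue r) a)
    {ρr : SphereMCG (n + 1) →* ProjStateUnitary r n 1} (hρr : IsSphereAction r n a ρr)
    {ρJ : BraidGroup n →* Matrix.unitaryGroup (Tab r (twoRowDiagram A B hBA) n) ℂ}
    (hρJ : IsJonesSector r (a ^ 4) (twoRowDiagram A B hBA) n ρJ) :
    ∃ S : StateSpace r n 1 ≃ₗ[ℂ] (Tab r (twoRowDiagram A B hBA) n → ℂ), IsUnitaryIso r n 1 S ∧
      ∀ (b : BraidGroup n) (u : stateUnitary r n 1),
        (QuotientGroup.mk u : ProjStateUnitary r n 1) = ρr (braidToSphere n b) →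
        ∃ z : Circle, ∀ v : StateSpace r n 1,
          S (u.1 v) = (z : ℂ) • Matrix.mulVec (ρJ b).1 (S v) := by
  obtain ⟨ρ, hρ, -⟩ := IsBraidAction.existsUnique (n := n) (m := 1) ha
  obtain ⟨S, hS, χ, hχ⟩ := hρ.exists_unitaryIso hr hm hn (by omega) ha hρJ
  refine ⟨S, hS, fun b u hu => ?_⟩
  rw [hρr.apply_braidToSphere hρ, eq_comm, QuotientGroup.eq] at hu
  obtain ⟨z, hz⟩ := hu
  have hzu (v : StateSpace r n 1) : u.1 v = (z : ℂ) • (ρ b).1 v := by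
    rw [← map_smul, ← hz, ← LinearEquiv.mul_apply, ← Subgroup.coe_mul, mul_inv_cancel_left]
  refine ⟨z * χ b, fun v => ?_⟩
  rw [hzu, map_smul, hχ, smul_smul, Circle.coe_mul]

end IsSphereAction

end Sphere

theorem inv_kauffmanA_pow_four (r : ℕ) :
    (kauffmanA r)⁻¹ ^ 4 = Complex.exp (2 * Real.pi * Complex.I / r) := by
  rw [inv_pow, show kauffmanA r ^ 4 = (kauffmanA r ^ 2) ^ 2 by ring, kauffmanA_sq, neg_sq,
    ← Complex.exp_nat_mul, ← Complex.exp_neg]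
  congr 1
  push_cast
  ring

end CSJones

open CSJones in
theorem theorem3p2_general (r : ℕ) (hr : 3 ≤ r) (a : ℂ)
    (hloop : -a ^ 2 - a⁻¹ ^ 2 = loopValue r) :
    (∀ n m : ℕ, m ≤ r - 2 → m ≤ n → Even (m + n) →
      let μ : YoungDiagram := twoRowDiagram ((m + n) / 2) ((n - m) / 2)
        (Nat.div_le_div_right ((Nat.sub_le n m).trans (Nat.le_add_left n m)))
      (∃! ρJ : BraidGroup n →* Matrix.unitaryGroup (Tab r μ n) ℂ, IsJonesSector r (a ^ 4) μ n ρJ) ∧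
      (∃! ρr : BraidGroup n →* stateUnitary r n m, IsBraidAction r n m a ρr) ∧
      ∀ (ρJ : BraidGroup n →* Matrix.unitaryGroup (Tab r μ n) ℂ)
        (ρr : BraidGroup n →* stateUnitary r n m),
        IsJonesSector r (a ^ 4) μ n ρJ → IsBraidAction r n m a ρr →
        ∃ S : StateSpace r n m ≃ₗ[ℂ] (Tab r μ n → ℂ), IsUnitaryIso r n m S ∧
          ∃ χ : BraidGroup n →* Circle, ∀ (b : BraidGroup n) (v : StateSpace r n m),
            S ((ρr b).1 v) = (χ b : ℂ) • Matrix.mulVec (ρJ b).1 (S v)) ∧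
    (∀ n : ℕ, Odd n →
      let μ : YoungDiagram := twoRowDiagram ((n + 1) / 2) ((n - 1) / 2)
        (Nat.div_le_div_right ((Nat.sub_le n 1).trans (Nat.le_add_right n 1)))
      (∃! ρJ : BraidGroup n →* Matrix.unitaryGroup (Tab r μ n) ℂ, IsJonesSector r (a ^ 4) μ n ρJ) ∧
      (∃! ρr : SphereMCG (n + 1) →* ProjStateUnitary r n 1, IsSphereAction r n a ρr) ∧
      ∀ (ρJ : BraidGroup n →* Matrix.unitaryGroup (Tab r μ n) ℂ)
        (ρr : SphereMCG (n + 1) →* ProjStateUnitary r n 1),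
        IsJonesSector r (a ^ 4) μ n ρJ → IsSphereAction r n a ρr →
        ∃ S : StateSpace r n 1 ≃ₗ[ℂ] (Tab r μ n → ℂ), IsUnitaryIso r n 1 S ∧
          ∀ (b : BraidGroup n) (u : stateUnitary r n 1),
            (QuotientGroup.mk u : ProjStateUnitary r n 1) = ρr (braidToSphere n b) →
            ∃ z : Circle, ∀ v : StateSpace r n 1,
              S (u.1 v) = (z : ℂ) • Matrix.mulVec (ρJ b).1 (S v)) := by
  have ha0 : a ≠ 0 := by
    rintro rfl
    exact loopValue_ne_zero hr (by rw [← hloop]; simp)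
  have ha : IsKauffmanParameter (loopValue r) a := ⟨ha0, hloop⟩
  constructor
  · intro n m hm hmn heven μ
    obtain ⟨k, hk⟩ := heven
    exact ⟨IsJonesSector.existsUnique hr (m := m) (by omega) (by omega) (by omega) ha,
      IsBraidAction.existsUnique ha, fun ρJ ρr hρJ hρr =>
        hρr.exists_unitaryIso hr (by omega) (by omega) (by omega) ha hρJ⟩
  · intro n hn μ
    have ⟨k, hk⟩ := hn
    exact ⟨IsJonesSector.existsUnique hr (m := 1) (by omega) (by omega) (by omega) ha,
      IsSphereAction.existsUnique hr hn ha, fun ρJ ρr hρJ hρr =>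
        hρr.exists_unitaryIso hr (by omega) (by omega) ha hρJ⟩

open CSJones in
theorem theorem3p2 (r : ℕ) (hr : 3 ≤ r) (a q : ℂ)
    (haq : (a = (kauffmanA r)⁻¹ ∧ q = Complex.exp (2 * Real.pi * Complex.I / r)) ∨
      (a = kauffmanA r ∧ q = kauffmanA r ^ 4)) :
    (∀ (n m : ℕ) (_ : m ≤ r - 2) (hmn : m ≤ n), m ≠ 1 → Even (m + n) →
      let μ : YoungDiagram := twoRowDiagram ((m + n) / 2) ((n - m) / 2) (by omega)
      (∃! ρJ : BraidGroup n →* Matrix.unitaryGroup (Tab r μ n) ℂ, IsJonesSector r q μ n ρJ) ∧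
      (∃! ρr : BraidGroup n →* stateUnitary r n m, IsBraidAction r n m a ρr) ∧
      ∀ (ρJ : BraidGroup n →* Matrix.unitaryGroup (Tab r μ n) ℂ)
        (ρr : BraidGroup n →* stateUnitary r n m),
        IsJonesSector r q μ n ρJ → IsBraidAction r n m a ρr →
        ∃ S : StateSpace r n m ≃ₗ[ℂ] (Tab r μ n → ℂ), IsUnitaryIso r n m S ∧
          ∃ χ : BraidGroup n →* Circle, ∀ (b : BraidGroup n) (v : StateSpace r n m),
            S ((ρr b).1 v) = (χ b : ℂ) • Matrix.mulVec (ρJ b).1 (S v)) ∧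
    (∀ n : ℕ, Odd n →
      let μ : YoungDiagram := twoRowDiagram ((n + 1) / 2) ((n - 1) / 2) (by omega)
      (∃! ρJ : BraidGroup n →* Matrix.unitaryGroup (Tab r μ n) ℂ, IsJonesSector r q μ n ρJ) ∧
      (∃! ρr : SphereMCG (n + 1) →* ProjStateUnitary r n 1, IsSphereAction r n a ρr) ∧
      ∀ (ρJ : BraidGroup n →* Matrix.unitaryGroup (Tab r μ n) ℂ)
        (ρr : SphereMCG (n + 1) →* ProjStateUnitary r n 1),
        IsJonesSector r q μ n ρJ → IsSphereAction r n a ρr →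
        ∃ S : StateSpace r n 1 ≃ₗ[ℂ] (Tab r μ n → ℂ), IsUnitaryIso r n 1 S ∧
          ∀ (b : BraidGroup n) (u : stateUnitary r n 1),
            (QuotientGroup.mk u : ProjStateUnitary r n 1) = ρr (braidToSphere n b) →
            ∃ z : Circle, ∀ v : StateSpace r n 1,
              S (u.1 v) = (z : ℂ) • Matrix.mulVec (ρJ b).1 (S v)) := by
  obtain ⟨ha, rfl⟩ : IsKauffmanParameter (loopValue r) a ∧ q = a ^ 4 := by
    rcases haq with ⟨rfl, rfl⟩ | ⟨rfl, rfl⟩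
    · exact ⟨(isKauffmanParameter_kauffmanA r).inv, (inv_kauffmanA_pow_four r).symm⟩
    · exact ⟨isKauffmanParameter_kauffmanA r, rfl⟩
  have h := theorem3p2_general r hr a ha.loop_eq
  exact ⟨fun n m hm hmn _ => h.1 n m hm hmn, h.2⟩
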